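/- **Setting.** Let $(\mathcal S,\mathcal A,r,c,P,\rho)$ be a finite constrained MDP with $r\in[0,1]$, $c\in[-1,1]$, let $\pi_\theta$ be policies parameterized by $\theta\in\mathbb R^d$, let $\Theta\subseteq\mathbb R^d$, and for $g\in\{r,c\}$ let $\phi_g:\mathcal S\to\mathbb R^{m_g}$ satisfy $\|\phi_g(s)\|\le 1$. Write $J_g(\theta)$ for the average of $g$ under $\pi_\theta$. Assume, for all $\theta\in\Theta$: * the chain $P^{\pi_\theta}$ has a single recurrent class $\mathcal S_R^\theta$; let $d^\theta$ be its stationary distribution and $\mathbb E_\theta$ the expectation over $s\sim d^\theta$, $a\sim\pi_\theta(\cdot|s)$, $s'\sim P(\cdot|s,a)$; * (Slater) $J_c(\bar\theta)\ge\delta$ for some $\bar\theta\in\Theta$, where $\delta\in(0,1)$; * with $M_\theta^g=\mathbb E_\theta[\phi_g(s)(\phi_g(s)-\phi_g(s'))^\top]$, there are $\lambda_g>0$ with $x^\top M^g_\theta x\ge\lambda_g\|x\|^2$ for $x\in\ker(M_\theta^g)^\perp$; put $\lambda=\min\{\lambda_r,\lambda_c\}$ and suppose $\lambda\le 1$; *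 $\pi_\theta(a|s)>0$ is differentiable in $\theta$, and the score $\nabla_\theta\log\pi_\theta(a|s)$ is bounded by $G_1$ and $G_2$-Lipschitz on $\Theta$; * the Fisher matrix satisfies $F(\theta)\succeq\mu I$, with $\mu>0$ independent of $\theta$. Let $C_{\rm tar}=\sup_{\theta\in\Theta}\sum_{s'}d^\theta(s')\,\mathbb E^\theta_s[T_{s'}]$ (with $s\in\mathcal S_R^\theta$ arbitrary and $T_{s'}=\inf\{t\ge 0:s_t=s'\}$), and assume $0<C_{\rm tar}<\infty$. **Algorithm.** Start from $s_0\sim\rho$, a parameter $\theta_0$ and the dual variable $\lambda_0=0$. For $k=0,\dots,K-1$, epoch $k$ runs one trajectory under $\pi_{\theta_k}$, continuing from the last state of the previous epoch: $B$ burn-in steps, then $H$ critic batches, then $H$ natural-policy-gradient (NPG) batches. A batch draws $Q\in\{1,2,\dots\}$ with $\Pr(Q=j)=2^{-j}$ and then $2^Q$ transitions $z=(s,a,s')$ if $2^Q\le T_{\max}$, and one transition otherwise. For a function $v$ of a transition, its multi-level (MLMC) estimate from the batch is $\hat v=v^0+\mathbb 1\{2^Q\le T_{\max}\}\,2^Q(v^Q-v^{Q-1})$,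 where $v^j$ is the average of $v$ over the first $2^j$ transitions. The critic iterates are $\xi^k_{g,0}=0$ and $\xi^k_{g,h+1}=\xi^k_{g,h}-\gamma_\xi\hat v$ with $v(z)=\mathbf A_g(z)\xi^k_{g,h}-\mathbf b_g(z)$, $$\mathbf A_g(z)=\begin{bmatrix}c_\gamma&0\\ \phi_g(s)&\phi_g(s)(\phi_g(s)-\phi_g(s'))^\top\end{bmatrix},\qquad \mathbf b_g(z)=\begin{bmatrix}c_\gamma g(s,a)\\ g(s,a)\phi_g(s)\end{bmatrix}.$$ Write $\xi^k_{g,H}=(\eta^k_g,\zeta^k_g)$ with $\eta^k_g\in\mathbb R$. The NPG iterates are $\omega^k_{g,0}=0$ and $\omega^k_{g,h+1}=\omega^k_{g,h}-\gamma_\omega\hat u$ with $$u(z)=\psi\psi^\top\omega^k_{g,h}-\big(g(s,a)-\eta^k_g+(\zeta^k_g)^\top(\phi_g(s')-\phi_g(s))\big)\psi,\qquad \psi=\nabla_\theta\log\pi_{\theta_k}(a|s).$$ Then $\theta_{k+1}=\theta_k+\alpha(\omega^k_{r,H}+\lambda_k\omega^k_{c,H})$, and $\lambda_{k+1}$ is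 the projection of $\lambda_k-\beta\eta^k_c$ onto $[0,2/\delta]$. Assume that $\theta_k\in\Theta$ almost surely for all $k<K$. **Notation.** $\mathcal E_B$ is the event that in every epoch $k<K$ one of the states at times $0,\dots,B$ of the burn-in lies in $\mathcal S_R^{\theta_k}$. $\mathbb E_k$ is the conditional expectation given the whole history before epoch $k$. $\xi^*_g(\theta)=\mathbf A_g(\theta)^\dagger\mathbf b_g(\theta)$ with $\mathbf A_g(\theta)=\mathbb E_\theta[\mathbf A_g(z)]$, $\mathbf b_g(\theta)=\mathbb E_\theta[\mathbf b_g(z)]$. $\Pi(\eta,\zeta)=(\eta,\mathrm{proj}_{\ker(M^g_{\theta_k})^\perp}\zeta)$. **Theorem.** There are universal constants $a,b,L>0$ and $q\in\mathbb N$ such that the following holds for all $T\ge2$, $T_{\max}\ge2$, $H\ge1$. Suppose $c_\gamma\ge\lambda+\sqrt{1/\lambda^2-1}$ and $$\gamma_\xi=\frac{8\log T}{\lambda H}\le\frac{\lambda}{a\,c_\gamma^2C_{\rm tar}^2\log T_{\max}},\qquad T_{\max}\ge\frac{b\,c_\gamma^2C_{\rm tar}^2}{\lambda}.$$ Then for both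 $g\in\{r,c\}$, every $k<K$ and every history before epoch $k$ that has positive probability together with $\mathcal E_B$, the iterate $\xi^k_{g,H}$ is square integrable under the conditional law, and with $\Lambda=L(\log T\,\log T_{\max})^q$, $$\mathbb E_k\big[\|\Pi(\xi^k_{g,H}-\xi^*_g(\theta_k))\|^2\mid\mathcal E_B\big]\le\Lambda\Big(\frac{c_\gamma^2}{\lambda^2T^2}+\frac{c_\gamma^4C_{\rm tar}^2}{\lambda^4}\Big(\frac1H+\frac1{T_{\max}}\Big)\Big),$$ $$\big\|\Pi\big(\mathbb E_k[\xi^k_{g,H}\mid\mathcal E_B]-\xi^*_g(\theta_k)\big)\big\|^2\le\Lambda\Big(\frac{c_\gamma^2}{\lambda^2T^2}+\frac{c_\gamma^4C_{\rm tar}^2}{\lambda^4T_{\max}}\Big).$$ In particular, if $T_{\max}\le H$, the mean-square error also satisfies the second bound $\Lambda\big(\frac{c_\gamma^2}{\lambda^2T^2}+\frac{c_\gamma^4C_{\rm tar}^2}{\lambda^4T_{\max}}\big)$. -/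

import Mathlib

open MeasureTheory ProbabilityTheory
open scoped ENNReal

namespace UnichainCMDP

/-- The two signals of a constrained MDP: the reward `r` and the constraint cost `c`. -/
inductive Signal
  | r
  | c

/-- A constrained Markov decision process. -/
structure CMDP (S A : Type*) where
  reward : S → A → ℝ
  cost : S → A → ℝ
  trans : S → A → PMF S
  init : PMF S
  reward_mem : ∀ s a, reward s a ∈ Set.Icc (0 : ℝ) 1
  cost_mem : ∀ s a, cost s a ∈ Set.Icc (-1 : ℝ) 1

/-- A CMDP with a parameterized policy class and one feature map for each signal. -/
structure Model (S A : Type*) (d : ℕ) (m : Signal → ℕ) extends CMDP S A where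
  policy : EuclideanSpace ℝ (Fin d) → S → PMF A
  feature : (g : Signal) → S → EuclideanSpace ℝ (Fin (m g))

section Chain

variable {S A : Type*} (M : CMDP S A) (π : S → PMF A)

/-- The signal `g ∈ {r, c}`. -/
def CMDP.signal : Signal → S → A → ℝ
  | .r => M.reward
  | .c => M.cost

/-- The transition law `P^π(s, ·) = ∑ₐ π(a|s) P(·|s, a)`. -/
noncomputable def CMDP.chain (s : S) : PMF S := (π s).bind (M.trans s)

/-- `s'` is reachable from `s` (in zero or more steps) with positive probability. -/
def CMDP.Reaches : S → S → Prop :=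
  Relation.ReflTransGen fun x y => M.chain π x y ≠ 0

/-- The recurrent states of the (finite) chain: those that can be reached back from every state
they lead to. When the chain has a single recurrent class, this set is that class. -/
def CMDP.recurrentStates : Set S :=
  {s | ∀ s', M.Reaches π s s' → M.Reaches π s' s}

/-- The chain has a single recurrent class (a finite chain always has at least one). -/
def CMDP.IsUnichain : Prop :=
  ∀ s ∈ M.recurrentStates π, ∀ s' ∈ M.recurrentStates π, M.Reaches π s s'

open Classical in
/-- The stationary distribution `d^π`, i.e. the probability vector with `(P^π)ᵀ d^π = d^π`
(it exists because the chain is finite, and is unique when the chain is unichain). -/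
noncomputable def CMDP.statDist : PMF S :=
  if h : ∃ ν : PMF S, ν.bind (M.chain π) = ν then h.choose else M.init

open Classical in
/-- `Pr_s(T_y > n)`, where `T_y = inf {t ≥ 0 : s_t = y}`: none of `s_0 = s, …, s_n` equals `y`. -/
noncomputable def CMDP.avoidProb [Fintype S] (y : S) : ℕ → S → ℝ≥0∞
  | 0, s => if s = y then 0 else 1
  | n + 1, s => if s = y then 0 else ∑ s', M.chain π s s' * CMDP.avoidProb y n s'

/-- The expected hitting time `E_s[T_y] = ∑_{n ≥ 0} Pr_s(T_y > n)`. -/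
noncomputable def CMDP.hitTime [Fintype S] (s y : S) : ℝ≥0∞ :=
  ∑' n, M.avoidProb π y n s

/-- `C_tar^π = ∑_y d^π(y) E_s[T_y]` for a recurrent state `s`. The sum is the same for all
recurrent `s` (random target identity), so the supremum over them only avoids a choice. -/
noncomputable def CMDP.targetTime [Fintype S] : ℝ≥0∞ :=
  ⨆ s ∈ M.recurrentStates π, ∑ y, M.statDist π y * M.hitTime π s y

/-- The expectation of `f(s, a, s')` over `s ∼ d^π`, `a ∼ π(·|s)`, `s' ∼ P(·|s, a)`. -/
noncomputable def CMDP.statExp [Fintype S] [Fintype A] {E : Type*} [AddCommMonoid E] [Module ℝ E]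
    (f : S → A → S → E) : E :=
  ∑ s, ∑ a, ∑ s', ((M.statDist π s).toReal * (π s a).toReal * (M.trans s a s').toReal) • f s a s'

/-- The average value `J_g^π = E_{s ∼ d^π, a ∼ π(·|s)}[g(s, a)]`. -/
noncomputable def CMDP.average [Fintype S] [Fintype A] (g : Signal) : ℝ :=
  M.statExp π fun s a _ => M.signal g s a

end Chain

section Critic

variable {S A E : Type*} [NormedAddCommGroup E] [InnerProductSpace ℝ E]

/-- Critic vectors `ξ = (η, ζ)` with the Euclidean norm `‖ξ‖² = η² + ‖ζ‖²`. -/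
abbrev CriticVec (E : Type*) := WithLp 2 (ℝ × E)

/-- The matrix `u vᵀ` as a linear map. -/
noncomputable def outer (u v : E) : E →ₗ[ℝ] E where
  toFun x := inner ℝ v x • u
  map_add' x y := by rw [inner_add_right, add_smul]
  map_smul' t x := by rw [inner_smul_right, mul_smul, RingHom.id_apply]

/-- The block matrix `[[c_γ, 0], [φ(s), φ(s) (φ(s) - φ(s'))ᵀ]]`. -/
noncomputable def criticA (cγ : ℝ) (φ : S → E) (s s' : S) : CriticVec E →ₗ[ℝ] CriticVec E where
  toFun ξ := WithLp.toLp 2 (cγ * ξ.fst, ξ.fst • φ s + outer (φ s) (φ s - φ s') ξ.snd)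
  map_add' x y := by
    apply (WithLp.ofLp_injective 2)
    ext1
    · simp [mul_add]
    · simp only [WithLp.add_fst, WithLp.add_snd, map_add, add_smul, WithLp.ofLp_add, Prod.snd_add]
      abel
  map_smul' t x := by
    apply (WithLp.ofLp_injective 2)
    ext1
    · simp [mul_left_comm]
    · simp [mul_smul]

/-- The vector `(c_γ g(s, a), g(s, a) φ(s))`, where `x` is the value `g(s, a)`. -/
noncomputable def criticB (cγ : ℝ) (φ : S → E) (x : ℝ) (s : S) : CriticVec E :=
  WithLp.toLp 2 (cγ * x, x • φ s)

/-- The Moore–Penrose pseudo-inverse `L†`: project orthogonally onto the range of `L`, then take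
the preimage that lies in `(ker L)ᗮ`. -/
noncomputable def pinv {F : Type*} [NormedAddCommGroup F] [InnerProductSpace ℝ F]
    [FiniteDimensional ℝ F] (L : F →ₗ[ℝ] F) : F →ₗ[ℝ] F :=
  (LinearMap.ker L)ᗮ.subtype ∘ₗ
    (L.kerComplementEquivRange
      (C := (LinearMap.ker L)ᗮ) (LinearMap.ker L).isCompl_orthogonal.symm).symm.toLinearMap ∘ₗ
    (LinearMap.range L).orthogonalProjectionOnto.toLinearMap

end Critic

section Data

/-- The score `∇_θ log π_θ(a|s)`. -/
noncomputable def Model.score {S A : Type*} {d : ℕ} {m : Signal → ℕ} (M : Model S A d m)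
    (θ : EuclideanSpace ℝ (Fin d)) (s : S) (a : A) :
    EuclideanSpace ℝ (Fin d) :=
  gradient (fun θ' => Real.log (M.policy θ' s a).toReal) θ

variable {S A : Type*} [Fintype S] [Fintype A] {d : ℕ} {m : Signal → ℕ} (M : Model S A d m)

/-- The feature matrix `M_θ^g = E_θ[φ_g(s) (φ_g(s) - φ_g(s'))ᵀ]`. -/
noncomputable def Model.featureMatrix (g : Signal) (θ : EuclideanSpace ℝ (Fin d)) :
    EuclideanSpace ℝ (Fin (m g)) →ₗ[ℝ] EuclideanSpace ℝ (Fin (m g)) :=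
  M.statExp (M.policy θ) fun s _ s' => outer (M.feature g s) (M.feature g s - M.feature g s')

/-- The stationary critic matrix `A_g(θ)`. -/
noncomputable def Model.meanA (cγ : ℝ) (g : Signal) (θ : EuclideanSpace ℝ (Fin d)) :
    CriticVec (EuclideanSpace ℝ (Fin (m g))) →ₗ[ℝ] CriticVec (EuclideanSpace ℝ (Fin (m g))) :=
  M.statExp (M.policy θ) fun s _ s' => criticA cγ (M.feature g) s s'

/-- The stationary critic vector `b_g(θ)`. -/
noncomputable def Model.meanB (cγ : ℝ) (g : Signal) (θ : EuclideanSpace ℝ (Fin d)) :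
    CriticVec (EuclideanSpace ℝ (Fin (m g))) :=
  M.statExp (M.policy θ) fun s a _ => criticB cγ (M.feature g) (M.signal g s a) s

/-- The critic target `ξ*_g(θ) = A_g(θ)† b_g(θ)`. -/
noncomputable def Model.criticTarget (cγ : ℝ) (g : Signal) (θ : EuclideanSpace ℝ (Fin d)) :
    CriticVec (EuclideanSpace ℝ (Fin (m g))) :=
  pinv (M.meanA cγ g θ) (M.meanB cγ g θ)

/-- The projection `Π(η, ζ) = (η, proj ζ)`, with `proj` the orthogonal projection onto
`ker(M_θ^g)ᗮ`. -/
noncomputable def Model.proj (g : Signal) (θ : EuclideanSpace ℝ (Fin d))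
    (ξ : CriticVec (EuclideanSpace ℝ (Fin (m g)))) :
    CriticVec (EuclideanSpace ℝ (Fin (m g))) :=
  WithLp.toLp 2 (ξ.fst, (LinearMap.ker (M.featureMatrix g θ))ᗮ.starProjection ξ.snd)

/-- The Fisher information matrix `F(θ)`. -/
noncomputable def Model.fisher (θ : EuclideanSpace ℝ (Fin d)) :
    EuclideanSpace ℝ (Fin d) →ₗ[ℝ] EuclideanSpace ℝ (Fin d) :=
  M.statExp (M.policy θ) fun s a _ => outer (M.score θ s a) (M.score θ s a)

/-- `C_tar`, the supremum of `C_tar^θ` over the parameter set. -/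
noncomputable def Model.Ctar (Θ : Set (EuclideanSpace ℝ (Fin d))) : ℝ≥0∞ :=
  ⨆ θ ∈ Θ, M.targetTime (M.policy θ)

/-- The standing assumptions on the model, with constants `δ`, `λ_g`, `G₁`, `G₂`, `μ`. -/
structure Model.Assumptions (Θ : Set (EuclideanSpace ℝ (Fin d))) (δ : ℝ) (lam : Signal → ℝ)
    (G₁ G₂ μ : ℝ) : Prop where
  unichain : ∀ θ ∈ Θ, M.IsUnichain (M.policy θ)
  slater_mem : δ ∈ Set.Ioo (0 : ℝ) 1
  slater : ∃ θ ∈ Θ, δ ≤ M.average (M.policy θ) .c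
  feature_le : ∀ g s, ‖M.feature g s‖ ≤ 1
  lam_pos : ∀ g, 0 < lam g
  critic_lower : ∀ g, ∀ θ ∈ Θ, ∀ x ∈ (LinearMap.ker (M.featureMatrix g θ))ᗮ,
    lam g * ‖x‖ ^ 2 ≤ inner ℝ x (M.featureMatrix g θ x)
  /-- Existence of the score functions. -/
  policy_pos : ∀ θ ∈ Θ, ∀ s a, 0 < (M.policy θ s a).toReal
  policy_diff : ∀ θ ∈ Θ, ∀ s a, DifferentiableAt ℝ (fun θ' => (M.policy θ' s a).toReal) θ
  score_le : ∀ θ ∈ Θ, ∀ s a, ‖M.score θ s a‖ ≤ G₁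
  score_lipschitz : ∀ θ ∈ Θ, ∀ θ' ∈ Θ, ∀ s a, ‖M.score θ s a - M.score θ' s a‖ ≤ G₂ * ‖θ - θ'‖
  fisher_pos : 0 < μ
  fisher_lower : ∀ θ ∈ Θ, ∀ x, μ * ‖x‖ ^ 2 ≤ inner ℝ x (M.fisher θ x)

end Data

/-! ### The algorithm -/

/-- A transition `z = (s, a, s')`. -/
abbrev Transition (S A : Type*) := S × A × S

/-- The samples of one multi-level Monte Carlo batch: the geometric level and the trajectory. -/
structure Batch (S A : Type*) where
  level : ℕ
  path : List (Transition S A)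

/-- All samples drawn in one epoch: burn-in trajectory, critic batches, NPG batches. -/
structure EpochSample (S A : Type*) where
  burn : List (Transition S A)
  critic : List (Batch S A)
  npg : List (Batch S A)

/-- The inputs of the algorithm other than the number of epochs. -/
structure Params (d : ℕ) where
  θ₀ : EuclideanSpace ℝ (Fin d)
  α : ℝ
  β : ℝ
  γξ : ℝ
  γω : ℝ
  cγ : ℝ
  δ : ℝ
  H : ℕ
  B : ℕ
  Tmax : ℕ

/-- Policy parameter, dual variable and current state of the CMDP at the start of an epoch. -/
structure AlgState (S : Type*) (d : ℕ) where
  θ : EuclideanSpace ℝ (Fin d)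
  dual : ℝ
  pos : S

/-- A run of the algorithm: the initial state and the samples of the epochs, in order. -/
structure Run (S A : Type*) where
  start : S
  epochs : List (EpochSample S A)

/-- Runs are discrete objects: every set of runs is measurable. -/
instance (S A : Type*) : MeasurableSpace (Run S A) := ⊤

/-- The final state of a trajectory that starts in `s`. -/
def endState {S A : Type*} (s : S) (τ : List (Transition S A)) : S :=
  τ.foldl (fun _ z => z.2.2) s

/-- The final state after consecutive batches. -/
def endStateB {S A : Type*} (s : S) (l : List (Batch S A)) : S :=
  l.foldl (fun x b => endState x b.path) s

section Sampling

variable {S A : Type*} (M : CMDP S A) (π : S → PMF A)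

/-- The geometric law `Geom(1/2)` on `{1, 2, …}`: `Pr(Q = j) = 2⁻ʲ`. -/
noncomputable def geomHalf : PMF ℕ :=
  ⟨fun j => if j = 0 then 0 else (2⁻¹ : ℝ≥0∞) ^ j, by
    have h : ∑' j : ℕ, (if j = 0 then 0 else (2⁻¹ : ℝ≥0∞) ^ j) = 1 := by
      rw [tsum_eq_zero_add' ENNReal.summable]
      simp [ENNReal.tsum_geometric_add_one, ENNReal.inv_mul_cancel]
    rw [← h]
    exact ENNReal.summable.hasSum⟩

/-- The law of the first `n` transitions under `π` from the state `s`. -/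
noncomputable def pathLaw : ℕ → S → PMF (List (Transition S A))
  | 0, _ => PMF.pure []
  | n + 1, s => (π s).bind fun a => (M.trans s a).bind fun s' =>
      (pathLaw n s').map fun τ => (s, a, s') :: τ

/-- The trajectory length `(2^Q - 1) 𝟙(2^Q ≤ Tmax) + 1`. -/
def batchLength (Tmax Q : ℕ) : ℕ := if 2 ^ Q ≤ Tmax then 2 ^ Q else 1

/-- One batch: draw `Q ∼ Geom(1/2)`, then a trajectory of the corresponding length. -/
noncomputable def batchLaw (Tmax : ℕ) (s : S) : PMF (Batch S A) :=
  geomHalf.bind fun Q => (pathLaw M π (batchLength Tmax Q) s).map fun τ => ⟨Q, τ⟩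

/-- Consecutive batches; each starts in the final state of the previous one. -/
noncomputable def batchesLaw (Tmax : ℕ) : ℕ → S → PMF (List (Batch S A))
  | 0, _ => PMF.pure []
  | n + 1, s => (batchLaw M π Tmax s).bind fun b =>
      (batchesLaw Tmax n (endState s b.path)).map fun l => b :: l

/-- All samples of one epoch that starts in the state `s`. -/
noncomputable def epochLaw (B H Tmax : ℕ) (s : S) : PMF (EpochSample S A) :=
  (pathLaw M π B s).bind fun τ =>
    (batchesLaw M π Tmax H (endState s τ)).bind fun l =>
      (batchesLaw M π Tmax H (endStateB (endState s τ) l)).map fun l' => ⟨τ, l, l'⟩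

end Sampling

section Estimators

variable {S A E : Type*} [AddCommGroup E] [Module ℝ E]

/-- The average of `v` over the first `2^j` transitions. -/
noncomputable def levelAvg (v : Transition S A → E) (τ : List (Transition S A)) (j : ℕ) : E :=
  ((2 : ℝ) ^ j)⁻¹ • ((τ.take (2 ^ j)).map v).sum

/-- The multi-level Monte Carlo estimate built from one batch. -/
noncomputable def mlmc (Tmax : ℕ) (v : Transition S A → E) (b : Batch S A) : E :=
  levelAvg v b.path 0 +
    if 2 ^ b.level ≤ Tmax then
      (2 : ℝ) ^ b.level • (levelAvg v b.path b.level - levelAvg v b.path (b.level - 1))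
    else 0

end Estimators

section Algorithm

variable {S A : Type*} {d : ℕ} {m : Signal → ℕ} (M : Model S A d m) (p : Params d)

/-- The critic output `ξ_{g,H}`: starting from `ξ_{g,0} = 0`, one step for each batch. -/
noncomputable def Model.criticOut (g : Signal) (l : List (Batch S A)) :
    CriticVec (EuclideanSpace ℝ (Fin (m g))) :=
  l.foldl (fun ξ b => ξ - p.γξ • mlmc p.Tmax (fun z =>
    criticA p.cγ (M.feature g) z.1 z.2.2 ξ
      - criticB p.cγ (M.feature g) (M.signal g z.1 z.2.1) z.1) b) 0

/-- The temporal-difference estimate of the advantage. -/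
noncomputable def Model.advantage (g : Signal) (ξ : CriticVec (EuclideanSpace ℝ (Fin (m g))))
    (z : Transition S A) : ℝ :=
  M.signal g z.1 z.2.1 - ξ.fst + inner ℝ ξ.snd (M.feature g z.2.2 - M.feature g z.1)

/-- The natural policy gradient estimate `ω_{g,H}`, from `ω_{g,0} = 0` and the critic `ξ`. -/
noncomputable def Model.npgOut (g : Signal) (θ : EuclideanSpace ℝ (Fin d))
    (ξ : CriticVec (EuclideanSpace ℝ (Fin (m g)))) (l : List (Batch S A)) :
    EuclideanSpace ℝ (Fin d) :=
  l.foldl (fun ω b => ω - p.γω • mlmc p.Tmax (fun z =>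
    outer (M.score θ z.1 z.2.1) (M.score θ z.1 z.2.1) ω
      - M.advantage g ξ z • M.score θ z.1 z.2.1) b) 0

/-- The policy, dual and state update at the end of an epoch with samples `e`. -/
noncomputable def Model.update (x : AlgState S d) (e : EpochSample S A) : AlgState S d where
  θ := x.θ + p.α • (M.npgOut p .r x.θ (M.criticOut p .r e.critic) e.npg
    + x.dual • M.npgOut p .c x.θ (M.criticOut p .c e.critic) e.npg)
  dual := max 0 (min (2 / p.δ) (x.dual - p.β * (M.criticOut p .c e.critic).fst))
  pos := endStateB (endStateB (endState x.pos e.burn) e.critic) e.npg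

/-- The state of the algorithm after the epochs of a run. -/
noncomputable def Model.stateAfter (ω : Run S A) : AlgState S d :=
  ω.epochs.foldl (M.update p) ⟨p.θ₀, 0, ω.start⟩

/-- The law of the first `k` epochs of the algorithm. -/
noncomputable def Model.runLaw : ℕ → PMF (Run S A)
  | 0 => M.init.map fun s => ⟨s, []⟩
  | k + 1 => (Model.runLaw k).bind fun ω =>
      (epochLaw M.toCMDP (M.policy (M.stateAfter p ω).θ) p.B p.H p.Tmax
        (M.stateAfter p ω).pos).map fun e => ⟨ω.start, ω.epochs ++ [e]⟩

/-- The history of a run before epoch `k`: the initial state and all samples of the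
epochs `0, …, k - 1`. -/
def Run.history (k : ℕ) (ω : Run S A) : Run S A := ⟨ω.start, ω.epochs.take k⟩

/-- The samples of epoch `k` (empty if the run is shorter). -/
def Run.epoch (k : ℕ) (ω : Run S A) : EpochSample S A := ω.epochs.getD k ⟨[], [], []⟩

/-- The event `T^{θ_k} ≤ B`: in epoch `k` one of the states `s_k^0, …, s_k^B` of the burn-in
belongs to the recurrent class of the chain under `π_{θ_k}`. -/
def Model.hitEvent (k : ℕ) : Set (Run S A) :=
  {ω | ∃ s ∈ (M.stateAfter p (ω.history k)).pos :: (ω.epoch k).burn.map (fun z => z.2.2),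
    s ∈ M.recurrentStates (M.policy (M.stateAfter p (ω.history k)).θ)}

/-- The burn-in event `E_B = ⋂_{k < K} {T^{θ_k} ≤ B}`. -/
def Model.burnInEvent (K : ℕ) : Set (Run S A) := ⋂ k ∈ Finset.range K, M.hitEvent p k

/-- The law of a run of `K` epochs conditioned on `E_B` and on the history `h` before epoch `k`;
integrals against it are the values of `E_k[ · | E_B]`. -/
noncomputable def Model.condLaw (K k : ℕ) (h : Run S A) : Measure (Run S A) :=
  ProbabilityTheory.cond (M.runLaw p K).toMeasure ({ω | ω.history k = h} ∩ M.burnInEvent p K)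

/-- The critic iterate `ξ^k_{g,H}` of epoch `k`. -/
noncomputable def Model.criticIterate (g : Signal) (k : ℕ) (ω : Run S A) :
    CriticVec (EuclideanSpace ℝ (Fin (m g))) :=
  M.criticOut p g (ω.epoch k).critic

end Algorithm

end UnichainCMDP

/-!
The critic is a linear stochastic approximation driven by trajectories of a Markov chain that need
not be aperiodic, so no mixing rate is available. Three facts replace it.

*Reduction to one epoch.* All policies have full support, so all chains share one recurrent class,
and a run that has entered it never leaves it. Given the history before an epoch, the burn-in
event therefore only constrains the burn-in of that epoch (`mem_burnInEvent_iff`), and under the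
conditional law the critic batches are those of a fresh chain with a random starting state in the
recurrent class (`exists_condLaw_weights`).

*Ergodic averages.* On the recurrent class the Poisson equation for a function `f` of the states
has the solution `-∑_y d(y) E_x[T_y] f(y)`, by Kac's formula, and its size is at most the target
time times `sup |f|` (`exists_poisson`). Consequently an average over `n` transitions has bias
`O(C / n)` and mean square deviation `O(C² / n)`. The multi-level estimate has the mean of an
average over `≈ Tmax` transitions, hence bias `O(C / Tmax)` (`norm_ev_mlmc_sub_le`), while its
second moment is only `O(C² log Tmax)`, each of the `log₂ Tmax` levels contributing equally
(`ev_mlmc_sq_le`).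

*Contraction.* The quadratic form of the feature matrix is a Dirichlet form, so a vector of its
kernel has constant inner product with the features on the recurrent class. Hence a critic update
sees only the projected iterate (`criticA_proj`), the critic equation is solvable
(`meanB_mem_range`), and the critic matrix is coercive on the range of `Π` with constant `λ / 2`,
the lower bound on `cγ` absorbing the off-diagonal block (`inner_meanA_ge`). With `e = Π(ξ - ξ*)`,
one batch gives `E‖e'‖² ≤ (1 - γλ/2) ‖e‖² + γ · (squared bias / λ + γ · second moment)`
(`ev_criticErr_step_sq_le`), and the mean of `e` contracts up to the bias alone
(`norm_ev_criticErr_le`). Iterating `H` times with `γ λ H = 8 log T` yields the two rates.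
-/

set_option linter.unusedSectionVars false

namespace UnichainCMDP

/-! ### Expectations of bounded functions under discrete laws -/

section Expectation

variable {α β E F : Type*} [NormedAddCommGroup E] [NormedSpace ℝ E]
  [NormedAddCommGroup F] [NormedSpace ℝ F]

/-- The expectation `∑ₓ p(x) f(x)` of a vector-valued function under a discrete law. It is
meaningful when `f` is bounded on the support of `p`. -/
noncomputable def ev (p : PMF α) (f : α → E) : E := ∑' x, (p x).toReal • f x

/-- `f` is bounded on the support of `p`. -/
def BddOn (p : PMF α) (f : α → E) : Prop := ∃ C, ∀ x ∈ p.support, ‖f x‖ ≤ C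

lemma hasSum_toReal (p : PMF α) : HasSum (fun x => (p x).toReal) 1 := by
  have h := ENNReal.hasSum_toReal (f := p) p.tsum_coe_ne_top
  rwa [← ENNReal.tsum_toReal_eq p.apply_ne_top, p.tsum_coe, ENNReal.toReal_one] at h

lemma toReal_eq_zero_of_notMem {p : PMF α} {x : α} (h : x ∉ p.support) : (p x).toReal = 0 := by
  rw [(p.apply_eq_zero_iff x).2 h, ENNReal.toReal_zero]

lemma BddOn.summable_norm {p : PMF α} {f : α → E} (h : BddOn p f) :
    Summable fun x => ‖(p x).toReal • f x‖ := by
  obtain ⟨C, hC⟩ := h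
  refine Summable.of_nonneg_of_le (fun _ => norm_nonneg _) (fun x => ?_)
    ((hasSum_toReal p).summable.mul_right C)
  by_cases hx : x ∈ p.support
  · rw [norm_smul, Real.norm_of_nonneg ENNReal.toReal_nonneg]
    exact mul_le_mul_of_nonneg_left (hC x hx) ENNReal.toReal_nonneg
  · simp [toReal_eq_zero_of_notMem hx]

lemma BddOn.summable [CompleteSpace E] {p : PMF α} {f : α → E} (h : BddOn p f) :
    Summable fun x => (p x).toReal • f x :=
  h.summable_norm.of_norm

lemma BddOn.add {p : PMF α} {f g : α → E} (hf : BddOn p f) (hg : BddOn p g) :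
    BddOn p fun x => f x + g x := by
  obtain ⟨C, hC⟩ := hf
  obtain ⟨D, hD⟩ := hg
  exact ⟨C + D, fun x hx => (norm_add_le _ _).trans (add_le_add (hC x hx) (hD x hx))⟩

lemma BddOn.clm {p : PMF α} {f : α → E} (hf : BddOn p f) (L : E →L[ℝ] F) :
    BddOn p fun x => L (f x) := by
  obtain ⟨C, hC⟩ := hf
  exact ⟨‖L‖ * C, fun x hx => (L.le_opNorm _).trans
    (mul_le_mul_of_nonneg_left (hC x hx) (norm_nonneg _))⟩

lemma BddOn.const_smul {p : PMF α} {f : α → E} (hf : BddOn p f) (t : ℝ) :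
    BddOn p fun x => t • f x := by
  obtain ⟨C, hC⟩ := hf
  exact ⟨‖t‖ * C, fun x hx => by
    rw [norm_smul]; exact mul_le_mul_of_nonneg_left (hC x hx) (norm_nonneg _)⟩

lemma BddOn.const_mul {p : PMF α} {f : α → ℝ} (hf : BddOn p f) (t : ℝ) :
    BddOn p fun x => t * f x := hf.const_smul t

lemma BddOn.neg {p : PMF α} {f : α → E} (hf : BddOn p f) : BddOn p fun x => - f x := by
  obtain ⟨C, hC⟩ := hf
  exact ⟨C, fun x hx => by rw [norm_neg]; exact hC x hx⟩

lemma BddOn.sub {p : PMF α} {f g : α → E} (hf : BddOn p f) (hg : BddOn p g) :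
    BddOn p fun x => f x - g x := by
  simpa [sub_eq_add_neg] using hf.add hg.neg

lemma BddOn.norm {p : PMF α} {f : α → E} (hf : BddOn p f) : BddOn p fun x => ‖f x‖ := by
  obtain ⟨C, hC⟩ := hf
  exact ⟨C, fun x hx => by rw [norm_norm]; exact hC x hx⟩

lemma BddOn.norm_sq {p : PMF α} {f : α → E} (hf : BddOn p f) : BddOn p fun x => ‖f x‖ ^ 2 := by
  obtain ⟨C, hC⟩ := hf
  exact ⟨C ^ 2, fun x hx => by
    rw [norm_pow, norm_norm]; exact pow_le_pow_left₀ (norm_nonneg _) (hC x hx) 2⟩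

lemma BddOn.const (p : PMF α) (v : E) : BddOn p fun _ => v := ⟨‖v‖, fun _ _ => le_rfl⟩

lemma BddOn.of_finite (p : PMF α) [Finite α] (f : α → E) : BddOn p f := by
  obtain ⟨C, hC⟩ := (Set.finite_range fun x => ‖f x‖).bddAbove
  exact ⟨C, fun x _ => hC ⟨x, rfl⟩⟩

lemma ev_congr {p : PMF α} {f g : α → E} (h : ∀ x ∈ p.support, f x = g x) : ev p f = ev p g := by
  refine tsum_congr fun x => ?_
  by_cases hx : x ∈ p.support
  · rw [h x hx]
  · simp [toReal_eq_zero_of_notMem hx]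

lemma ev_eq_sum [Fintype α] (p : PMF α) (f : α → E) : ev p f = ∑ x, (p x).toReal • f x :=
  tsum_fintype _

lemma ev_const [CompleteSpace E] (p : PMF α) (v : E) : ev p (fun _ => v) = v := by
  unfold ev
  rw [Summable.tsum_smul_const (hasSum_toReal p).summable, (hasSum_toReal p).tsum_eq, one_smul]

lemma ev_add [CompleteSpace E] {p : PMF α} {f g : α → E} (hf : BddOn p f) (hg : BddOn p g) :
    ev p (fun x => f x + g x) = ev p f + ev p g := by
  unfold ev
  rw [← hf.summable.tsum_add hg.summable]
  simp only [smul_add]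

lemma ev_neg (p : PMF α) (f : α → E) : ev p (fun x => - f x) = - ev p f := by
  unfold ev
  rw [← tsum_neg]
  simp only [smul_neg]

lemma ev_sub [CompleteSpace E] {p : PMF α} {f g : α → E} (hf : BddOn p f) (hg : BddOn p g) :
    ev p (fun x => f x - g x) = ev p f - ev p g := by
  simp only [sub_eq_add_neg]
  rw [ev_add hf hg.neg, ev_neg]

lemma ev_clm [CompleteSpace E] {p : PMF α} {f : α → E} (hf : BddOn p f)
    (L : E →L[ℝ] F) : ev p (fun x => L (f x)) = L (ev p f) := by
  unfold ev
  rw [L.map_tsum hf.summable]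
  simp only [map_smul]

lemma ev_smul (p : PMF α) (f : α → E) (t : ℝ) :
    ev p (fun x => t • f x) = t • ev p f := by
  unfold ev
  rw [← tsum_const_smul'']
  simp only [smul_comm t]

lemma ev_mul (p : PMF α) (f : α → ℝ) (t : ℝ) : ev p (fun x => t * f x) = t * ev p f :=
  ev_smul p f t

lemma norm_ev_le {p : PMF α} {f : α → E} (hf : BddOn p f) : ‖ev p f‖ ≤ ev p fun x => ‖f x‖ := by
  refine (norm_tsum_le_tsum_norm hf.summable_norm).trans (le_of_eq (tsum_congr fun x => ?_))
  rw [norm_smul, Real.norm_of_nonneg ENNReal.toReal_nonneg, smul_eq_mul]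

lemma ev_mono {p : PMF α} {f g : α → ℝ} (hf : BddOn p f) (hg : BddOn p g)
    (h : ∀ x ∈ p.support, f x ≤ g x) : ev p f ≤ ev p g := by
  refine hf.summable.tsum_le_tsum (fun x => ?_) hg.summable
  by_cases hx : x ∈ p.support
  · exact mul_le_mul_of_nonneg_left (h x hx) ENNReal.toReal_nonneg
  · simp [toReal_eq_zero_of_notMem hx]

lemma ev_le_of_le {p : PMF α} {f : α → ℝ} {C : ℝ} (hf : BddOn p f)
    (h : ∀ x ∈ p.support, f x ≤ C) : ev p f ≤ C := by
  simpa only [ev_const] using ev_mono hf (BddOn.const p C) h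

lemma norm_ev_le_of_le {p : PMF α} {f : α → E} {C : ℝ} (h : ∀ x ∈ p.support, ‖f x‖ ≤ C) :
    ‖ev p f‖ ≤ C :=
  (norm_ev_le ⟨C, h⟩).trans (ev_le_of_le (BddOn.norm ⟨C, h⟩) h)

lemma ev_nonneg {p : PMF α} {f : α → ℝ} (h : ∀ x, 0 ≤ f x) : 0 ≤ ev p f :=
  tsum_nonneg fun x => mul_nonneg ENNReal.toReal_nonneg (h x)

lemma ev_pure (a : α) (f : α → E) : ev (PMF.pure a) f = f a := by
  classical
  unfold ev
  rw [tsum_eq_single a]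
  · simp
  · intro b hb
    simp [hb]

lemma BddOn.of_bind {p : PMF α} {q : α → PMF β} {f : β → E} (h : BddOn (p.bind q) f)
    {a : α} (ha : a ∈ p.support) : BddOn (q a) f := by
  obtain ⟨C, hC⟩ := h
  exact ⟨C, fun x hx => hC x ((PMF.mem_support_bind_iff _ _ _).2 ⟨a, ha, hx⟩)⟩

lemma BddOn.ev_bind {p : PMF α} {q : α → PMF β} {f : β → E} (h : BddOn (p.bind q) f) :
    BddOn p fun a => ev (q a) f := by
  obtain ⟨C, hC⟩ := h
  exact ⟨C, fun a ha => norm_ev_le_of_le fun x hx =>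
    hC x ((PMF.mem_support_bind_iff _ _ _).2 ⟨a, ha, hx⟩)⟩

lemma ev_bind [CompleteSpace E] {p : PMF α} {q : α → PMF β} {f : β → E}
    (h : BddOn (p.bind q) f) : ev (p.bind q) f = ev p fun a => ev (q a) f := by
  have key : ∀ b, ((p.bind q) b).toReal = ∑' a, (p a).toReal * (q a b).toReal := by
    intro b
    rw [PMF.bind_apply, ENNReal.tsum_toReal_eq]
    · simp only [ENNReal.toReal_mul]
    · exact fun a => ENNReal.mul_ne_top (p.apply_ne_top a) ((q a).apply_ne_top b)
  have hs : ∀ b, Summable fun a => (p a).toReal * (q a b).toReal := by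
    intro b
    refine Summable.of_nonneg_of_le (fun a => by positivity) (fun a => ?_)
      (hasSum_toReal p).summable
    refine mul_le_of_le_one_right ENNReal.toReal_nonneg ?_
    exact ENNReal.toReal_le_of_le_ofReal zero_le_one (by simpa using (q a).coe_le_one b)
  have h0 : 0 ≤ fun x : α × β => (p x.1).toReal * (q x.1 x.2).toReal :=
    fun x => mul_nonneg ENNReal.toReal_nonneg ENNReal.toReal_nonneg
  have hs2 : Summable fun x : α × β => (p x.1).toReal * (q x.1 x.2).toReal := by
    rw [summable_prod_of_nonneg h0]
    dsimp only
    refine ⟨fun a => Summable.mul_left (f := fun b => (q a b).toReal) (p a).toReal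
      (hasSum_toReal (q a)).summable, ?_⟩
    simp only [tsum_mul_left, (hasSum_toReal (q _)).tsum_eq, mul_one]
    exact (hasSum_toReal p).summable
  have hsum : Summable fun x : α × β => ((p x.1).toReal * (q x.1 x.2).toReal) • f x.2 := by
    obtain ⟨C, hC⟩ := h
    have hC' : ∀ x : α × β, ‖((p x.1).toReal * (q x.1 x.2).toReal) • f x.2‖
        ≤ ((p x.1).toReal * (q x.1 x.2).toReal) * C := by
      intro x
      rw [norm_smul, Real.norm_of_nonneg (h0 x)]
      by_cases hx : x.1 ∈ p.support ∧ x.2 ∈ (q x.1).support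
      · exact mul_le_mul_of_nonneg_left
          (hC _ ((PMF.mem_support_bind_iff _ _ _).2 ⟨_, hx⟩)) (h0 x)
      · rw [not_and_or] at hx
        rcases hx with hx | hx
        · simp [toReal_eq_zero_of_notMem hx]
        · simp [toReal_eq_zero_of_notMem hx]
    exact Summable.of_norm_bounded (hs2.mul_right C) hC'
  unfold ev
  have h1 : ∀ b, ((p.bind q) b).toReal • f b
      = ∑' a, ((p a).toReal * (q a b).toReal) • f b := by
    intro b
    rw [key, Summable.tsum_smul_const (hs b)]
  have h2 : ∀ a, (p a).toReal • ∑' b, (q a b).toReal • f b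
      = ∑' b, ((p a).toReal * (q a b).toReal) • f b := by
    intro a
    rw [← tsum_const_smul'']
    simp only [mul_smul]
  simp only [h1, h2]
  exact Summable.tsum_comm (f := fun a b => ((p a).toReal * (q a b).toReal) • f b) hsum

lemma ev_map [CompleteSpace E] {p : PMF α} {g : α → β} {f : β → E} (h : BddOn (p.map g) f) :
    ev (p.map g) f = ev p fun a => f (g a) := by
  have h' : BddOn (p.bind (PMF.pure ∘ g)) f := by rwa [PMF.bind_pure_comp]
  rw [← PMF.bind_pure_comp, ev_bind h']
  simp only [Function.comp, ev_pure]

end Expectation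

/-! ### Finite chains: stationary law, recurrent class and the Poisson equation -/

section FiniteChain

/-- A finite chain has a stationary law: `P - 1` is singular, and the absolute values of a left
null vector are again a left null vector. -/
lemma exists_bind_eq_self {S : Type*} [Fintype S] [Nonempty S] (P : S → PMF S) :
    ∃ ν : PMF S, ν.bind P = ν := by
  classical
  let Q : Matrix S S ℝ := fun i j => (P i j).toReal
  have hrow : ∀ i, ∑ j, Q i j = 1 := fun i => by
    simpa [tsum_fintype] using (hasSum_toReal (P i)).tsum_eq
  have hdet : (Q - 1).det = 0 := by
    rw [← Matrix.exists_mulVec_eq_zero_iff]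
    refine ⟨fun _ => 1, ?_, ?_⟩
    · obtain ⟨s⟩ := ‹Nonempty S›
      exact fun h => one_ne_zero (congrFun h s)
    · ext i
      rw [Matrix.sub_mulVec, Matrix.one_mulVec]
      simp [Matrix.mulVec, dotProduct, hrow]
  obtain ⟨v, hv0, hv⟩ := Matrix.exists_vecMul_eq_zero_iff.2 hdet
  have hv' : ∀ j, ∑ i, v i * Q i j = v j := by
    intro j
    have := congrFun hv j
    rw [Matrix.vecMul_sub, Matrix.vecMul_one] at this
    simpa [Matrix.vecMul, dotProduct, sub_eq_zero] using this
  have hle : ∀ j ∈ Finset.univ, |v j| ≤ ∑ i, |v i| * Q i j := by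
    intro j _
    rw [← hv' j]
    refine (Finset.abs_sum_le_sum_abs _ _).trans (Finset.sum_le_sum fun i _ => ?_)
    rw [abs_mul, abs_of_nonneg (a := Q i j) ENNReal.toReal_nonneg]
  have htot : ∑ j, |v j| = ∑ j, ∑ i, |v i| * Q i j := by
    rw [Finset.sum_comm]
    simp only [← Finset.mul_sum, hrow, mul_one]
  have heq : ∀ j, |v j| = ∑ i, |v i| * Q i j := fun j =>
    (Finset.sum_eq_sum_iff_of_le hle).1 htot j (Finset.mem_univ j)
  have hpos : 0 < ∑ j, |v j| := by
    obtain ⟨j, hj⟩ : ∃ j, v j ≠ 0 := by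
      by_contra hcon
      push Not at hcon
      exact hv0 (funext hcon)
    exact Finset.sum_pos' (fun _ _ => abs_nonneg _) ⟨j, Finset.mem_univ j, abs_pos.2 hj⟩
  set t := ∑ j, |v j| with ht
  have hsum : ∑ i, ENNReal.ofReal (|v i| / t) = 1 := by
    rw [← ENNReal.ofReal_sum_of_nonneg (fun i _ => by positivity), ← Finset.sum_div, ← ht,
      div_self hpos.ne', ENNReal.ofReal_one]
  refine ⟨PMF.ofFintype (fun i => ENNReal.ofReal (|v i| / t)) hsum, ?_⟩
  ext j
  rw [PMF.bind_apply, tsum_fintype, PMF.ofFintype_apply]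
  have hterm : ∀ i, ENNReal.ofReal (|v i| / t) * P i j = ENNReal.ofReal (|v i| / t * Q i j) := by
    intro i
    rw [ENNReal.ofReal_mul (by positivity), ENNReal.ofReal_toReal ((P i).apply_ne_top j)]
  simp only [PMF.ofFintype_apply, hterm]
  rw [← ENNReal.ofReal_sum_of_nonneg (fun i _ =>
    mul_nonneg (by positivity) ENNReal.toReal_nonneg), heq j, Finset.sum_div]
  simp only [div_mul_eq_mul_div]
  rfl

end FiniteChain

section Recurrent

variable {S A : Type*} (M : CMDP S A) (π : S → PMF A)

lemma CMDP.recurrent_of_step {x y : S} (hx : x ∈ M.recurrentStates π)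
    (hxy : M.chain π x y ≠ 0) : y ∈ M.recurrentStates π := by
  intro z hyz
  have h1 : M.Reaches π x y := Relation.ReflTransGen.single hxy
  exact (hx z (h1.trans hyz)).trans h1

/-- The law of the transition `(s, a, s')` out of the state `s`. -/
noncomputable def stepLaw (s : S) : PMF (Transition S A) :=
  (π s).bind fun a => (M.trans s a).map fun s' => (s, a, s')

lemma stepLaw_map_next (s : S) : (stepLaw M π s).map (fun z => z.2.2) = M.chain π s := by
  unfold stepLaw CMDP.chain
  rw [PMF.map_bind]
  congr 1
  funext a
  rw [PMF.map_comp]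
  exact PMF.map_id _

lemma fst_of_mem_stepLaw {s : S} {z : Transition S A} (hz : z ∈ (stepLaw M π s).support) :
    z.1 = s := by
  unfold stepLaw at hz
  simp only [PMF.mem_support_bind_iff, PMF.mem_support_map_iff] at hz
  obtain ⟨a, -, s', -, rfl⟩ := hz
  rfl

lemma chain_ne_zero_of_mem_stepLaw {s : S} {z : Transition S A}
    (hz : z ∈ (stepLaw M π s).support) : M.chain π s z.2.2 ≠ 0 := by
  rw [← stepLaw_map_next, ← PMF.mem_support_iff, PMF.mem_support_map_iff]
  exact ⟨z, hz, rfl⟩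

lemma recurrent_of_mem_stepLaw {s : S} (hs : s ∈ M.recurrentStates π) {z : Transition S A}
    (hz : z ∈ (stepLaw M π s).support) : z.2.2 ∈ M.recurrentStates π :=
  M.recurrent_of_step π hs (chain_ne_zero_of_mem_stepLaw M π hz)

variable [Fintype S]

lemma statDist_bind : (M.statDist π).bind (M.chain π) = M.statDist π := by
  have : Nonempty S := ⟨M.init.support_nonempty.choose⟩
  have h := exists_bind_eq_self (M.chain π)
  unfold CMDP.statDist
  rw [dif_pos h]
  exact h.choose_spec

lemma statDist_apply (y : S) :
    ∑ x, M.statDist π x * M.chain π x y = M.statDist π y := by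
  conv_rhs => rw [← statDist_bind]
  rw [PMF.bind_apply, tsum_fintype]

lemma statDist_step {x y : S} (hx : M.statDist π x ≠ 0) (hxy : M.chain π x y ≠ 0) :
    M.statDist π y ≠ 0 := by
  rw [← statDist_apply]
  intro h
  have := (Finset.sum_eq_zero_iff.1 h) x (Finset.mem_univ x)
  exact (mul_ne_zero hx hxy) this

lemma statDist_reaches {x y : S} (hx : M.statDist π x ≠ 0) (hxy : M.Reaches π x y) :
    M.statDist π y ≠ 0 := by
  induction hxy with
  | refl => exact hx
  | tail _ h ih => exact statDist_step M π ih h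

lemma ev_statDist_chain {E : Type*} [NormedAddCommGroup E] [NormedSpace ℝ E] [CompleteSpace E]
    (f : S → E) :
    ev (M.statDist π) (fun x => ev (M.chain π x) f) = ev (M.statDist π) f := by
  conv_rhs => rw [← statDist_bind]
  rw [ev_bind (BddOn.of_finite _ _)]

/-- A stationary law does not flow into a closed set from outside. -/
lemma notMem_of_closed {Z : Set S} (hZ : ∀ x ∈ Z, ∀ y, M.chain π x y ≠ 0 → y ∈ Z) {x y : S}
    (hx : M.statDist π x ≠ 0) (hxZ : x ∉ Z) (hxy : M.chain π x y ≠ 0) : y ∉ Z := by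
  classical
  intro hy
  let f : S → ℝ := Z.indicator 1
  have hf1 : ∀ w, f w ≤ 1 := fun w => by
    by_cases hw : w ∈ Z <;> simp [f, hw]
  have hf0 : ∀ w, 0 ≤ f w := fun w => by
    by_cases hw : w ∈ Z <;> simp [f, hw]
  -- Stationarity: the mass of `Z` does not change in one step, while no term of this sum is
  -- negative because `Z` is closed; hence every term vanishes.
  have h0 : ∑ w, (M.statDist π w).toReal * (ev (M.chain π w) f - f w) = 0 := by
    have := ev_statDist_chain M π f
    rw [ev_eq_sum, ev_eq_sum] at this
    simp only [smul_eq_mul] at this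
    simp only [mul_sub, Finset.sum_sub_distrib, this, sub_self]
  have hnn : ∀ w ∈ Finset.univ, 0 ≤ (M.statDist π w).toReal * (ev (M.chain π w) f - f w) := by
    intro w _
    refine mul_nonneg ENNReal.toReal_nonneg (sub_nonneg.2 ?_)
    by_cases hw : w ∈ Z
    · have : ev (M.chain π w) f = ev (M.chain π w) fun _ => (1 : ℝ) :=
        ev_congr fun u hu => by simp [f, hZ w hw u hu]
      rw [this, ev_const]
      exact hf1 w
    · simp only [f, Set.indicator_of_notMem hw]
      exact ev_nonneg hf0
  have hx0 := (Finset.sum_eq_zero_iff_of_nonneg hnn).1 h0 x (Finset.mem_univ x)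
  have hpos : 0 < ev (M.chain π x) f := by
    rw [ev_eq_sum]
    refine Finset.sum_pos' (fun w _ => smul_nonneg ENNReal.toReal_nonneg (hf0 w))
      ⟨y, Finset.mem_univ y, ?_⟩
    simp only [f, Set.indicator_of_mem hy, Pi.one_apply, smul_eq_mul, mul_one]
    exact ENNReal.toReal_pos hxy ((M.chain π x).apply_ne_top y)
  have : 0 < (M.statDist π x).toReal :=
    ENNReal.toReal_pos hx ((M.statDist π).apply_ne_top x)
  have hfx : f x = 0 := by simp [f, hxZ]
  rw [hfx, sub_zero] at hx0
  exact (mul_pos this hpos).ne' hx0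

/-- The stationary law does not charge transient states. -/
lemma recurrent_of_statDist_ne_zero {y : S} (hy : M.statDist π y ≠ 0) :
    y ∈ M.recurrentStates π := by
  intro z hyz
  by_contra hzy
  -- The states that do not lead to `y` form a closed set, which is reachable from `y`.
  let Z : Set S := {x | ¬ M.Reaches π x y}
  have hZ : ∀ x ∈ Z, ∀ w, M.chain π x w ≠ 0 → w ∈ Z := by
    intro x hx w hxw hwy
    have h1 : M.Reaches π x w := Relation.ReflTransGen.single hxw
    exact hx (h1.trans hwy)
  have key : ∀ w, M.Reaches π y w → w ∉ Z := by
    intro w hw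
    induction hw with
    | refl => exact fun h => h Relation.ReflTransGen.refl
    | tail h1 h2 ih => exact notMem_of_closed M π hZ (statDist_reaches M π hy h1) ih h2
  exact key z hyz hzy

lemma statDist_ne_zero_iff (hU : M.IsUnichain π) {y : S} :
    M.statDist π y ≠ 0 ↔ y ∈ M.recurrentStates π := by
  refine ⟨recurrent_of_statDist_ne_zero M π, fun hy => ?_⟩
  obtain ⟨x, hx⟩ := (M.statDist π).support_nonempty
  have hxR := recurrent_of_statDist_ne_zero M π hx
  exact statDist_reaches M π hx (hU x hxR y hy)

end Recurrent

section Poisson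

variable {S A : Type*} [Fintype S] (M : CMDP S A) (π : S → PMF A)

lemma hitTime_self (y : S) : M.hitTime π y y = 0 := by
  unfold CMDP.hitTime
  rw [ENNReal.tsum_eq_zero]
  intro n
  cases n <;> simp [CMDP.avoidProb]

/-- First-step analysis of the expected hitting time. -/
lemma hitTime_of_ne {x y : S} (h : x ≠ y) :
    M.hitTime π x y = 1 + ∑ x', M.chain π x x' * M.hitTime π x' y := by
  unfold CMDP.hitTime
  rw [tsum_eq_zero_add' ENNReal.summable]
  congr 1
  · simp [CMDP.avoidProb, h]
  · simp only [CMDP.avoidProb, h, if_false, ← ENNReal.tsum_mul_left]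
    rw [Summable.tsum_finsetSum fun _ _ => ENNReal.summable]

lemma one_le_hitTime {x y : S} (h : x ≠ y) : 1 ≤ M.hitTime π x y := by
  rw [hitTime_of_ne M π h]
  exact le_self_add

lemma sum_statDist_hitTime_le {x : S} (hx : x ∈ M.recurrentStates π) :
    ∑ y, M.statDist π y * M.hitTime π x y ≤ M.targetTime π := by
  unfold CMDP.targetTime
  exact le_iSup₂_of_le x hx le_rfl

variable {C : ℝ} (hU : M.IsUnichain π) (hC0 : 0 ≤ C) (hC : M.targetTime π ≤ ENNReal.ofReal C)
include hU hC0 hC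

lemma hitTime_ne_top {x y : S} (hx : x ∈ M.recurrentStates π) (hy : y ∈ M.recurrentStates π) :
    M.hitTime π x y ≠ ⊤ := by
  intro h
  have h1 := (sum_statDist_hitTime_le M π hx).trans hC
  have h2 : M.statDist π y * M.hitTime π x y ≤ ENNReal.ofReal C :=
    (Finset.single_le_sum (f := fun y => M.statDist π y * M.hitTime π x y)
      (fun _ _ => zero_le) (Finset.mem_univ y)).trans h1
  rw [h, ENNReal.mul_top ((statDist_ne_zero_iff M π hU).2 hy)] at h2
  exact absurd h2 (by simp)

lemma toReal_hitTime_of_ne {x y : S} (hx : x ∈ M.recurrentStates π)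
    (hy : y ∈ M.recurrentStates π) (h : x ≠ y) :
    (M.hitTime π x y).toReal = 1 + ev (M.chain π x) fun x' => (M.hitTime π x' y).toReal := by
  have hfin : ∀ x' ∈ Finset.univ, M.chain π x x' * M.hitTime π x' y ≠ ⊤ := by
    intro x' _
    by_cases h0 : M.chain π x x' = 0
    · simp [h0]
    · exact ENNReal.mul_ne_top ((M.chain π x).apply_ne_top x')
        (hitTime_ne_top M π hU hC0 hC (M.recurrent_of_step π hx h0) hy)
  rw [hitTime_of_ne M π h, ENNReal.toReal_add ENNReal.one_ne_top (ENNReal.sum_ne_top.2 hfin),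
    ENNReal.toReal_sum hfin, ENNReal.toReal_one, ev_eq_sum]
  simp only [ENNReal.toReal_mul, smul_eq_mul]

/-- Kac's formula: the expected return time to a recurrent state `y` is `1 / d(y)`. -/
lemma statDist_mul_returnTime {y : S} (hy : y ∈ M.recurrentStates π) :
    (M.statDist π y).toReal * (1 + ev (M.chain π y) fun x' => (M.hitTime π x' y).toReal) = 1 := by
  classical
  set H : S → ℝ := fun x => (M.hitTime π x y).toReal with hH
  have h1 := ev_statDist_chain M π H
  have h2 : ev (M.statDist π) (fun x => ev (M.chain π x) H)
      = ev (M.statDist π) (fun x => H x + ((if x = y then 1 + ev (M.chain π y) H else 0) - 1)) := by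
    refine ev_congr fun x hx => ?_
    have hxR := recurrent_of_statDist_ne_zero M π hx
    by_cases hxy : x = y
    · subst hxy
      have : H x = 0 := by simp [hH, hitTime_self]
      simp [this]
    · have := toReal_hitTime_of_ne M π hU hC0 hC hxR hy hxy
      simp only [hxy, if_false]
      rw [show H x = 1 + ev (M.chain π x) H from this]
      ring
  rw [h2, ev_add (BddOn.of_finite _ _) (BddOn.of_finite _ _),
    ev_sub (BddOn.of_finite _ _) (BddOn.of_finite _ _), ev_const] at h1
  have h3 : ev (M.statDist π) (fun x => if x = y then 1 + ev (M.chain π y) H else 0)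
      = (M.statDist π y).toReal * (1 + ev (M.chain π y) H) := by
    rw [ev_eq_sum]
    simp
  rw [h3] at h1
  linarith

lemma statDist_mul_ev_hitTime {x : S} (hx : x ∈ M.recurrentStates π) (y : S) [Decidable (x = y)] :
    (M.statDist π y).toReal * ev (M.chain π x) (fun x' => (M.hitTime π x' y).toReal)
      = (M.statDist π y).toReal * (M.hitTime π x y).toReal - (M.statDist π y).toReal
        + if x = y then 1 else 0 := by
  by_cases hy : y ∈ M.recurrentStates π
  · by_cases hxy : x = y
    · subst hxy
      have := statDist_mul_returnTime M π hU hC0 hC hx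
      simp only [if_true, hitTime_self, ENNReal.toReal_zero]
      linarith
    · rw [toReal_hitTime_of_ne M π hU hC0 hC hx hy hxy, if_neg hxy]
      ring
  · have h0 : M.statDist π y = 0 := by
      by_contra h
      exact hy ((statDist_ne_zero_iff M π hU).1 h)
    have hxy : x ≠ y := fun h => hy (h ▸ hx)
    simp [h0, hxy]

/-- The Poisson equation has the solution `h(x) = -∑_y d(y) E_x[T_y] f(y)`, whose size is
controlled by the target time; no mixing or aperiodicity is needed. -/
lemma exists_poisson [Finite A] {E : Type*} [NormedAddCommGroup E] [NormedSpace ℝ E]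
    [CompleteSpace E] {F : ℝ} (v : Transition S A → E) (hv : ∀ z, ‖v z‖ ≤ F) :
    ∃ h : S → E, (∀ x ∈ M.recurrentStates π, ‖h x‖ ≤ C * F) ∧
      ∀ x ∈ M.recurrentStates π, ev (stepLaw M π x) (fun z => v z + h z.2.2)
        = ev ((M.statDist π).bind (stepLaw M π)) v + h x := by
  classical
  set f : S → E := fun y => ev (stepLaw M π y) v with hf
  have hfF : ∀ y, ‖f y‖ ≤ F := fun y => norm_ev_le_of_le fun z _ => hv z
  refine ⟨fun x => - ∑ y, ((M.statDist π y).toReal * (M.hitTime π x y).toReal) • f y,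
    fun x hx => ?_, fun x hx => ?_⟩
  · have hF : 0 ≤ F := (norm_nonneg _).trans (hfF x)
    rw [norm_neg]
    calc _ ≤ ∑ y, ((M.statDist π y).toReal * (M.hitTime π x y).toReal) * F := by
          refine norm_sum_le_of_le _ fun y _ => ?_
          rw [norm_smul, Real.norm_of_nonneg (by positivity)]
          exact mul_le_mul_of_nonneg_left (hfF y) (by positivity)
      _ = (∑ y, M.statDist π y * M.hitTime π x y).toReal * F := by
          rw [← Finset.sum_mul, ENNReal.toReal_sum]
          · simp only [ENNReal.toReal_mul]
          · intro y _ htop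
            have h1 := (sum_statDist_hitTime_le M π hx).trans hC
            have h2 := (Finset.single_le_sum (f := fun y => M.statDist π y * M.hitTime π x y)
              (fun _ _ => zero_le) (Finset.mem_univ y)).trans h1
            rw [htop] at h2
            exact absurd h2 (by simp)
      _ ≤ C * F := by
          refine mul_le_mul_of_nonneg_right ?_ hF
          exact ENNReal.toReal_le_of_le_ofReal hC0 ((sum_statDist_hitTime_le M π hx).trans hC)
  · set h : S → E := fun x =>
      - ∑ y, ((M.statDist π y).toReal * (M.hitTime π x y).toReal) • f y with hh
    have hnext : ev (stepLaw M π x) (fun z => h z.2.2) = ev (M.chain π x) h := by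
      rw [← stepLaw_map_next, ev_map (BddOn.of_finite _ _)]
    rw [ev_add (BddOn.of_finite _ _) (BddOn.of_finite _ _), hnext,
      ev_bind (BddOn.of_finite _ _)]
    have h1 : ev (M.chain π x) h = - ∑ y, ((M.statDist π y).toReal *
        ev (M.chain π x) (fun x' => (M.hitTime π x' y).toReal)) • f y := by
      rw [hh, ev_neg]
      congr 1
      simp only [ev_eq_sum, Finset.smul_sum, Finset.mul_sum, Finset.sum_smul, smul_smul]
      rw [Finset.sum_comm]
      refine Finset.sum_congr rfl fun y _ => Finset.sum_congr rfl fun w _ => ?_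
      simp only [smul_eq_mul]
      congr 1
      ring
    rw [h1]
    simp only [statDist_mul_ev_hitTime M π hU hC0 hC hx, add_smul, sub_smul,
      Finset.sum_add_distrib, Finset.sum_sub_distrib, ite_smul, one_smul, zero_smul,
      Finset.sum_ite_eq, Finset.mem_univ, if_true]
    rw [ev_eq_sum (M.statDist π)]
    simp only [hh]
    change f x + _ = _
    abel

end Poisson

section TargetTime

variable {S A : Type*} [Fintype S] (M : CMDP S A) (π : S → PMF A)

lemma one_sub_statDist_le_targetTime {x : S} (hx : x ∈ M.recurrentStates π) :
    1 - M.statDist π x ≤ M.targetTime π := by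
  classical
  refine le_trans ?_ (sum_statDist_hitTime_le M π hx)
  have h1 : ∑ y, M.statDist π y = 1 := by
    rw [← (M.statDist π).tsum_coe, tsum_fintype]
  rw [← h1, tsub_le_iff_right, ← Finset.sum_erase_add _ _ (Finset.mem_univ x)]
  gcongr
  refine (Finset.sum_le_sum fun y hy => ?_).trans
    (Finset.sum_le_sum_of_subset (Finset.erase_subset x Finset.univ))
  exact le_mul_of_one_le_right zero_le (one_le_hitTime M π (Finset.ne_of_mem_erase hy).symm)

/-- A nonzero target time is at least `1/2`: the recurrent class then has two states, and one of
them has stationary mass at most `1/2`. -/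
lemma half_le_targetTime (h : M.targetTime π ≠ 0) : 2⁻¹ ≤ M.targetTime π := by
  classical
  obtain ⟨x, hx, y, hy⟩ : ∃ x ∈ M.recurrentStates π, ∃ y,
      M.statDist π y * M.hitTime π x y ≠ 0 := by
    by_contra hcon
    push Not at hcon
    refine h ?_
    unfold CMDP.targetTime
    simp only [ENNReal.iSup_eq_zero]
    exact fun x hx => Finset.sum_eq_zero fun y _ => hcon x hx y
  have hxy : x ≠ y := by
    rintro rfl
    exact hy (by rw [hitTime_self, mul_zero])
  have hyR : y ∈ M.recurrentStates π :=
    recurrent_of_statDist_ne_zero M π (left_ne_zero_of_mul hy)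
  have hsum : M.statDist π x + M.statDist π y ≤ 1 := by
    rw [← (M.statDist π).tsum_coe, tsum_fintype, ← Finset.sum_pair hxy]
    exact Finset.sum_le_sum_of_subset (Finset.subset_univ _)
  have key : ∀ w ∈ M.recurrentStates π, M.statDist π w ≤ 2⁻¹ → 2⁻¹ ≤ M.targetTime π := by
    intro w hw hle
    refine le_trans ?_ (one_sub_statDist_le_targetTime M π hw)
    refine le_trans (le_of_eq ?_) (tsub_le_tsub_left hle 1)
    exact ENNReal.one_sub_inv_two.symm
  by_cases hx2 : M.statDist π x ≤ 2⁻¹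
  · exact key x hx hx2
  · refine key y hyR ?_
    by_contra hy2
    push Not at hx2 hy2
    have := ENNReal.add_lt_add hx2 hy2
    rw [ENNReal.inv_two_add_inv_two] at this
    exact absurd hsum (not_le.2 this)

end TargetTime

/-! ### Trajectories: ergodic averages started in the recurrent class -/

section Paths

variable {S A : Type*} (M : CMDP S A) (π : S → PMF A)

lemma pathLaw_succ (n : ℕ) (s : S) :
    pathLaw M π (n + 1) s
      = (stepLaw M π s).bind fun z => (pathLaw M π n z.2.2).map fun τ => z :: τ := by
  unfold stepLaw
  rw [PMF.bind_bind]
  simp only [PMF.bind_map, Function.comp_def]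
  rfl

lemma length_of_mem_pathLaw {n : ℕ} {s : S} {τ : List (Transition S A)}
    (h : τ ∈ (pathLaw M π n s).support) : τ.length = n := by
  induction n generalizing s τ with
  | zero => simpa [pathLaw] using h
  | succ n ih =>
    rw [pathLaw_succ] at h
    simp only [PMF.mem_support_bind_iff, PMF.mem_support_map_iff] at h
    obtain ⟨z, -, τ', hτ', rfl⟩ := h
    rw [List.length_cons, ih hτ']

lemma recurrent_of_mem_pathLaw {n : ℕ} {s : S} {τ : List (Transition S A)}
    (hs : s ∈ M.recurrentStates π) (h : τ ∈ (pathLaw M π n s).support) :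
    endState s τ ∈ M.recurrentStates π ∧
      ∀ z ∈ τ, z.1 ∈ M.recurrentStates π ∧ M.chain π z.1 z.2.2 ≠ 0 := by
  induction n generalizing s τ with
  | zero =>
    obtain rfl : τ = [] := by simpa [pathLaw] using h
    exact ⟨hs, by simp⟩
  | succ n ih =>
    rw [pathLaw_succ] at h
    simp only [PMF.mem_support_bind_iff, PMF.mem_support_map_iff] at h
    obtain ⟨z, hz, τ', hτ', rfl⟩ := h
    have hz2 := recurrent_of_mem_stepLaw M π hs hz
    have hz1 := fst_of_mem_stepLaw M π hz
    obtain ⟨h1, h2⟩ := ih hz2 hτ'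
    refine ⟨h1, fun w hw => ?_⟩
    rcases List.mem_cons.1 hw with rfl | hw
    · exact ⟨by rwa [hz1], by rw [hz1]; exact chain_ne_zero_of_mem_stepLaw M π hz⟩
    · exact h2 w hw

/-- The first `m` transitions of a trajectory of length `n ≥ m` form a trajectory of length `m`. -/
lemma pathLaw_map_take {m n : ℕ} (h : m ≤ n) (s : S) :
    (pathLaw M π n s).map (List.take m) = pathLaw M π m s := by
  induction n generalizing m s with
  | zero =>
    obtain rfl : m = 0 := by omega
    simp [pathLaw, PMF.pure_map]
  | succ n ih =>
    cases m with
    | zero =>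
      have : (List.take 0 : List (Transition S A) → _) = Function.const _ [] := by
        funext l; simp
      rw [this, PMF.map_const]
      rfl
    | succ m =>
      rw [pathLaw_succ, pathLaw_succ, PMF.map_bind]
      congr 1
      funext z
      rw [PMF.map_comp, ← ih (Nat.le_of_succ_le_succ h), PMF.map_comp]
      rfl

lemma BddOn.of_pathLaw [Finite S] [Finite A] {E : Type*} [NormedAddCommGroup E] (n : ℕ) (s : S)
    (f : List (Transition S A) → E) : BddOn (pathLaw M π n s) f := by
  have hfin : {l : List (Transition S A) | l.length = n}.Finite := List.finite_length_eq _ n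
  obtain ⟨C, hC⟩ := (hfin.image fun l => ‖f l‖).bddAbove
  exact ⟨C, fun τ hτ => hC ⟨τ, length_of_mem_pathLaw M π hτ, rfl⟩⟩

lemma ev_pathLaw_succ [Finite S] [Finite A] {E : Type*} [NormedAddCommGroup E] [NormedSpace ℝ E]
    [CompleteSpace E] (n : ℕ) (s : S) (f : List (Transition S A) → E) :
    ev (pathLaw M π (n + 1) s) f
      = ev (stepLaw M π s) fun z => ev (pathLaw M π n z.2.2) fun τ => f (z :: τ) := by
  have hb := BddOn.of_pathLaw M π (n + 1) s f
  rw [pathLaw_succ] at hb ⊢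
  rw [ev_bind hb]
  exact ev_congr fun z hz => ev_map (hb.of_bind hz)

lemma ev_pathLaw_take [Finite S] [Finite A] {E : Type*} [NormedAddCommGroup E] [NormedSpace ℝ E]
    [CompleteSpace E] {m n : ℕ} (h : m ≤ n) (s : S) (f : List (Transition S A) → E) :
    ev (pathLaw M π n s) (fun τ => f (τ.take m)) = ev (pathLaw M π m s) f := by
  have hb := BddOn.of_pathLaw M π m s f
  rw [← pathLaw_map_take M π h] at hb ⊢
  rw [ev_map hb]

/-- Expansion of the mean square of a shifted random vector. -/
lemma ev_norm_add_sq {α E : Type*} [NormedAddCommGroup E] [InnerProductSpace ℝ E]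
    [CompleteSpace E] {p : PMF α} {f : α → E} (hf : BddOn p f) (c : E) :
    ev p (fun x => ‖c + f x‖ ^ 2)
      = ‖c‖ ^ 2 + 2 * inner ℝ c (ev p f) + ev p (fun x => ‖f x‖ ^ 2) := by
  simp only [norm_add_sq_real]
  have hin : BddOn p fun x => innerSL ℝ c (f x) := hf.clm _
  have h2 : ev p (fun x => innerSL ℝ c (f x)) = inner ℝ c (ev p f) := ev_clm hf _
  simp only [innerSL_apply_apply] at hin h2
  rw [ev_add ((BddOn.const _ _).add (hin.const_mul 2)) hf.norm_sq,
    ev_add (BddOn.const _ _) (hin.const_mul 2), ev_const, ev_mul, h2]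

lemma norm_sum_map_le {α E : Type*} [NormedAddCommGroup E] {F : ℝ} (v : α → E)
    (hv : ∀ z, ‖v z‖ ≤ F) (τ : List α) : ‖(τ.map v).sum‖ ≤ τ.length * F := by
  induction τ with
  | nil => simp
  | cons z τ ih =>
    rw [List.map_cons, List.sum_cons, List.length_cons]
    push_cast
    refine (norm_add_le _ _).trans ?_
    linarith [hv z]

section Poisson

variable [Finite S] [Finite A] {E : Type*} [NormedAddCommGroup E] [InnerProductSpace ℝ E]
  [CompleteSpace E] {u : Transition S A → E} {h : S → E}
  (hP : ∀ x ∈ M.recurrentStates π, ev (stepLaw M π x) (fun z => u z + h z.2.2) = h x)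
include hP

/-- Summing the Poisson equation along a trajectory leaves only the boundary terms. -/
lemma ev_path_sum (n : ℕ) {x : S} (hx : x ∈ M.recurrentStates π) :
    ev (pathLaw M π n x) (fun τ => (τ.map u).sum + h (endState x τ)) = h x := by
  induction n generalizing x with
  | zero => simp [pathLaw, ev_pure, endState]
  | succ n ih =>
    rw [ev_pathLaw_succ, ← hP x hx]
    refine ev_congr fun z hz => ?_
    have h1 := ih (recurrent_of_mem_stepLaw M π hx hz)
    simp only [List.map_cons, List.sum_cons, add_assoc]
    rw [ev_add (BddOn.const _ _) (BddOn.of_pathLaw _ _ _ _ _), ev_const]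
    exact congrArg (u z + ·) h1

/-- Orthogonality of martingale increments: the compensated sum over `n` steps has mean square at
most `n σ²`. -/
lemma ev_path_martingale_sq_le {σ : ℝ}
    (hσ : ∀ x ∈ M.recurrentStates π, ∀ z ∈ (stepLaw M π x).support,
      ‖u z + h z.2.2 - h x‖ ≤ σ) (n : ℕ) {x : S} (hx : x ∈ M.recurrentStates π) :
    ev (pathLaw M π n x) (fun τ => ‖(τ.map u).sum + h (endState x τ) - h x‖ ^ 2)
      ≤ n * σ ^ 2 := by
  induction n generalizing x with
  | zero => simp [pathLaw, ev_pure, endState]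
  | succ n ih =>
    rw [ev_pathLaw_succ]
    push_cast
    refine ev_le_of_le (BddOn.of_finite _ _) (fun z hz => ?_)
    · have hz2 := recurrent_of_mem_stepLaw M π hx hz
      have h1 := ih hz2
      have h2 : ev (pathLaw M π n z.2.2)
          (fun τ => (τ.map u).sum + h (endState z.2.2 τ) - h z.2.2) = 0 := by
        rw [ev_sub (BddOn.of_pathLaw _ _ _ _ _) (BddOn.const _ _), ev_const,
          ev_path_sum M π hP n hz2, sub_self]
      have h3 : ∀ τ, ((z :: τ).map u).sum + h (endState x (z :: τ)) - h x
          = (u z + h z.2.2 - h x) + ((τ.map u).sum + h (endState z.2.2 τ) - h z.2.2) := by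
        intro τ
        have : endState x (z :: τ) = endState z.2.2 τ := rfl
        rw [this, List.map_cons, List.sum_cons]
        abel
      simp only [h3]
      rw [ev_norm_add_sq (BddOn.of_pathLaw _ _ _ _ _), h2, inner_zero_right]
      have := pow_le_pow_left₀ (norm_nonneg _) (hσ x hx z hz) 2
      linarith

end Poisson

end Paths

section Averages

variable {S A : Type*} [Fintype S] [Finite A] (M : CMDP S A) (π : S → PMF A) {C F : ℝ}
  (hU : M.IsUnichain π) (hC0 : 1 / 2 ≤ C) (hC : M.targetTime π ≤ ENNReal.ofReal C)
  {E : Type*} [NormedAddCommGroup E] [InnerProductSpace ℝ E]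
  [CompleteSpace E] {v : Transition S A → E} (hv : ∀ z, ‖v z‖ ≤ F)

omit [Fintype S] [Finite A] [CompleteSpace E] in
lemma norm_levelAvg_le (hF : 0 ≤ F) (hv : ∀ z, ‖v z‖ ≤ F) (τ : List (Transition S A)) (j : ℕ) :
    ‖levelAvg v τ j‖ ≤ F := by
  unfold levelAvg
  have h2 : (0 : ℝ) < 2 ^ j := by positivity
  rw [norm_smul, norm_inv, Real.norm_of_nonneg h2.le, inv_mul_le_iff₀ h2]
  refine (norm_sum_map_le v hv _).trans (mul_le_mul_of_nonneg_right ?_ hF)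
  have : (τ.take (2 ^ j)).length ≤ 2 ^ j := by simp
  exact_mod_cast this

/-- The stationary mean of a function of the transitions. -/
noncomputable def statMean (v : Transition S A → E) : E :=
  ev ((M.statDist π).bind (stepLaw M π)) v

lemma levelAvg_sub {τ : List (Transition S A)} {j : ℕ} (hτ : τ.length = 2 ^ j) (w : E) :
    levelAvg v τ j - w = ((2 : ℝ) ^ j)⁻¹ • (τ.map fun z => v z - w).sum := by
  have h1 : ∀ l : List (Transition S A),
      (l.map fun z => v z - w).sum = (l.map v).sum - (l.length : ℝ) • w := by
    intro l
    induction l with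
    | nil => simp
    | cons z l ih =>
      rw [List.map_cons, List.sum_cons, ih, List.map_cons, List.sum_cons, List.length_cons]
      push_cast
      rw [add_smul, one_smul]
      abel
  unfold levelAvg
  rw [h1, List.take_of_length_le hτ.le, hτ, smul_sub, smul_smul]
  push_cast
  rw [inv_mul_cancel₀ (by positivity), one_smul]

include hU hC0 hC hv

lemma exists_centered_poisson :
    ∃ h : S → E, (∀ x ∈ M.recurrentStates π, ‖h x‖ ≤ C * F) ∧
      ∀ x ∈ M.recurrentStates π,
        ev (stepLaw M π x) (fun z => (v z - statMean M π v) + h z.2.2) = h x := by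
  obtain ⟨h, h1, h2⟩ := exists_poisson M π hU (by linarith) hC v hv
  refine ⟨h, h1, fun x hx => ?_⟩
  have : (fun z : Transition S A => (v z - statMean M π v) + h z.2.2)
      = fun z => (v z + h z.2.2) - statMean M π v := by
    funext z; abel
  rw [this, ev_sub (BddOn.of_finite _ _) (BddOn.const _ _), ev_const, h2 x hx]
  unfold statMean
  abel

lemma norm_ev_levelAvg_sub_le {x : S} (hx : x ∈ M.recurrentStates π) (j : ℕ) :
    ‖ev (pathLaw M π (2 ^ j) x) (fun τ => levelAvg v τ j) - statMean M π v‖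
      ≤ 2 * C * F / 2 ^ j := by
  obtain ⟨h, h1, h2⟩ := exists_centered_poisson M π hU hC0 hC hv
  have h3 := ev_path_sum M π h2 (2 ^ j) hx
  rw [ev_add (BddOn.of_pathLaw _ _ _ _ _) (BddOn.of_pathLaw _ _ _ _ _)] at h3
  have h4 : ev (pathLaw M π (2 ^ j) x) (fun τ => levelAvg v τ j) - statMean M π v
      = ((2 : ℝ) ^ j)⁻¹ • (h x - ev (pathLaw M π (2 ^ j) x) fun τ => h (endState x τ)) := by
    rw [← eq_sub_iff_add_eq] at h3
    rw [← h3, ← ev_smul]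
    conv_lhs => rw [← ev_const (pathLaw M π (2 ^ j) x) (statMean M π v)]
    rw [← ev_sub (BddOn.of_pathLaw _ _ _ _ _) (BddOn.const _ _)]
    exact ev_congr fun τ hτ => levelAvg_sub (length_of_mem_pathLaw M π hτ) _
  have h5 : ‖ev (pathLaw M π (2 ^ j) x) fun τ => h (endState x τ)‖ ≤ C * F :=
    norm_ev_le_of_le fun τ hτ => h1 _ (recurrent_of_mem_pathLaw M π hx hτ).1
  have h6 : (0 : ℝ) < 2 ^ j := by positivity
  rw [h4, norm_smul, norm_inv, Real.norm_of_nonneg h6.le, inv_mul_eq_div]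
  refine div_le_div_of_nonneg_right ?_ h6.le
  refine (norm_sub_le _ _).trans ?_
  linarith [h1 x hx]

lemma ev_levelAvg_sub_sq_le {x : S} (hx : x ∈ M.recurrentStates π) (j : ℕ) :
    ev (pathLaw M π (2 ^ j) x) (fun τ => ‖levelAvg v τ j - statMean M π v‖ ^ 2)
      ≤ 80 * C ^ 2 * F ^ 2 / 2 ^ j := by
  obtain ⟨h, h1, h2⟩ := exists_centered_poisson M π hU hC0 hC hv
  have hF : 0 ≤ F := by
    have := (norm_nonneg _).trans (h1 x hx)
    exact nonneg_of_mul_nonneg_right this (by linarith)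
  have hmean : ‖statMean M π v‖ ≤ F := norm_ev_le_of_le fun z _ => hv z
  have hCF : F ≤ 2 * (C * F) := by nlinarith
  have hσ : ∀ x ∈ M.recurrentStates π, ∀ z ∈ (stepLaw M π x).support,
      ‖(v z - statMean M π v) + h z.2.2 - h x‖ ≤ 6 * (C * F) := by
    intro x hx z hz
    have e1 := h1 x hx
    have e2 := h1 _ (recurrent_of_mem_stepLaw M π hx hz)
    have e3 := norm_sub_le ((v z - statMean M π v) + h z.2.2) (h x)
    have e4 := norm_add_le (v z - statMean M π v) (h z.2.2)
    have e5 := norm_sub_le (v z) (statMean M π v)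
    linarith [hv z]
  have h3 := ev_path_martingale_sq_le M π h2 hσ (2 ^ j) hx
  have h6 : (0 : ℝ) < 2 ^ j := by positivity
  have h7 : (1 : ℝ) ≤ 2 ^ j := one_le_pow₀ (by norm_num)
  have h8 : ∀ τ ∈ (pathLaw M π (2 ^ j) x).support,
      ‖levelAvg v τ j - statMean M π v‖ ^ 2
        ≤ (((2 : ℝ) ^ j)⁻¹) ^ 2 * (2 * ‖(τ.map fun z => v z - statMean M π v).sum
            + h (endState x τ) - h x‖ ^ 2 + 8 * (C * F) ^ 2) := by
    intro τ hτ
    rw [levelAvg_sub (length_of_mem_pathLaw M π hτ), norm_smul, norm_inv,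
      Real.norm_of_nonneg h6.le, mul_pow]
    refine mul_le_mul_of_nonneg_left ?_ (by positivity)
    set s := (τ.map fun z => v z - statMean M π v).sum
    have e1 := h1 x hx
    have e2 := h1 _ (recurrent_of_mem_pathLaw M π hx hτ).1
    have e3 : s = (s + h (endState x τ) - h x) + (h x - h (endState x τ)) := by abel
    have e4 : ‖s‖ ≤ ‖s + h (endState x τ) - h x‖ + 2 * (C * F) := by
      conv_lhs => rw [e3]
      refine (norm_add_le _ _).trans ?_
      linarith [norm_sub_le (h x) (h (endState x τ))]
    set t := ‖s + h (endState x τ) - h x‖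
    have e5 : ‖s‖ ^ 2 ≤ (t + 2 * (C * F)) ^ 2 := pow_le_pow_left₀ (norm_nonneg _) e4 2
    nlinarith [sq_nonneg (t - 2 * (C * F))]
  refine (ev_mono (BddOn.of_pathLaw _ _ _ _ _) (BddOn.of_pathLaw _ _ _ _ _) h8).trans ?_
  rw [ev_mul, ev_add (BddOn.of_pathLaw _ _ _ _ _) (BddOn.const _ _), ev_mul, ev_const]
  push_cast at h3
  have h9 : 2 * ev (pathLaw M π (2 ^ j) x) (fun τ => ‖(τ.map fun z => v z - statMean M π v).sum
      + h (endState x τ) - h x‖ ^ 2) + 8 * (C * F) ^ 2 ≤ 2 ^ j * (80 * C ^ 2 * F ^ 2) := by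
    have : (C * F) ^ 2 ≤ 2 ^ j * (C * F) ^ 2 := le_mul_of_one_le_left (sq_nonneg _) h7
    nlinarith
  calc _ ≤ (((2 : ℝ) ^ j)⁻¹) ^ 2 * (2 ^ j * (80 * C ^ 2 * F ^ 2)) :=
        mul_le_mul_of_nonneg_left h9 (by positivity)
    _ = _ := by field_simp

end Averages

/-! ### Multi-level Monte Carlo batches -/

section Mlmc

lemma geomHalf_toReal_succ (i : ℕ) : (geomHalf (i + 1)).toReal = (2⁻¹ : ℝ) ^ (i + 1) := by
  have : geomHalf (i + 1) = (2⁻¹ : ℝ≥0∞) ^ (i + 1) := by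
    change (if i + 1 = 0 then 0 else (2⁻¹ : ℝ≥0∞) ^ (i + 1)) = _
    simp
  rw [this, ENNReal.toReal_pow, ENNReal.toReal_inv]
  rfl

lemma pos_of_mem_geomHalf {Q : ℕ} (h : Q ∈ geomHalf.support) : 0 < Q := by
  rw [PMF.mem_support_iff] at h
  by_contra h0
  obtain rfl : Q = 0 := by omega
  exact h (if_pos rfl : (if 0 = 0 then (0 : ℝ≥0∞) else 2⁻¹ ^ 0) = 0)

lemma ev_geomHalf {E : Type*} [NormedAddCommGroup E] [NormedSpace ℝ E] {J : ℕ} {G : ℕ → E}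
    (hG : ∀ Q, J < Q → G Q = 0) :
    ev geomHalf G = ∑ i ∈ Finset.range J, (2⁻¹ : ℝ) ^ (i + 1) • G (i + 1) := by
  unfold ev
  rw [tsum_eq_sum (s := Finset.range (J + 1)), Finset.sum_range_succ']
  · have : (geomHalf 0).toReal = 0 :=
      toReal_eq_zero_of_notMem fun h => absurd (pos_of_mem_geomHalf h) (lt_irrefl 0)
    rw [this, zero_smul, add_zero]
    simp only [geomHalf_toReal_succ]
  · intro Q hQ
    rw [hG Q (by simpa [Nat.lt_succ_iff] using hQ), smul_zero]

variable {S A : Type*} (M : CMDP S A) (π : S → PMF A)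

lemma one_le_batchLength (Tmax Q : ℕ) : 1 ≤ batchLength Tmax Q := by
  unfold batchLength
  split_ifs
  · exact Nat.one_le_two_pow
  · exact le_rfl

lemma recurrent_of_mem_batchLaw {Tmax : ℕ} {s : S} (hs : s ∈ M.recurrentStates π)
    {b : Batch S A} (hb : b ∈ (batchLaw M π Tmax s).support) :
    endState s b.path ∈ M.recurrentStates π ∧
      ∀ z ∈ b.path, z.1 ∈ M.recurrentStates π ∧ M.chain π z.1 z.2.2 ≠ 0 := by
  unfold batchLaw at hb
  simp only [PMF.mem_support_bind_iff, PMF.mem_support_map_iff] at hb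
  obtain ⟨Q, -, τ, hτ, rfl⟩ := hb
  exact recurrent_of_mem_pathLaw M π hs hτ

lemma mlmc_congr {E : Type*} [AddCommGroup E] [Module ℝ E] {Tmax : ℕ}
    {v w : Transition S A → E} {b : Batch S A} (h : ∀ z ∈ b.path, v z = w z) :
    mlmc Tmax v b = mlmc Tmax w b := by
  have : ∀ j, levelAvg v b.path j = levelAvg w b.path j := by
    intro j
    unfold levelAvg
    rw [List.map_congr_left fun z hz => h z (List.mem_of_mem_take hz)]
  unfold mlmc
  simp only [this]

variable {E : Type*} [NormedAddCommGroup E] [InnerProductSpace ℝ E]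

lemma norm_mlmc_le {F : ℝ} (hF : 0 ≤ F) {v : Transition S A → E} (hv : ∀ z, ‖v z‖ ≤ F)
    (Tmax : ℕ) (b : Batch S A) : ‖mlmc Tmax v b‖ ≤ (1 + 2 * Tmax) * F := by
  have hl := norm_levelAvg_le hF hv b.path
  unfold mlmc
  refine (norm_add_le _ _).trans ?_
  have h2 : ‖if 2 ^ b.level ≤ Tmax then (2 : ℝ) ^ b.level •
      (levelAvg v b.path b.level - levelAvg v b.path (b.level - 1)) else 0‖ ≤ Tmax * (2 * F) := by
    split_ifs with h
    · rw [norm_smul, norm_pow, Real.norm_ofNat]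
      refine mul_le_mul (by exact_mod_cast h) ?_ (norm_nonneg _) (by positivity)
      linarith [norm_sub_le (levelAvg v b.path b.level) (levelAvg v b.path (b.level - 1)),
        hl b.level, hl (b.level - 1)]
    · rw [norm_zero]; positivity
  linarith [hl 0]

variable [Fintype S] [Finite A] {C F : ℝ}
  (hU : M.IsUnichain π) (hC0 : 1 / 2 ≤ C) (hC : M.targetTime π ≤ ENNReal.ofReal C)
  [CompleteSpace E] {v : Transition S A → E} (hF : 0 ≤ F) (hv : ∀ z, ‖v z‖ ≤ F)

lemma ev_batchLaw {G : Type*} [NormedAddCommGroup G] [NormedSpace ℝ G] [CompleteSpace G]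
    {Tmax : ℕ} {s : S} {f : Batch S A → G} (hf : ∃ B, ∀ b, ‖f b‖ ≤ B) :
    ev (batchLaw M π Tmax s) f
      = ev geomHalf fun Q => ev (pathLaw M π (batchLength Tmax Q) s) fun τ => f ⟨Q, τ⟩ := by
  obtain ⟨B, hB⟩ := hf
  unfold batchLaw
  rw [ev_bind ⟨B, fun b _ => hB b⟩]
  exact ev_congr fun Q _ => ev_map ⟨B, fun b _ => hB b⟩

lemma ev_levelAvg {G : Type*} [NormedAddCommGroup G] [NormedSpace ℝ G] [CompleteSpace G]
    {n j : ℕ} (h : 2 ^ j ≤ n) (s : S) (f : E → G) :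
    ev (pathLaw M π n s) (fun τ => f (levelAvg v τ j))
      = ev (pathLaw M π (2 ^ j) s) (fun τ => f (levelAvg v τ j)) := by
  rw [← ev_pathLaw_take M π h]
  refine ev_congr fun τ _ => ?_
  unfold levelAvg
  rw [List.take_take, min_self]

lemma pow_le_iff_le_log {Tmax Q : ℕ} (hT : 2 ≤ Tmax) : 2 ^ Q ≤ Tmax ↔ Q ≤ Nat.log 2 Tmax :=
  (Nat.le_log_iff_pow_le (by norm_num) (by omega)).symm

include hF hv in
/-- The mean of the multi-level estimate telescopes to the mean over the longest trajectory. -/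
lemma ev_mlmc {Tmax : ℕ} (hT : 2 ≤ Tmax) (s : S) :
    ev (batchLaw M π Tmax s) (mlmc Tmax v)
      = ev (pathLaw M π (2 ^ Nat.log 2 Tmax) s) fun τ => levelAvg v τ (Nat.log 2 Tmax) := by
  set J := Nat.log 2 Tmax with hJ
  set a : ℕ → E := fun j => ev (pathLaw M π (2 ^ j) s) fun τ => levelAvg v τ j with ha
  have h1 : ∀ Q ∈ geomHalf.support,
      ev (pathLaw M π (batchLength Tmax Q) s) (fun τ => mlmc Tmax v ⟨Q, τ⟩)
        = a 0 + if Q ≤ J then (2 : ℝ) ^ Q • (a Q - a (Q - 1)) else 0 := by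
    intro Q hQ
    have e0 : ev (pathLaw M π (batchLength Tmax Q) s) (fun τ => levelAvg v τ 0) = a 0 :=
      ev_levelAvg M π (by simpa using one_le_batchLength Tmax Q) s id
    simp only [mlmc, pow_le_iff_le_log hT, ← hJ]
    rw [ev_add (BddOn.of_pathLaw _ _ _ _ _) (BddOn.of_pathLaw _ _ _ _ _), e0]
    congr 1
    split_ifs with hQJ
    · have hlen : batchLength Tmax Q = 2 ^ Q := if_pos ((pow_le_iff_le_log hT).2 hQJ)
      rw [ev_smul, ev_sub (BddOn.of_pathLaw _ _ _ _ _) (BddOn.of_pathLaw _ _ _ _ _), hlen]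
      have e1 := ev_levelAvg (v := v) M π (j := Q - 1) (n := 2 ^ Q)
        (Nat.pow_le_pow_right (by norm_num) (by omega)) s id
      simp only [id] at e1
      rw [e1]
    · exact ev_const _ _
  rw [ev_batchLaw M π ⟨_, norm_mlmc_le hF hv Tmax⟩, ev_congr h1]
  have hb : BddOn geomHalf fun Q => if Q ≤ J then (2 : ℝ) ^ Q • (a Q - a (Q - 1)) else 0 := by
    obtain ⟨B, hB⟩ := ((Finset.range (J + 1)).image fun Q =>
      ‖(2 : ℝ) ^ Q • (a Q - a (Q - 1))‖).bddAbove
    refine ⟨max B 0, fun Q _ => ?_⟩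
    dsimp only
    split_ifs with hQ
    · exact le_max_of_le_left (hB (Finset.mem_coe.2
        (Finset.mem_image_of_mem _ (Finset.mem_range.2 (by omega)))))
    · simp
  rw [ev_add (BddOn.const _ _) hb, ev_const,
    ev_geomHalf (J := J) fun Q hQ => if_neg (not_le.2 hQ)]
  have h2 : ∀ i ∈ Finset.range J, ((2⁻¹ : ℝ) ^ (i + 1) •
      if i + 1 ≤ J then (2 : ℝ) ^ (i + 1) • (a (i + 1) - a (i + 1 - 1)) else 0)
        = a (i + 1) - a i := by
    intro i hi
    rw [if_pos (Nat.succ_le_of_lt (Finset.mem_range.1 hi)), smul_smul, ← mul_pow, inv_mul_cancel₀ (by norm_num),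
      one_pow, one_smul, Nat.add_sub_cancel]
  rw [Finset.sum_congr rfl h2, Finset.sum_range_sub]
  abel

include hU hC0 hC hF hv

lemma norm_ev_mlmc_sub_le {Tmax : ℕ} (hT : 2 ≤ Tmax) {s : S} (hs : s ∈ M.recurrentStates π) :
    ‖ev (batchLaw M π Tmax s) (mlmc Tmax v) - statMean M π v‖ ≤ 4 * C * F / Tmax := by
  rw [ev_mlmc M π hF hv hT]
  refine (norm_ev_levelAvg_sub_le M π hU hC0 hC hv hs _).trans ?_
  have h1 : Tmax < 2 ^ (Nat.log 2 Tmax + 1) := Nat.lt_pow_succ_log_self (by norm_num) _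
  have h2 : (Tmax : ℝ) ≤ 2 * 2 ^ Nat.log 2 Tmax := by
    rw [pow_succ] at h1
    have : (Tmax : ℝ) < 2 ^ Nat.log 2 Tmax * 2 := by exact_mod_cast h1
    linarith
  have h3 : (0 : ℝ) < Tmax := by exact_mod_cast (by omega : 0 < Tmax)
  rw [div_le_div_iff₀ (by positivity) h3]
  have : 0 ≤ C * F := mul_nonneg (by linarith) hF
  nlinarith

/-- Level `Q` occurs with probability `2^{-Q}` and contributes a correction of mean square
`O(4^Q · C² F² 2^{-Q})`; hence all levels contribute equally, and the second moment grows with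
their number, that is, with `log Tmax`. -/
lemma ev_mlmc_sq_le {Tmax : ℕ} (hT : 2 ≤ Tmax) {s : S} (hs : s ∈ M.recurrentStates π) :
    ev (batchLaw M π Tmax s) (fun b => ‖mlmc Tmax v b‖ ^ 2)
      ≤ 1500 * C ^ 2 * Real.log Tmax * F ^ 2 := by
  set J := Nat.log 2 Tmax with hJ
  have hbd : ∃ B, ∀ b, ‖(fun b => ‖mlmc (S := S) (A := A) Tmax v b‖ ^ 2) b‖ ≤ B := by
    refine ⟨((1 + 2 * Tmax) * F) ^ 2, fun b => ?_⟩
    rw [norm_pow, norm_norm]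
    exact pow_le_pow_left₀ (norm_nonneg _) (norm_mlmc_le hF hv Tmax b) 2
  rw [ev_batchLaw M π hbd]
  set G : ℕ → ℝ := fun Q => if Q ≤ J then 960 * C ^ 2 * F ^ 2 * 2 ^ Q else 0 with hG
  have h1 : ∀ Q ∈ geomHalf.support,
      ev (pathLaw M π (batchLength Tmax Q) s) (fun τ => ‖mlmc Tmax v ⟨Q, τ⟩‖ ^ 2)
        ≤ 2 * F ^ 2 + G Q := by
    intro Q hQ
    have hQ0 := pos_of_mem_geomHalf hQ
    simp only [mlmc, pow_le_iff_le_log hT, ← hJ, hG]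
    split_ifs with hQJ
    · have hlen : batchLength Tmax Q = 2 ^ Q := if_pos ((pow_le_iff_le_log hT).2 hQJ)
      rw [hlen]
      set w := statMean M π v
      have hp : ∀ τ ∈ (pathLaw M π (2 ^ Q) s).support,
          ‖levelAvg v τ 0 + (2 : ℝ) ^ Q • (levelAvg v τ Q - levelAvg v τ (Q - 1))‖ ^ 2
          ≤ 2 * F ^ 2 + 4 * (2 ^ Q) ^ 2 * (‖levelAvg v τ Q - w‖ ^ 2
              + ‖levelAvg v τ (Q - 1) - w‖ ^ 2) := by
        intro τ _
        have e0 := norm_levelAvg_le hF hv τ 0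
        have e1 : ‖levelAvg v τ Q - levelAvg v τ (Q - 1)‖
            ≤ ‖levelAvg v τ Q - w‖ + ‖levelAvg v τ (Q - 1) - w‖ := by
          rw [← sub_sub_sub_cancel_right _ _ w]
          exact norm_sub_le _ _
        have e2 := norm_add_le (levelAvg v τ 0)
          ((2 : ℝ) ^ Q • (levelAvg v τ Q - levelAvg v τ (Q - 1)))
        rw [norm_smul, norm_pow, Real.norm_ofNat] at e2
        set x := ‖levelAvg v τ Q - w‖
        set y := ‖levelAvg v τ (Q - 1) - w‖
        have e3 : ‖levelAvg v τ 0 + (2 : ℝ) ^ Q • (levelAvg v τ Q - levelAvg v τ (Q - 1))‖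
            ≤ F + 2 ^ Q * (x + y) := by
          have : (2 : ℝ) ^ Q * ‖levelAvg v τ Q - levelAvg v τ (Q - 1)‖ ≤ 2 ^ Q * (x + y) :=
            mul_le_mul_of_nonneg_left e1 (by positivity)
          linarith
        refine (pow_le_pow_left₀ (norm_nonneg _) e3 2).trans ?_
        have e4 : 2 * (2 ^ Q * (x + y)) ^ 2 ≤ 4 * ((2 : ℝ) ^ Q) ^ 2 * (x ^ 2 + y ^ 2) := by
          have : 0 ≤ ((2 : ℝ) ^ Q) ^ 2 * (x - y) ^ 2 := by positivity
          nlinarith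
        nlinarith [sq_nonneg (F - 2 ^ Q * (x + y))]
      refine (ev_mono (BddOn.of_pathLaw _ _ _ _ _) (BddOn.of_pathLaw _ _ _ _ _) hp).trans ?_
      rw [ev_add (BddOn.const _ _) (BddOn.of_pathLaw _ _ _ _ _), ev_const, ev_mul,
        ev_add (BddOn.of_pathLaw _ _ _ _ _) (BddOn.of_pathLaw _ _ _ _ _)]
      have e1 := ev_levelAvg_sub_sq_le M π hU hC0 hC hv hs Q
      have e2 := ev_levelAvg_sub_sq_le M π hU hC0 hC hv hs (Q - 1)
      rw [← ev_levelAvg M π (v := v) (n := 2 ^ Q) (Nat.pow_le_pow_right (by norm_num) (by omega))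
        s (fun y => ‖y - statMean M π v‖ ^ 2)] at e2
      obtain ⟨i, rfl⟩ : ∃ i, Q = i + 1 := ⟨Q - 1, by omega⟩
      rw [Nat.add_sub_cancel] at e2 ⊢
      have h2i : (0 : ℝ) < 2 ^ i := by positivity
      refine add_le_add le_rfl ((mul_le_mul_of_nonneg_left (add_le_add e1 e2)
        (by positivity)).trans (le_of_eq ?_))
      rw [pow_succ]
      field_simp
      ring
    · simp only [add_zero]
      refine ev_le_of_le (BddOn.of_pathLaw _ _ _ _ _) fun τ _ => ?_
      have := pow_le_pow_left₀ (norm_nonneg _) (norm_levelAvg_le hF hv τ 0) 2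
      nlinarith [sq_nonneg F]
  have hGb : BddOn geomHalf G := by
    refine ⟨960 * C ^ 2 * F ^ 2 * 2 ^ J, fun Q _ => ?_⟩
    simp only [hG]
    split_ifs with hQ
    · rw [Real.norm_of_nonneg (by positivity)]
      gcongr
      norm_num
    · rw [norm_zero]; positivity
  have hlb : BddOn geomHalf fun Q =>
      ev (pathLaw M π (batchLength Tmax Q) s) (fun τ => ‖mlmc Tmax v ⟨Q, τ⟩‖ ^ 2) := by
    obtain ⟨B, hB⟩ := hbd
    exact ⟨B, fun Q _ => norm_ev_le_of_le fun τ _ => hB _⟩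
  refine (ev_mono hlb ((BddOn.const _ _).add hGb) h1).trans ?_
  rw [ev_add (BddOn.const _ _) hGb, ev_const,
    ev_geomHalf (J := J) fun Q hQ => if_neg (not_le.2 hQ)]
  have h2 : ∀ i ∈ Finset.range J, ((2⁻¹ : ℝ) ^ (i + 1) • G (i + 1)) = 960 * C ^ 2 * F ^ 2 := by
    intro i hi
    simp only [hG]
    rw [if_pos (Nat.succ_le_of_lt (Finset.mem_range.1 hi)), smul_eq_mul, inv_pow]
    field_simp
  rw [Finset.sum_congr rfl h2, Finset.sum_const, Finset.card_range, nsmul_eq_mul]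
  have hJ1 : 1 ≤ J := (pow_le_iff_le_log hT).1 (by simpa using hT)
  have hJ1' : (1 : ℝ) ≤ J := by exact_mod_cast hJ1
  have hJlog : (J : ℝ) * Real.log 2 ≤ Real.log Tmax := by
    rw [← Real.log_pow]
    refine Real.log_le_log (by positivity) ?_
    exact_mod_cast Nat.pow_log_le_self 2 (by omega)
  have hlog2 := Real.log_two_gt_d9
  have hJ2 : 0.69 * (J : ℝ) ≤ Real.log Tmax := by nlinarith
  have hCF : F ^ 2 ≤ 4 * (C ^ 2 * F ^ 2) := by
    have : 1 ≤ 4 * C ^ 2 := by nlinarith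
    nlinarith [sq_nonneg F]
  have hCF0 : 0 ≤ C ^ 2 * F ^ 2 := by positivity
  have hA : 2 * F ^ 2 + J * (960 * C ^ 2 * F ^ 2) ≤ 968 * J * (C ^ 2 * F ^ 2) := by nlinarith
  have hB : 968 * J * (C ^ 2 * F ^ 2) ≤ 1500 * Real.log Tmax * (C ^ 2 * F ^ 2) :=
    mul_le_mul_of_nonneg_right (by linarith) hCF0
  linarith

end Mlmc

/-! ### The stationary critic equation -/

section Pinv

variable {F : Type*} [NormedAddCommGroup F] [InnerProductSpace ℝ F] [FiniteDimensional ℝ F]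

lemma pinv_mem (L : F →ₗ[ℝ] F) (b : F) : pinv L b ∈ (LinearMap.ker L)ᗮ := by
  unfold pinv
  simp only [LinearMap.comp_apply, Submodule.subtype_apply]
  exact Submodule.coe_mem _

lemma apply_pinv {L : F →ₗ[ℝ] F} {b : F} (hb : b ∈ LinearMap.range L) : L (pinv L b) = b := by
  unfold pinv
  simp only [LinearMap.comp_apply, Submodule.subtype_apply]
  set e := L.kerComplementEquivRange
      (C := (LinearMap.ker L)ᗮ) (LinearMap.ker L).isCompl_orthogonal.symm with he
  have h1 : ∀ x : ((LinearMap.ker L)ᗮ : Submodule ℝ F), L (x : F) = (e x : F) := fun x => rfl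
  rw [h1]
  change ((e (e.symm ((LinearMap.range L).orthogonalProjectionOnto b)) : LinearMap.range L) : F) = b
  rw [LinearEquiv.apply_symm_apply]
  exact Submodule.starProjection_eq_self_iff.2 hb

end Pinv

section StatMean

variable {S A : Type*} [Fintype S] [Fintype A] (M : CMDP S A) (π : S → PMF A)

lemma statExp_eq_statMean {E : Type*} [NormedAddCommGroup E] [InnerProductSpace ℝ E]
    [CompleteSpace E] (f : S → A → S → E) :
    M.statExp π f = statMean M π fun z => f z.1 z.2.1 z.2.2 := by
  unfold statMean CMDP.statExp
  rw [ev_bind (BddOn.of_finite _ _), ev_eq_sum]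
  refine Finset.sum_congr rfl fun s _ => ?_
  unfold stepLaw
  rw [ev_bind (BddOn.of_finite _ _), ev_eq_sum, Finset.smul_sum]
  refine Finset.sum_congr rfl fun a _ => ?_
  rw [ev_map (BddOn.of_finite _ _), ev_eq_sum, Finset.smul_sum, Finset.smul_sum]
  refine Finset.sum_congr rfl fun s' _ => ?_
  simp only [smul_smul, mul_assoc]

lemma statExp_apply {E F : Type*} [AddCommGroup E] [Module ℝ E] [AddCommGroup F] [Module ℝ F]
    (f : S → A → S → E →ₗ[ℝ] F) (x : E) :
    M.statExp π f x = M.statExp π fun s a s' => f s a s' x := by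
  unfold CMDP.statExp
  simp only [LinearMap.sum_apply, LinearMap.smul_apply]

variable {E F : Type*} [NormedAddCommGroup E] [InnerProductSpace ℝ E]
    [CompleteSpace E] [NormedAddCommGroup F] [InnerProductSpace ℝ F]
    [CompleteSpace F]

lemma statMean_add (u v : Transition S A → E) :
    statMean M π (fun z => u z + v z) = statMean M π u + statMean M π v :=
  ev_add (BddOn.of_finite _ _) (BddOn.of_finite _ _)

lemma statMean_sub (u v : Transition S A → E) :
    statMean M π (fun z => u z - v z) = statMean M π u - statMean M π v :=
  ev_sub (BddOn.of_finite _ _) (BddOn.of_finite _ _)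

lemma statMean_smul (t : ℝ) (u : Transition S A → E) :
    statMean M π (fun z => t • u z) = t • statMean M π u :=
  ev_smul _ _ _

lemma statMean_clm (L : E →L[ℝ] F) (u : Transition S A → E) :
    statMean M π (fun z => L (u z)) = L (statMean M π u) :=
  ev_clm (BddOn.of_finite _ _) L

lemma statMean_inner (x : E) (u : Transition S A → E) :
    statMean M π (fun z => inner ℝ x (u z)) = inner ℝ x (statMean M π u) :=
  statMean_clm M π (innerSL ℝ x) u

lemma norm_statMean_le {C : ℝ} {u : Transition S A → E} (h : ∀ z, ‖u z‖ ≤ C) :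
    ‖statMean M π u‖ ≤ C :=
  norm_ev_le_of_le fun z _ => h z

lemma statMean_next (f : S → E) :
    statMean M π (fun z => f z.2.2) = statMean M π (fun z => f z.1) := by
  unfold statMean
  rw [ev_bind (BddOn.of_finite _ _), ev_bind (BddOn.of_finite _ _)]
  have h1 : ∀ s, ev (stepLaw M π s) (fun z => f z.1) = f s := by
    intro s
    conv_rhs => rw [← ev_const (stepLaw M π s) (f s)]
    exact ev_congr fun z hz => by rw [fst_of_mem_stepLaw M π hz]
  have h2 : ∀ s, ev (stepLaw M π s) (fun z => f z.2.2) = ev (M.chain π s) f := by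
    intro s
    rw [← stepLaw_map_next, ev_map (BddOn.of_finite _ _)]
  simp only [h1, h2]
  exact ev_statDist_chain M π f

lemma recurrent_of_mem_stat {z : Transition S A}
    (hz : z ∈ ((M.statDist π).bind (stepLaw M π)).support) : z.1 ∈ M.recurrentStates π := by
  rw [PMF.mem_support_bind_iff] at hz
  obtain ⟨s, hs, hz⟩ := hz
  rw [fst_of_mem_stepLaw M π hz]
  exact recurrent_of_statDist_ne_zero M π hs

lemma eq_zero_of_statMean_sq_eq_zero (hU : M.IsUnichain π) {f : S → S → ℝ}
    (h : statMean M π (fun z => f z.1 z.2.2 ^ 2) = 0) {s s' : S} (hs : s ∈ M.recurrentStates π)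
    (hss : M.chain π s s' ≠ 0) : f s s' = 0 := by
  unfold statMean at h
  rw [ev_eq_sum] at h
  have hmem : s' ∈ ((stepLaw M π s).map fun z => z.2.2).support := by
    rw [stepLaw_map_next]; exact hss
  obtain ⟨z, hz, rfl⟩ := (PMF.mem_support_map_iff _ _ _).1 hmem
  have hz1 := fst_of_mem_stepLaw M π hz
  have hz2 : z ∈ ((M.statDist π).bind (stepLaw M π)).support :=
    (PMF.mem_support_bind_iff _ _ _).2 ⟨s, (statDist_ne_zero_iff M π hU).2 hs, hz⟩
  have h0 := (Finset.sum_eq_zero_iff_of_nonneg fun z _ =>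
    smul_nonneg ENNReal.toReal_nonneg (sq_nonneg _)).1 h z (Finset.mem_univ z)
  rw [smul_eq_mul, mul_eq_zero] at h0
  rcases h0 with h0 | h0
  · exact absurd h0 (ENNReal.toReal_pos hz2 (PMF.apply_ne_top _ _)).ne'
  · rw [hz1] at h0
    exact pow_eq_zero_iff (two_ne_zero) |>.1 h0

end StatMean

section CriticEquation

variable {S A : Type*} [Fintype S] [Fintype A] {d : ℕ} {m : Signal → ℕ} (M : Model S A d m)
  (g : Signal) (θ : EuclideanSpace ℝ (Fin d)) (cγ : ℝ)

lemma featureMatrix_apply (x : EuclideanSpace ℝ (Fin (m g))) :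
    M.featureMatrix g θ x = statMean M.toCMDP (M.policy θ) fun z =>
      inner ℝ (M.feature g z.1 - M.feature g z.2.2) x • M.feature g z.1 := by
  unfold Model.featureMatrix
  rw [statExp_apply, statExp_eq_statMean]
  rfl

lemma meanA_apply (ξ : CriticVec (EuclideanSpace ℝ (Fin (m g)))) :
    M.meanA cγ g θ ξ = statMean M.toCMDP (M.policy θ) fun z =>
      criticA cγ (M.feature g) z.1 z.2.2 ξ := by
  unfold Model.meanA
  rw [statExp_apply, statExp_eq_statMean]

lemma meanB_eq : M.meanB cγ g θ = statMean M.toCMDP (M.policy θ) fun z =>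
      criticB cγ (M.feature g) (M.signal g z.1 z.2.1) z.1 := by
  unfold Model.meanB
  rw [statExp_eq_statMean]

lemma inner_featureMatrix (x y : EuclideanSpace ℝ (Fin (m g))) :
    inner ℝ y (M.featureMatrix g θ x) = statMean M.toCMDP (M.policy θ) fun z =>
      inner ℝ (M.feature g z.1 - M.feature g z.2.2) x * inner ℝ y (M.feature g z.1) := by
  rw [featureMatrix_apply, ← statMean_inner]
  simp only [inner_smul_right]

/-- The quadratic form of the feature matrix is a Dirichlet form. -/
lemma inner_featureMatrix_self (x : EuclideanSpace ℝ (Fin (m g))) :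
    inner ℝ x (M.featureMatrix g θ x) = (1 / 2 : ℝ) * statMean M.toCMDP (M.policy θ) fun z =>
      (inner ℝ x (M.feature g z.1) - inner ℝ x (M.feature g z.2.2)) ^ 2 := by
  rw [inner_featureMatrix]
  set f : S → ℝ := fun s => inner ℝ x (M.feature g s) with hf
  have h1 : (fun z : Transition S A =>
      inner ℝ (M.feature g z.1 - M.feature g z.2.2) x * inner ℝ x (M.feature g z.1))
      = fun z => (1 / 2 : ℝ) • (f z.1 - f z.2.2) ^ 2
        + ((1 / 2 : ℝ) • f z.1 ^ 2 - (1 / 2 : ℝ) • f z.2.2 ^ 2) := by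
    funext z
    rw [real_inner_comm, inner_sub_right]
    simp only [hf, smul_eq_mul]
    ring
  rw [h1, statMean_add, statMean_sub, statMean_smul, statMean_smul, statMean_smul,
    statMean_next _ _ (fun s => f s ^ 2), sub_self, add_zero, smul_eq_mul]

variable (hU : M.IsUnichain (M.policy θ))
include hU

/-- Along every transition inside the recurrent class, a vector of the kernel has the same inner
product with the two features. -/
lemma inner_feature_eq_of_step {x : EuclideanSpace ℝ (Fin (m g))}
    (hx : x ∈ LinearMap.ker (M.featureMatrix g θ)) {s s' : S}
    (hs : s ∈ M.recurrentStates (M.policy θ)) (hss : M.chain (M.policy θ) s s' ≠ 0) :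
    inner ℝ x (M.feature g s) = inner ℝ x (M.feature g s') := by
  have h := inner_featureMatrix_self M g θ x
  rw [LinearMap.mem_ker.1 hx, inner_zero_right] at h
  have h0 : statMean M.toCMDP (M.policy θ) (fun z =>
      (inner ℝ x (M.feature g z.1) - inner ℝ x (M.feature g z.2.2)) ^ 2) = 0 := by linarith
  exact sub_eq_zero.1 (eq_zero_of_statMean_sq_eq_zero M.toCMDP (M.policy θ) hU
    (f := fun s s' => inner ℝ x (M.feature g s) - inner ℝ x (M.feature g s')) h0 hs hss)

lemma exists_inner_feature_eq {x : EuclideanSpace ℝ (Fin (m g))}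
    (hx : x ∈ LinearMap.ker (M.featureMatrix g θ)) :
    ∃ κ : ℝ, ∀ s ∈ M.recurrentStates (M.policy θ), inner ℝ x (M.feature g s) = κ := by
  obtain ⟨s₀, hs₀⟩ := (M.statDist (M.policy θ)).support_nonempty
  have hR := recurrent_of_statDist_ne_zero M.toCMDP (M.policy θ) hs₀
  refine ⟨inner ℝ x (M.feature g s₀), fun s hs => ?_⟩
  have hr := hU s₀ hR s hs
  suffices s ∈ M.recurrentStates (M.policy θ) ∧
      inner ℝ x (M.feature g s) = inner ℝ x (M.feature g s₀) from this.2
  clear hs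
  induction hr with
  | refl => exact ⟨hR, rfl⟩
  | tail _ h ih =>
    exact ⟨M.recurrent_of_step _ ih.1 h,
      (inner_feature_eq_of_step M g θ hU hx ih.1 h).symm.trans ih.2⟩

/-- Although the feature matrix is not symmetric, its range is the orthogonal complement of its
kernel. -/
lemma range_featureMatrix :
    LinearMap.range (M.featureMatrix g θ) = (LinearMap.ker (M.featureMatrix g θ))ᗮ := by
  refine Submodule.eq_of_le_of_finrank_eq ?_ ?_
  · rintro _ ⟨y, rfl⟩
    rw [Submodule.mem_orthogonal]
    intro x hx
    obtain ⟨κ, hκ⟩ := exists_inner_feature_eq M g θ hU hx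
    rw [inner_featureMatrix]
    have h1 : statMean M.toCMDP (M.policy θ) (fun z =>
        inner ℝ (M.feature g z.1 - M.feature g z.2.2) y * inner ℝ x (M.feature g z.1))
        = statMean M.toCMDP (M.policy θ) (fun z =>
          κ • (inner ℝ y (M.feature g z.1) - inner ℝ y (M.feature g z.2.2))) := by
      refine ev_congr fun z hz => ?_
      rw [hκ _ (recurrent_of_mem_stat _ _ hz), real_inner_comm, inner_sub_right, smul_eq_mul,
        mul_comm]
    rw [h1, statMean_smul, statMean_sub,
      statMean_next _ _ (fun s => inner ℝ y (M.feature g s)), sub_self, smul_zero]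
  · have h1 := (M.featureMatrix g θ).finrank_range_add_finrank_ker
    have h2 := (LinearMap.ker (M.featureMatrix g θ)).finrank_add_finrank_orthogonal
    omega

/-- On transitions of the recurrent class the critic update only sees the projected iterate. -/
lemma criticA_proj (ξ : CriticVec (EuclideanSpace ℝ (Fin (m g)))) {s s' : S}
    (hs : s ∈ M.recurrentStates (M.policy θ)) (hss : M.chain (M.policy θ) s s' ≠ 0) :
    criticA cγ (M.feature g) s s' (M.proj g θ ξ) = criticA cγ (M.feature g) s s' ξ := by
  set K := (LinearMap.ker (M.featureMatrix g θ))ᗮ with hK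
  have hmem : ξ.snd - K.starProjection ξ.snd ∈ LinearMap.ker (M.featureMatrix g θ) := by
    have := K.sub_starProjection_mem_orthogonal ξ.snd
    have hKK : Kᗮ = LinearMap.ker (M.featureMatrix g θ) := Submodule.orthogonal_orthogonal _
    rwa [hKK] at this
  have h1 := inner_feature_eq_of_step M g θ hU hmem hs hss
  have h2 : inner ℝ (M.feature g s - M.feature g s') ξ.snd
      = inner ℝ (M.feature g s - M.feature g s') (K.starProjection ξ.snd) := by
    rw [← sub_eq_zero, ← inner_sub_right, real_inner_comm, inner_sub_right, h1, sub_self]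
  apply (WithLp.ofLp_injective 2)
  ext1
  · rfl
  · change ξ.fst • M.feature g s + inner ℝ (M.feature g s - M.feature g s')
      (K.starProjection ξ.snd) • M.feature g s = ξ.fst • M.feature g s
        + inner ℝ (M.feature g s - M.feature g s') ξ.snd • M.feature g s
    rw [h2]

end CriticEquation

section CriticBounds

variable {S A : Type*} [Fintype S] [Fintype A] {d : ℕ} {m : Signal → ℕ} (M : Model S A d m)
  (g : Signal) (θ : EuclideanSpace ℝ (Fin d)) (cγ : ℝ)

/-- The projection `Π` as a continuous linear map. -/
noncomputable def projL : CriticVec (EuclideanSpace ℝ (Fin (m g))) →L[ℝ]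
    CriticVec (EuclideanSpace ℝ (Fin (m g))) :=
  (WithLp.prodContinuousLinearEquiv 2 ℝ ℝ (EuclideanSpace ℝ (Fin (m g)))).symm.toContinuousLinearMap
    ∘L ((WithLp.fstL 2 ℝ ℝ (EuclideanSpace ℝ (Fin (m g)))).prod
      ((LinearMap.ker (M.featureMatrix g θ))ᗮ.starProjection
        ∘L WithLp.sndL 2 ℝ ℝ (EuclideanSpace ℝ (Fin (m g)))))

lemma projL_apply (ξ : CriticVec (EuclideanSpace ℝ (Fin (m g)))) :
    projL M g θ ξ = M.proj g θ ξ := rfl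

lemma norm_projL_le (ξ : CriticVec (EuclideanSpace ℝ (Fin (m g)))) :
    ‖projL M g θ ξ‖ ≤ ‖ξ‖ := by
  rw [projL_apply, ← sq_le_sq₀ (norm_nonneg _) (norm_nonneg _), WithLp.prod_norm_sq_eq_of_L2,
    WithLp.prod_norm_sq_eq_of_L2]
  have h : ‖(M.proj g θ ξ).snd‖ ≤ ‖ξ.snd‖ := Submodule.norm_starProjection_apply_le _ _
  have h2 : (M.proj g θ ξ).fst = ξ.fst := rfl
  rw [h2]
  gcongr

lemma projL_eq_self_iff {ξ : CriticVec (EuclideanSpace ℝ (Fin (m g)))} :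
    projL M g θ ξ = ξ ↔ ξ.snd ∈ (LinearMap.ker (M.featureMatrix g θ))ᗮ := by
  rw [← Submodule.starProjection_eq_self_iff]
  constructor
  · intro h
    exact congrArg WithLp.snd h
  · intro h
    apply (WithLp.ofLp_injective 2)
    ext1
    · rfl
    · exact h

lemma snd_projL_mem (ξ : CriticVec (EuclideanSpace ℝ (Fin (m g)))) :
    (projL M g θ ξ).snd ∈ (LinearMap.ker (M.featureMatrix g θ))ᗮ :=
  Submodule.starProjection_apply_mem _ _

lemma projL_projL (ξ : CriticVec (EuclideanSpace ℝ (Fin (m g)))) :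
    projL M g θ (projL M g θ ξ) = projL M g θ ξ :=
  (projL_eq_self_iff M g θ).2 (snd_projL_mem M g θ ξ)

lemma inner_projL {e : CriticVec (EuclideanSpace ℝ (Fin (m g)))}
    (he : projL M g θ e = e) (ξ : CriticVec (EuclideanSpace ℝ (Fin (m g)))) :
    inner ℝ e (projL M g θ ξ) = inner ℝ e ξ := by
  rw [WithLp.prod_inner_apply, WithLp.prod_inner_apply]
  congr 1
  have h := (projL_eq_self_iff M g θ).1 he
  have h1 : inner ℝ e.snd
      (ξ.snd - (LinearMap.ker (M.featureMatrix g θ))ᗮ.starProjection ξ.snd) = 0 :=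
    Submodule.inner_right_of_mem_orthogonal h (Submodule.sub_starProjection_mem_orthogonal _)
  rw [inner_sub_right, sub_eq_zero] at h1
  exact h1.symm

lemma norm_criticVec_le (ξ : CriticVec (EuclideanSpace ℝ (Fin (m g)))) :
    ‖ξ‖ ≤ |ξ.fst| + ‖ξ.snd‖ := by
  rw [← sq_le_sq₀ (norm_nonneg _) (by positivity), WithLp.prod_norm_sq_eq_of_L2,
    Real.norm_eq_abs]
  nlinarith [abs_nonneg ξ.fst, norm_nonneg ξ.snd]

lemma abs_fst_le (ξ : CriticVec (EuclideanSpace ℝ (Fin (m g)))) : |ξ.fst| ≤ ‖ξ‖ := by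
  rw [← sq_le_sq₀ (abs_nonneg _) (norm_nonneg _), WithLp.prod_norm_sq_eq_of_L2, Real.norm_eq_abs]
  nlinarith [sq_nonneg ‖ξ.snd‖]

lemma norm_snd_le (ξ : CriticVec (EuclideanSpace ℝ (Fin (m g)))) : ‖ξ.snd‖ ≤ ‖ξ‖ := by
  rw [← sq_le_sq₀ (norm_nonneg _) (norm_nonneg _), WithLp.prod_norm_sq_eq_of_L2]
  nlinarith [sq_nonneg ‖ξ.fst‖]

lemma abs_signal_le (s : S) (a : A) : |M.signal g s a| ≤ 1 := by
  cases g
  · have := M.reward_mem s a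
    exact abs_le.2 ⟨le_trans (by norm_num) this.1, this.2⟩
  · exact abs_le.2 (M.cost_mem s a)

variable (hφ : ∀ s, ‖M.feature g s‖ ≤ 1) (hc : 1 ≤ cγ)
include hφ hc

lemma norm_criticA_le (s s' : S) (ξ : CriticVec (EuclideanSpace ℝ (Fin (m g)))) :
    ‖criticA cγ (M.feature g) s s' ξ‖ ≤ 4 * cγ * ‖ξ‖ := by
  refine (norm_criticVec_le g _).trans ?_
  change |cγ * ξ.fst| + ‖ξ.fst • M.feature g s
    + inner ℝ (M.feature g s - M.feature g s') ξ.snd • M.feature g s‖ ≤ _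
  have h1 := abs_fst_le g ξ
  have h2 := norm_snd_le g ξ
  have h3 : ‖ξ.fst • M.feature g s‖ ≤ ‖ξ‖ := by
    rw [norm_smul, Real.norm_eq_abs]
    nlinarith [abs_nonneg ξ.fst, hφ s, norm_nonneg (M.feature g s)]
  have h4 : |inner ℝ (M.feature g s - M.feature g s') ξ.snd| ≤ 2 * ‖ξ‖ := by
    refine (abs_real_inner_le_norm _ _).trans ?_
    have : ‖M.feature g s - M.feature g s'‖ ≤ 2 := by
      linarith [norm_sub_le (M.feature g s) (M.feature g s'), hφ s, hφ s']
    exact mul_le_mul this h2 (norm_nonneg _) (by norm_num)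
  have h5 : ‖inner ℝ (M.feature g s - M.feature g s') ξ.snd • M.feature g s‖ ≤ 2 * ‖ξ‖ := by
    rw [norm_smul, Real.norm_eq_abs]
    nlinarith [abs_nonneg (inner ℝ (M.feature g s - M.feature g s') ξ.snd), hφ s,
      norm_nonneg (M.feature g s)]
  have h6 : |cγ * ξ.fst| ≤ cγ * ‖ξ‖ := by
    rw [abs_mul, abs_of_nonneg (by linarith : 0 ≤ cγ)]
    exact mul_le_mul_of_nonneg_left h1 (by linarith)
  have h7 := norm_add_le (ξ.fst • M.feature g s)
    (inner ℝ (M.feature g s - M.feature g s') ξ.snd • M.feature g s)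
  nlinarith [norm_nonneg ξ]

lemma norm_criticB_le (s : S) (a : A) :
    ‖criticB cγ (M.feature g) (M.signal g s a) s‖ ≤ 2 * cγ := by
  refine (norm_criticVec_le g _).trans ?_
  change |cγ * M.signal g s a| + ‖M.signal g s a • M.feature g s‖ ≤ _
  have h1 := abs_signal_le M g s a
  rw [abs_mul, abs_of_nonneg (by linarith : 0 ≤ cγ), norm_smul, Real.norm_eq_abs]
  nlinarith [abs_nonneg (M.signal g s a), hφ s, norm_nonneg (M.feature g s)]

omit hφ hc

lemma fst_statMean (u : Transition S A → CriticVec (EuclideanSpace ℝ (Fin (m g)))) :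
    (statMean M.toCMDP (M.policy θ) u).fst = statMean M.toCMDP (M.policy θ) fun z => (u z).fst :=
  (statMean_clm _ _ (WithLp.fstL 2 ℝ ℝ _) u).symm

lemma snd_statMean (u : Transition S A → CriticVec (EuclideanSpace ℝ (Fin (m g)))) :
    (statMean M.toCMDP (M.policy θ) u).snd = statMean M.toCMDP (M.policy θ) fun z => (u z).snd :=
  (statMean_clm _ _ (WithLp.sndL 2 ℝ ℝ _) u).symm

/-- The stationary mean of the features. -/
noncomputable def meanFeature : EuclideanSpace ℝ (Fin (m g)) :=
  statMean M.toCMDP (M.policy θ) fun z => M.feature g z.1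

lemma meanA_fst (ξ : CriticVec (EuclideanSpace ℝ (Fin (m g)))) :
    (M.meanA cγ g θ ξ).fst = cγ * ξ.fst := by
  rw [meanA_apply, fst_statMean]
  exact ev_const _ (cγ * ξ.fst)

lemma meanA_snd (ξ : CriticVec (EuclideanSpace ℝ (Fin (m g)))) :
    (M.meanA cγ g θ ξ).snd = ξ.fst • meanFeature M g θ + M.featureMatrix g θ ξ.snd := by
  rw [meanA_apply, snd_statMean, featureMatrix_apply, meanFeature, ← statMean_smul,
    ← statMean_add]
  rfl

variable {lam : ℝ} (hlam0 : 0 < lam) (hlam1 : lam ≤ 1)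
  (hlow : ∀ x ∈ (LinearMap.ker (M.featureMatrix g θ))ᗮ,
    lam * ‖x‖ ^ 2 ≤ inner ℝ x (M.featureMatrix g θ x))
  (hcγ : lam / 2 + 1 / (2 * lam) ≤ cγ)

include hφ hlam0 hlow hcγ in
/-- Coercivity of the stationary critic matrix on the range of `Π`: the condition on `cγ`
absorbs the coupling between the two components. -/
lemma inner_meanA_ge {e : CriticVec (EuclideanSpace ℝ (Fin (m g)))} (he : projL M g θ e = e) :
    lam / 2 * ‖e‖ ^ 2 ≤ inner ℝ e (M.meanA cγ g θ e) := by
  have h := (projL_eq_self_iff M g θ).1 he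
  have h1 := hlow _ h
  rw [WithLp.prod_inner_apply, WithLp.prod_norm_sq_eq_of_L2]
  change _ ≤ inner ℝ e.fst (M.meanA cγ g θ e).fst + inner ℝ e.snd (M.meanA cγ g θ e).snd
  rw [meanA_fst, meanA_snd, inner_add_right, inner_smul_right]
  have hin : inner ℝ e.fst (cγ * e.fst) = cγ * e.fst ^ 2 := by
    rw [real_inner_eq_re_inner]
    simp [mul_comm, pow_two, mul_left_comm]
  rw [hin, Real.norm_eq_abs, sq_abs]
  have hφm : ‖meanFeature M g θ‖ ≤ 1 := norm_statMean_le _ _ fun z => hφ _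
  have h2 : |inner ℝ e.snd (meanFeature M g θ)| ≤ ‖e.snd‖ := by
    refine (abs_real_inner_le_norm _ _).trans ?_
    nlinarith [norm_nonneg e.snd]
  have h3 : -(|e.fst| * ‖e.snd‖) ≤ e.fst * inner ℝ e.snd (meanFeature M g θ) := by
    refine le_trans (neg_le_neg ?_) (neg_abs_le _)
    rw [abs_mul]
    exact mul_le_mul_of_nonneg_left h2 (abs_nonneg _)
  set x := |e.fst|
  set y := ‖e.snd‖
  have hx : e.fst ^ 2 = x ^ 2 := (sq_abs _).symm
  rw [hx]
  -- Young's inequality with the weight that leaves `lam / 2` for the second component.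
  have h4 : x * y ≤ 1 / (2 * lam) * x ^ 2 + lam / 2 * y ^ 2 := by
    have : 1 / (2 * lam) * x ^ 2 + lam / 2 * y ^ 2 - x * y = 1 / (2 * lam) * (x - lam * y) ^ 2 := by
      field_simp
      ring
    have : 0 ≤ 1 / (2 * lam) * (x - lam * y) ^ 2 := by positivity
    linarith
  have h5 : (lam / 2 + 1 / (2 * lam)) * x ^ 2 ≤ cγ * x ^ 2 :=
    mul_le_mul_of_nonneg_right hcγ (sq_nonneg _)
  linarith

omit hlam0 hlam1 hlow hcγ in
/-- The stationary critic equation is solvable: the centred right-hand side is orthogonal to the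
kernel of the feature matrix. -/
lemma meanB_mem_range (hU : M.IsUnichain (M.policy θ)) :
    M.meanB cγ g θ ∈ LinearMap.range (M.meanA cγ g θ) := by
  set J : ℝ := statMean M.toCMDP (M.policy θ) fun z => M.signal g z.1 z.2.1 with hJ
  have hfst : (M.meanB cγ g θ).fst = cγ * J := by
    rw [meanB_eq, fst_statMean]
    exact statMean_smul _ _ cγ fun z => M.signal g z.1 z.2.1
  have hsnd : (M.meanB cγ g θ).snd
      = statMean M.toCMDP (M.policy θ) fun z => M.signal g z.1 z.2.1 • M.feature g z.1 := by
    rw [meanB_eq, snd_statMean]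
    rfl
  have hw : (M.meanB cγ g θ).snd - J • meanFeature M g θ
      ∈ LinearMap.range (M.featureMatrix g θ) := by
    rw [range_featureMatrix M g θ hU, Submodule.mem_orthogonal]
    intro x hx
    obtain ⟨κ, hκ⟩ := exists_inner_feature_eq M g θ hU hx
    have h1 : inner ℝ x (M.meanB cγ g θ).snd = κ * J := by
      rw [hsnd, ← statMean_inner, hJ]
      refine Eq.trans (ev_congr fun z hz => ?_)
        (statMean_smul _ _ κ fun z => M.signal g z.1 z.2.1)
      rw [inner_smul_right, hκ _ (recurrent_of_mem_stat _ _ hz), smul_eq_mul, mul_comm]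
    have h2 : inner ℝ x (meanFeature M g θ) = κ := by
      rw [meanFeature, ← statMean_inner]
      refine Eq.trans (ev_congr fun z hz => ?_) (ev_const _ κ)
      rw [hκ _ (recurrent_of_mem_stat _ _ hz)]
    rw [inner_sub_right, inner_smul_right, h1, h2]
    ring
  obtain ⟨ζ, hζ⟩ := hw
  refine ⟨WithLp.toLp 2 (J, ζ), ?_⟩
  apply (WithLp.ofLp_injective 2)
  ext1
  · exact (meanA_fst M g θ cγ _).trans hfst.symm
  · refine (meanA_snd M g θ cγ _).trans ?_
    change J • meanFeature M g θ + M.featureMatrix g θ ζ = (M.meanB cγ g θ).snd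
    rw [hζ]
    abel

lemma meanA_criticTarget (hU : M.IsUnichain (M.policy θ)) :
    M.meanA cγ g θ (M.criticTarget cγ g θ) = M.meanB cγ g θ :=
  apply_pinv (meanB_mem_range M g θ cγ hU)

lemma projL_criticTarget : projL M g θ (M.criticTarget cγ g θ) = M.criticTarget cγ g θ := by
  rw [projL_eq_self_iff, Submodule.mem_orthogonal]
  intro x hx
  have h1 : (WithLp.toLp 2 ((0 : ℝ), x) : CriticVec (EuclideanSpace ℝ (Fin (m g))))
      ∈ LinearMap.ker (M.meanA cγ g θ) := by
    rw [LinearMap.mem_ker]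
    apply (WithLp.ofLp_injective 2)
    ext1
    · exact (meanA_fst M g θ cγ _).trans (mul_zero _)
    · refine (meanA_snd M g θ cγ _).trans ?_
      change (0 : ℝ) • meanFeature M g θ + M.featureMatrix g θ x = 0
      rw [zero_smul, zero_add, LinearMap.mem_ker.1 hx]
  have h2 := Submodule.inner_right_of_mem_orthogonal h1 (pinv_mem _ (M.meanB cγ g θ))
  rw [WithLp.prod_inner_apply] at h2
  change inner ℝ (0 : ℝ) _ + inner ℝ x (M.criticTarget cγ g θ).snd = 0 at h2
  rwa [inner_zero_left, zero_add] at h2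

include hφ hc hlam0 hlam1 hlow in
lemma norm_criticTarget_le (hU : M.IsUnichain (M.policy θ)) :
    ‖M.criticTarget cγ g θ‖ ≤ 3 / lam := by
  set ξ := M.criticTarget cγ g θ with hξ
  have hA := meanA_criticTarget M g θ cγ hU
  rw [← hξ] at hA
  have hmem := (projL_eq_self_iff M g θ).1 (projL_criticTarget M g θ cγ)
  rw [← hξ] at hmem
  have hfst : |ξ.fst| ≤ 1 := by
    have h1 : cγ * ξ.fst
        = cγ * statMean M.toCMDP (M.policy θ) fun z => M.signal g z.1 z.2.1 := by
      rw [← meanA_fst M g θ, hA, meanB_eq, fst_statMean]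
      exact statMean_smul _ _ cγ fun z => M.signal g z.1 z.2.1
    rw [mul_left_cancel₀ (by linarith : cγ ≠ 0) h1]
    rw [← Real.norm_eq_abs]
    refine norm_statMean_le _ _ fun z => ?_
    rw [Real.norm_eq_abs]
    exact abs_signal_le M g z.1 z.2.1
  have hN : M.featureMatrix g θ ξ.snd = (M.meanB cγ g θ).snd - ξ.fst • meanFeature M g θ := by
    rw [← hA, meanA_snd]
    abel
  have hNn : ‖M.featureMatrix g θ ξ.snd‖ ≤ 2 := by
    rw [hN]
    have h1 : ‖(M.meanB cγ g θ).snd‖ ≤ 1 := by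
      rw [meanB_eq, snd_statMean]
      refine norm_statMean_le _ _ fun z => ?_
      change ‖M.signal g z.1 z.2.1 • M.feature g z.1‖ ≤ 1
      rw [norm_smul, Real.norm_eq_abs]
      exact mul_le_one₀ (abs_signal_le M g _ _) (norm_nonneg _) (hφ _)
    have h2 : ‖ξ.fst • meanFeature M g θ‖ ≤ 1 := by
      rw [norm_smul, Real.norm_eq_abs]
      exact mul_le_one₀ hfst (norm_nonneg _) (norm_statMean_le _ _ fun z => hφ _)
    linarith [norm_sub_le (M.meanB cγ g θ).snd (ξ.fst • meanFeature M g θ)]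
  have h1 := hlow _ hmem
  have h2 := real_inner_le_norm ξ.snd (M.featureMatrix g θ ξ.snd)
  have h3 : ‖ξ.snd‖ ≤ 2 / lam := by
    rw [le_div_iff₀ hlam0]
    by_cases h0 : ‖ξ.snd‖ = 0
    · rw [h0]; norm_num
    · have hpos : 0 < ‖ξ.snd‖ := lt_of_le_of_ne (norm_nonneg _) (Ne.symm h0)
      have : ‖ξ.snd‖ * (‖ξ.snd‖ * lam) ≤ ‖ξ.snd‖ * 2 := by nlinarith
      exact le_of_mul_le_mul_left this hpos
  have h4 : 1 ≤ 1 / lam := by rw [le_div_iff₀ hlam0]; linarith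
  have h5 : 3 / lam = 1 / lam + 2 / lam := by ring
  linarith [norm_criticVec_le g ξ]

omit hlow hcγ in
include hlam0 hlam1 in
/-- The condition on `cγ` in the form in which the coercivity estimate uses it. -/
lemma half_add_le_of_sqrt_le (h : lam + √(1 / lam ^ 2 - 1) ≤ cγ) :
    lam / 2 + 1 / (2 * lam) ≤ cγ := by
  refine le_trans ?_ h
  have h1 : (1 - lam ^ 2) / (2 * lam) ≤ √(1 / lam ^ 2 - 1) := by
    refine Real.le_sqrt_of_sq_le ?_
    have h2 : 1 / lam ^ 2 - 1 = (1 - lam ^ 2) / lam ^ 2 := by field_simp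
    rw [h2, div_pow, mul_pow, div_le_div_iff₀ (by positivity) (by positivity)]
    have h3 : 0 ≤ 1 - lam ^ 2 := by nlinarith
    have h4 : (1 - lam ^ 2) * (1 - lam ^ 2) ≤ (1 - lam ^ 2) * 4 :=
      mul_le_mul_of_nonneg_left (by nlinarith) h3
    nlinarith [sq_nonneg lam]
  have h5 : (1 - lam ^ 2) / (2 * lam) = 1 / (2 * lam) - lam / 2 := by
    field_simp
  linarith

include hlam0 hcγ in
lemma one_le_of_half_add_le : 1 ≤ cγ := by
  refine le_trans ?_ hcγ
  have : lam / 2 + 1 / (2 * lam) - 1 = (lam - 1) ^ 2 / (2 * lam) := by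
    field_simp
    ring
  have : 0 ≤ (lam - 1) ^ 2 / (2 * lam) := by positivity
  linarith

end CriticBounds

/-! ### Consecutive batches -/

section Batches

variable {S A : Type*} (M : CMDP S A) (π : S → PMF A)

/-- The law of consecutive batches, built from the front in its definition, can also be built by
appending the last batch. -/
lemma batchesLaw_succ_last (Tmax n : ℕ) (s : S) :
    batchesLaw M π Tmax (n + 1) s = (batchesLaw M π Tmax n s).bind fun l =>
      (batchLaw M π Tmax (endStateB s l)).map fun b => l ++ [b] := by
  induction n generalizing s with
  | zero =>
    simp only [batchesLaw, PMF.pure_bind, PMF.pure_map, List.nil_append]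
    rfl
  | succ n ih =>
    rw [batchesLaw]
    conv_rhs => rw [batchesLaw]
    rw [PMF.bind_bind]
    congr 1
    funext b
    rw [ih, PMF.map_bind, PMF.bind_map]
    congr 1
    funext l
    rw [PMF.map_comp]
    rfl

lemma length_of_mem_batchesLaw {Tmax n : ℕ} {s : S} {l : List (Batch S A)}
    (h : l ∈ (batchesLaw M π Tmax n s).support) : l.length = n := by
  induction n generalizing s l with
  | zero => simpa [batchesLaw] using h
  | succ n ih =>
    rw [batchesLaw] at h
    simp only [PMF.mem_support_bind_iff, PMF.mem_support_map_iff] at h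
    obtain ⟨b, -, l', hl', rfl⟩ := h
    rw [List.length_cons, ih hl']

lemma recurrent_of_mem_batchesLaw {Tmax n : ℕ} {s : S} {l : List (Batch S A)}
    (hs : s ∈ M.recurrentStates π) (h : l ∈ (batchesLaw M π Tmax n s).support) :
    endStateB s l ∈ M.recurrentStates π := by
  induction n generalizing s l with
  | zero =>
    obtain rfl : l = [] := by simpa [batchesLaw] using h
    exact hs
  | succ n ih =>
    rw [batchesLaw] at h
    simp only [PMF.mem_support_bind_iff, PMF.mem_support_map_iff] at h
    obtain ⟨b, hb, l', hl', rfl⟩ := h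
    exact ih (s := endState s b.path) (recurrent_of_mem_batchLaw M π hs hb).1 hl'

/-- Iterating an update of affine growth over boundedly many batches gives bounded results. -/
lemma exists_norm_foldl_le {α V : Type*} [NormedAddCommGroup V] {f : V → α → V} {c₁ c₂ : ℝ}
    (hc₁ : 0 ≤ c₁) (hf : ∀ ξ b, ‖f ξ b‖ ≤ c₁ * ‖ξ‖ + c₂) (n : ℕ) (B₀ : ℝ) :
    ∃ B, ∀ ξ, ‖ξ‖ ≤ B₀ → ∀ l : List α, l.length = n → ‖l.foldl f ξ‖ ≤ B := by
  induction n generalizing B₀ with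
  | zero =>
    refine ⟨B₀, fun ξ hξ l hl => ?_⟩
    rw [List.length_eq_zero_iff.1 hl]
    exact hξ
  | succ n ih =>
    obtain ⟨B, hB⟩ := ih (c₁ * B₀ + c₂)
    refine ⟨B, fun ξ hξ l hl => ?_⟩
    obtain ⟨b, l', rfl⟩ := List.exists_cons_of_length_eq_add_one hl
    rw [List.foldl_cons]
    refine hB _ ((hf ξ b).trans ?_) _ (by simpa using hl)
    have := mul_le_mul_of_nonneg_left hξ hc₁
    linarith

end Batches

/-! ### The critic recursion -/

section Recursion

variable {S A : Type*} [Fintype S] [Fintype A] {d : ℕ} {m : Signal → ℕ}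

/-- The hypotheses under which the critic recursion for the signal `g` at the parameter `θ` is
analysed: coercivity constant `lam`, target time at most `C`, and a step size and a maximal
trajectory length tuned to them. The constants `3000000` and `2000` are large enough for the
second moment and the bias of a batch to use up at most half of the contraction `γ λ ‖e‖²`. -/
structure CriticRegime (M : Model S A d m) (p : Params d) (g : Signal)
    (θ : EuclideanSpace ℝ (Fin d)) (lam C : ℝ) : Prop where
  unichain : M.IsUnichain (M.policy θ)
  feature_le : ∀ s, ‖M.feature g s‖ ≤ 1
  lam_pos : 0 < lam
  lam_le_one : lam ≤ 1
  lower : ∀ x ∈ (LinearMap.ker (M.featureMatrix g θ))ᗮ,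
    lam * ‖x‖ ^ 2 ≤ inner ℝ x (M.featureMatrix g θ x)
  half_le : 1 / 2 ≤ C
  target_le : M.targetTime (M.policy θ) ≤ ENNReal.ofReal C
  cγ_ge : lam / 2 + 1 / (2 * lam) ≤ p.cγ
  two_le : 2 ≤ p.Tmax
  step_nonneg : 0 ≤ p.γξ
  step_le : 3000000 * (p.γξ * (p.cγ ^ 2 * C ^ 2 * Real.log p.Tmax)) ≤ lam
  Tmax_ge : 2000 * (p.cγ ^ 2 * C ^ 2) ≤ lam * p.Tmax

/-- One critic update. -/
noncomputable def criticStep (M : Model S A d m) (p : Params d) (g : Signal)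
    (ξ : CriticVec (EuclideanSpace ℝ (Fin (m g)))) (b : Batch S A) :
    CriticVec (EuclideanSpace ℝ (Fin (m g))) :=
  ξ - p.γξ • mlmc p.Tmax (fun z =>
    criticA p.cγ (M.feature g) z.1 z.2.2 ξ
      - criticB p.cγ (M.feature g) (M.signal g z.1 z.2.1) z.1) b

lemma criticOut_eq (M : Model S A d m) (p : Params d) (g : Signal) (l : List (Batch S A)) :
    M.criticOut p g l = l.foldl (criticStep M p g) 0 := rfl

lemma criticOut_append (M : Model S A d m) (p : Params d) (g : Signal) (l : List (Batch S A))
    (b : Batch S A) : M.criticOut p g (l ++ [b]) = criticStep M p g (M.criticOut p g l) b := by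
  simp [criticOut_eq, List.foldl_append]

/-- The projected critic error `Π(ξ - ξ*)`. -/
noncomputable def criticErr (M : Model S A d m) (p : Params d) (g : Signal)
    (θ : EuclideanSpace ℝ (Fin d)) (ξ : CriticVec (EuclideanSpace ℝ (Fin (m g)))) :
    CriticVec (EuclideanSpace ℝ (Fin (m g))) :=
  projL M g θ (ξ - M.criticTarget p.cγ g θ)

lemma projL_criticErr (M : Model S A d m) (p : Params d) (g : Signal)
    (θ : EuclideanSpace ℝ (Fin d)) (ξ : CriticVec (EuclideanSpace ℝ (Fin (m g)))) :
    projL M g θ (criticErr M p g θ ξ) = criticErr M p g θ ξ :=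
  projL_projL M g θ _

/-- The critic increment written in terms of the projected error. -/
noncomputable def errIncrement (M : Model S A d m) (p : Params d) (g : Signal)
    (θ : EuclideanSpace ℝ (Fin d)) (e : CriticVec (EuclideanSpace ℝ (Fin (m g))))
    (z : Transition S A) : CriticVec (EuclideanSpace ℝ (Fin (m g))) :=
  criticA p.cγ (M.feature g) z.1 z.2.2 (e + M.criticTarget p.cγ g θ)
    - criticB p.cγ (M.feature g) (M.signal g z.1 z.2.1) z.1

/-- The stationary critic matrix as a continuous linear map. -/
noncomputable def meanAL (M : Model S A d m) (p : Params d) (g : Signal)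
    (θ : EuclideanSpace ℝ (Fin d)) : CriticVec (EuclideanSpace ℝ (Fin (m g))) →L[ℝ]
      CriticVec (EuclideanSpace ℝ (Fin (m g))) :=
  LinearMap.toContinuousLinearMap (M.meanA p.cγ g θ)

namespace CriticRegime

variable {M : Model S A d m} {p : Params d} {g : Signal}
    {θ : EuclideanSpace ℝ (Fin d)} {lam C : ℝ} (hR : CriticRegime M p g θ lam C)
include hR

lemma one_le_cγ : 1 ≤ p.cγ := one_le_of_half_add_le p.cγ hR.lam_pos hR.cγ_ge

lemma log_ge : 0.69 ≤ Real.log p.Tmax := by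
  have h1 : Real.log 2 ≤ Real.log p.Tmax :=
    Real.log_le_log (by norm_num) (by exact_mod_cast hR.two_le)
  have := Real.log_two_gt_d9
  norm_num at this ⊢
  linarith

lemma Tmax_pos : (0 : ℝ) < p.Tmax := by
  have := hR.two_le
  exact_mod_cast (by omega : 0 < p.Tmax)

lemma ratio_le : p.cγ * C / p.Tmax ≤ lam / 1000 := by
  have h1 := hR.one_le_cγ
  have h2 := hR.half_le
  rw [div_le_iff₀ hR.Tmax_pos]
  have h3 : 1 / 2 ≤ p.cγ * C := by nlinarith
  have h4 : 2000 * (p.cγ * C) ^ 2 ≤ lam * p.Tmax := by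
    have := hR.Tmax_ge
    rwa [mul_pow]
  nlinarith

lemma step_cγ_le : p.γξ * p.cγ ^ 2 ≤ lam / 500000 := by
  have h2 := hR.half_le
  have h3 := hR.log_ge
  have h4 := hR.step_le
  have h5 : 0 ≤ p.γξ * p.cγ ^ 2 := mul_nonneg hR.step_nonneg (sq_nonneg _)
  have h6 : 0.17 ≤ C ^ 2 * Real.log p.Tmax := by
    have : 1 / 4 ≤ C ^ 2 := by nlinarith
    nlinarith
  have h7 : (p.γξ * p.cγ ^ 2) * 0.17 ≤ (p.γξ * p.cγ ^ 2) * (C ^ 2 * Real.log p.Tmax) :=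
    mul_le_mul_of_nonneg_left h6 h5
  nlinarith

lemma step_le_lam : p.γξ ≤ lam / 500000 := by
  refine le_trans ?_ hR.step_cγ_le
  refine le_mul_of_one_le_right hR.step_nonneg ?_
  nlinarith [hR.one_le_cγ]

lemma norm_criticStep_le (ξ : CriticVec (EuclideanSpace ℝ (Fin (m g)))) (b : Batch S A) :
    ‖criticStep M p g ξ b‖ ≤ (1 + p.γξ * ((1 + 2 * p.Tmax) * (4 * p.cγ))) * ‖ξ‖
      + p.γξ * ((1 + 2 * p.Tmax) * (2 * p.cγ)) := by
  have hc := hR.one_le_cγ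
  have h1 : ∀ z : Transition S A, ‖criticA p.cγ (M.feature g) z.1 z.2.2 ξ
      - criticB p.cγ (M.feature g) (M.signal g z.1 z.2.1) z.1‖ ≤ 4 * p.cγ * ‖ξ‖ + 2 * p.cγ :=
    fun z => (norm_sub_le _ _).trans (add_le_add
      (norm_criticA_le M g p.cγ hR.feature_le hc _ _ _)
      (norm_criticB_le M g p.cγ hR.feature_le hc _ _))
  have h2 := norm_mlmc_le (by positivity) h1 p.Tmax b
  unfold criticStep
  refine (norm_sub_le _ _).trans ?_
  rw [norm_smul, Real.norm_of_nonneg hR.step_nonneg]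
  have := mul_le_mul_of_nonneg_left h2 hR.step_nonneg
  linarith

lemma exists_norm_criticOut_le (n : ℕ) :
    ∃ B, ∀ l : List (Batch S A), l.length = n → ‖M.criticOut p g l‖ ≤ B := by
  have hc := hR.one_le_cγ
  have h0 := hR.step_nonneg
  obtain ⟨B, hB⟩ := exists_norm_foldl_le (f := criticStep M p g) (by positivity)
    hR.norm_criticStep_le n 0
  exact ⟨B, fun l hl => hB 0 (by simp) l hl⟩

lemma bddOn_criticOut (n : ℕ) (x : S) :
    BddOn (batchesLaw M.toCMDP (M.policy θ) p.Tmax n x) (M.criticOut p g) := by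
  obtain ⟨B, hB⟩ := hR.exists_norm_criticOut_le n
  exact ⟨B, fun l hl => hB l (length_of_mem_batchesLaw _ _ hl)⟩

lemma bddOn_criticErr (n : ℕ) (x : S) :
    BddOn (batchesLaw M.toCMDP (M.policy θ) p.Tmax n x)
      fun l => criticErr M p g θ (M.criticOut p g l) :=
  ((hR.bddOn_criticOut n x).sub (BddOn.const _ _)).clm _

lemma norm_errIncrement_le (e : CriticVec (EuclideanSpace ℝ (Fin (m g)))) (z : Transition S A) :
    ‖errIncrement M p g θ e z‖ ≤ 14 * p.cγ * (‖e‖ + 1 / lam) := by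
  have hc := hR.one_le_cγ
  have h1 := norm_criticA_le M g p.cγ hR.feature_le hc z.1 z.2.2 (e + M.criticTarget p.cγ g θ)
  have h2 := norm_criticB_le M g p.cγ hR.feature_le hc z.1 z.2.1
  have h3 := norm_criticTarget_le M g θ p.cγ hR.feature_le hc hR.lam_pos hR.lam_le_one hR.lower
    hR.unichain
  have h4 := norm_add_le e (M.criticTarget p.cγ g θ)
  have h5 : 1 ≤ 1 / lam := by rw [le_div_iff₀ hR.lam_pos]; linarith [hR.lam_le_one]
  have h6 : 3 / lam = 3 * (1 / lam) := by ring
  unfold errIncrement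
  refine (norm_sub_le _ _).trans ?_
  rw [h6] at h3
  have h7 : 4 * p.cγ * ‖e + M.criticTarget p.cγ g θ‖ ≤ 4 * p.cγ * (‖e‖ + 3 * (1 / lam)) :=
    mul_le_mul_of_nonneg_left (by linarith) (by linarith)
  nlinarith [norm_nonneg e]

lemma statMean_errIncrement (e : CriticVec (EuclideanSpace ℝ (Fin (m g)))) :
    statMean M.toCMDP (M.policy θ) (errIncrement M p g θ e) = M.meanA p.cγ g θ e := by
  unfold errIncrement
  rw [statMean_sub, ← meanA_apply, ← meanB_eq, map_add,
    meanA_criticTarget M g θ p.cγ hR.unichain, add_sub_cancel_right]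

/-- One critic update in terms of the projected error: trajectories from the recurrent class do not
see the component of `ξ` that `Π` removes. -/
lemma criticErr_step (ξ : CriticVec (EuclideanSpace ℝ (Fin (m g)))) {x : S}
    (hx : x ∈ M.recurrentStates (M.policy θ)) {b : Batch S A}
    (hb : b ∈ (batchLaw M.toCMDP (M.policy θ) p.Tmax x).support) :
    criticErr M p g θ (criticStep M p g ξ b) = criticErr M p g θ ξ
      + (-p.γξ) • projL M g θ (mlmc p.Tmax (errIncrement M p g θ (criticErr M p g θ ξ)) b) := by
  have h1 : criticErr M p g θ ξ + M.criticTarget p.cγ g θ = M.proj g θ ξ := by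
    unfold criticErr
    rw [map_sub, projL_criticTarget, sub_add_cancel, projL_apply]
  have h2 : mlmc p.Tmax (errIncrement M p g θ (criticErr M p g θ ξ)) b
      = mlmc p.Tmax (fun z => criticA p.cγ (M.feature g) z.1 z.2.2 ξ
      - criticB p.cγ (M.feature g) (M.signal g z.1 z.2.1) z.1) b := by
    refine mlmc_congr fun z hz => ?_
    obtain ⟨hz1, hz2⟩ := (recurrent_of_mem_batchLaw _ _ hx hb).2 z hz
    unfold errIncrement
    rw [h1, criticA_proj M g θ p.cγ hR.unichain ξ hz1 hz2]
  rw [h2]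
  unfold criticErr criticStep
  rw [sub_right_comm, map_sub, map_smul, neg_smul, ← sub_eq_add_neg]

lemma bddOn_mlmc (e : CriticVec (EuclideanSpace ℝ (Fin (m g)))) (q : PMF (Batch S A)) :
    BddOn q (mlmc p.Tmax (errIncrement M p g θ e)) := by
  have := hR.one_le_cγ
  have := hR.lam_pos
  exact ⟨_, fun b _ => norm_mlmc_le (by positivity) (hR.norm_errIncrement_le e) p.Tmax b⟩

/-- The bias of one batch. -/
lemma norm_ev_mlmc_err_le (e : CriticVec (EuclideanSpace ℝ (Fin (m g)))) {x : S}
    (hx : x ∈ M.recurrentStates (M.policy θ)) :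
    ‖ev (batchLaw M.toCMDP (M.policy θ) p.Tmax x) (mlmc p.Tmax (errIncrement M p g θ e))
      - M.meanA p.cγ g θ e‖ ≤ 56 * (p.cγ * C / p.Tmax) * (‖e‖ + 1 / lam) := by
  have := hR.one_le_cγ
  have := hR.lam_pos
  have h := norm_ev_mlmc_sub_le M.toCMDP (M.policy θ) hR.unichain hR.half_le hR.target_le
    (by positivity) (hR.norm_errIncrement_le e) hR.two_le hx
  rw [hR.statMean_errIncrement] at h
  refine h.trans (le_of_eq ?_)
  ring

lemma ev_mlmc_err_sq_le (e : CriticVec (EuclideanSpace ℝ (Fin (m g)))) {x : S}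
    (hx : x ∈ M.recurrentStates (M.policy θ)) :
    ev (batchLaw M.toCMDP (M.policy θ) p.Tmax x)
      (fun b => ‖mlmc p.Tmax (errIncrement M p g θ e) b‖ ^ 2)
      ≤ 588000 * (p.cγ ^ 2 * C ^ 2 * Real.log p.Tmax) * (‖e‖ ^ 2 + 1 / lam ^ 2) := by
  have := hR.one_le_cγ
  have := hR.lam_pos
  have hl := hR.log_ge
  have h := ev_mlmc_sq_le M.toCMDP (M.policy θ) hR.unichain hR.half_le hR.target_le
    (by positivity) (hR.norm_errIncrement_le e) hR.two_le hx
  refine h.trans ?_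
  have h1 : (‖e‖ + 1 / lam) ^ 2 ≤ 2 * (‖e‖ ^ 2 + 1 / lam ^ 2) := by
    have h2 : 1 / lam ^ 2 = (1 / lam) ^ 2 := by rw [one_div_pow]
    rw [h2]
    nlinarith [sq_nonneg (‖e‖ - 1 / lam)]
  have h3 : 0 ≤ 294000 * (p.cγ ^ 2 * C ^ 2 * Real.log p.Tmax) := by
    have : 0 ≤ Real.log p.Tmax := by linarith
    positivity
  have h4 := mul_le_mul_of_nonneg_left h1 h3
  nlinarith

/-- The conditional second moment of the error contracts, up to the squared bias and the
variance of a batch. -/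
lemma ev_criticErr_step_sq_le (ξ : CriticVec (EuclideanSpace ℝ (Fin (m g)))) {x : S}
    (hx : x ∈ M.recurrentStates (M.policy θ)) :
    ev (batchLaw M.toCMDP (M.policy θ) p.Tmax x)
      (fun b => ‖criticErr M p g θ (criticStep M p g ξ b)‖ ^ 2)
      ≤ (1 - p.γξ * lam / 2) * ‖criticErr M p g θ ξ‖ ^ 2
        + p.γξ * (25088 * (p.cγ * C / p.Tmax) ^ 2 / lam ^ 3
          + 588000 * (p.γξ * (p.cγ ^ 2 * C ^ 2 * Real.log p.Tmax)) / lam ^ 2) := by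
  set e := criticErr M p g θ ξ with he
  set P := batchLaw M.toCMDP (M.policy θ) p.Tmax x
  set w := mlmc p.Tmax (errIncrement M p g θ e) with hw
  have hpe : projL M g θ e = e := projL_criticErr M p g θ ξ
  have hwb : BddOn P w := hR.bddOn_mlmc e P
  have hpw : BddOn P fun b => projL M g θ (w b) := hwb.clm _
  have hγ := hR.step_nonneg
  have hlam := hR.lam_pos
  have h1 : ev P (fun b => ‖criticErr M p g θ (criticStep M p g ξ b)‖ ^ 2)
      = ‖e‖ ^ 2 + 2 * inner ℝ e (ev P fun b => (-p.γξ) • projL M g θ (w b))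
        + ev P (fun b => ‖(-p.γξ) • projL M g θ (w b)‖ ^ 2) := by
    rw [← ev_norm_add_sq (hpw.const_smul _)]
    exact ev_congr fun b hb => by rw [hR.criticErr_step ξ hx hb]
  have h2 : ev P (fun b => ‖(-p.γξ) • projL M g θ (w b)‖ ^ 2)
      ≤ p.γξ ^ 2 * (588000 * (p.cγ ^ 2 * C ^ 2 * Real.log p.Tmax) * (‖e‖ ^ 2 + 1 / lam ^ 2)) := by
    have h3 : ev P (fun b => ‖(-p.γξ) • projL M g θ (w b)‖ ^ 2)
        ≤ ev P (fun b => p.γξ ^ 2 * ‖w b‖ ^ 2) := by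
      refine ev_mono (hpw.const_smul _).norm_sq (hwb.norm_sq.const_mul _) fun b _ => ?_
      rw [norm_smul, norm_neg, mul_pow, Real.norm_eq_abs, sq_abs]
      exact mul_le_mul_of_nonneg_left
        (pow_le_pow_left₀ (norm_nonneg _) (norm_projL_le M g θ _) 2) (sq_nonneg _)
    rw [ev_mul] at h3
    exact h3.trans (mul_le_mul_of_nonneg_left (hR.ev_mlmc_err_sq_le e hx) (sq_nonneg _))
  have h4 : inner ℝ e (ev P fun b => (-p.γξ) • projL M g θ (w b))
      = -p.γξ * inner ℝ e (ev P w) := by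
    rw [ev_smul, ev_clm hwb, inner_smul_right, inner_projL M g θ hpe]
  have h5 : lam / 2 * ‖e‖ ^ 2 - ‖e‖ * (56 * (p.cγ * C / p.Tmax) * (‖e‖ + 1 / lam))
      ≤ inner ℝ e (ev P w) := by
    have e1 := inner_meanA_ge M g θ p.cγ hR.feature_le hlam hR.lower hR.cγ_ge hpe
    have e2 := abs_real_inner_le_norm e (ev P w - M.meanA p.cγ g θ e)
    have e3 := mul_le_mul_of_nonneg_left (hR.norm_ev_mlmc_err_le e hx) (norm_nonneg e)
    have e4 := neg_abs_le (inner ℝ e (ev P w - M.meanA p.cγ g θ e))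
    rw [inner_sub_right] at e2 e4
    linarith
  rw [h1, h4]
  set X := p.cγ * C / p.Tmax
  set D := p.cγ ^ 2 * C ^ 2 * Real.log p.Tmax
  have hX : X ≤ lam / 1000 := hR.ratio_le
  have hD : 3000000 * (p.γξ * D) ≤ lam := hR.step_le
  set y := ‖e‖ with hy
  have hy0 : 0 ≤ y := norm_nonneg _
  -- The part of the bias proportional to `y` is small against `lam`; the constant part is
  -- absorbed by Young's inequality, at the price of the squared bias.
  have h6 : y * (56 * X * (y + 1 / lam)) ≤ lam / 8 * y ^ 2 + 12544 * X ^ 2 / lam ^ 3 := by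
    have e1 : 56 * X * y ^ 2 ≤ lam / 16 * y ^ 2 :=
      mul_le_mul_of_nonneg_right (by linarith) (sq_nonneg _)
    have e2 : lam / 16 * y ^ 2 + 12544 * X ^ 2 / lam ^ 3 - 56 * X * y / lam
        = lam / 16 * (y - 448 * X / lam ^ 2) ^ 2 := by
      field_simp
      ring
    have e3 : 0 ≤ lam / 16 * (y - 448 * X / lam ^ 2) ^ 2 := by positivity
    have e4 : y * (56 * X * (y + 1 / lam)) = 56 * X * y ^ 2 + 56 * X * y / lam := by
      field_simp
    linarith
  -- The second moment is multiplied by `γ²`, and the step-size condition turns one factor `γ`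
  -- into a small multiple of `lam`.
  have h7 : p.γξ ^ 2 * (588000 * D * (y ^ 2 + 1 / lam ^ 2))
      ≤ p.γξ * (lam / 4 * y ^ 2 + 588000 * (p.γξ * D) / lam ^ 2) := by
    have e1 : 588000 * (p.γξ * D) * y ^ 2 ≤ lam / 4 * y ^ 2 :=
      mul_le_mul_of_nonneg_right (by linarith) (sq_nonneg _)
    have e2 : p.γξ ^ 2 * (588000 * D * (y ^ 2 + 1 / lam ^ 2))
        = p.γξ * (588000 * (p.γξ * D) * y ^ 2 + 588000 * (p.γξ * D) / lam ^ 2) := by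
      field_simp
    rw [e2]
    exact mul_le_mul_of_nonneg_left (by linarith) hγ
  have h8 := mul_le_mul_of_nonneg_left (h5.trans' (sub_le_sub_left h6 _)) hγ
  have h9 : p.γξ * (25088 * X ^ 2 / lam ^ 3) = 2 * (p.γξ * (12544 * X ^ 2 / lam ^ 3)) := by ring
  nlinarith

/-- Second moment of the error after `n` critic steps. -/
lemma ev_criticErr_sq_le (n : ℕ) {x : S} (hx : x ∈ M.recurrentStates (M.policy θ)) :
    ev (batchesLaw M.toCMDP (M.policy θ) p.Tmax n x)
      (fun l => ‖criticErr M p g θ (M.criticOut p g l)‖ ^ 2)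
      ≤ (1 - p.γξ * lam / 2) ^ n * (9 / lam ^ 2)
        + (50176 * (p.cγ * C / p.Tmax) ^ 2 / lam ^ 4
          + 1176000 * (p.γξ * (p.cγ ^ 2 * C ^ 2 * Real.log p.Tmax)) / lam ^ 3) := by
  have hγ := hR.step_nonneg
  have hlam := hR.lam_pos
  have hγ1 := hR.step_le_lam
  have hlam1 := hR.lam_le_one
  have hl := hR.log_ge
  set X := p.cγ * C / p.Tmax
  set D := p.cγ ^ 2 * C ^ 2 * Real.log p.Tmax with hD
  have hD0 : 0 ≤ D := by
    have : 0 ≤ Real.log p.Tmax := by linarith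
    positivity
  induction n with
  | zero =>
    rw [batchesLaw, ev_pure, pow_zero, one_mul]
    have h1 : ‖criticErr M p g θ (M.criticOut p g [])‖ ≤ 3 / lam := by
      have h2 : criticErr M p g θ (M.criticOut p g []) = - M.criticTarget p.cγ g θ := by
        unfold criticErr
        rw [criticOut_eq, List.foldl_nil, zero_sub, map_neg, projL_criticTarget]
      rw [h2, norm_neg]
      exact norm_criticTarget_le M g θ p.cγ hR.feature_le hR.one_le_cγ hlam hlam1 hR.lower
        hR.unichain
    have h3 := pow_le_pow_left₀ (norm_nonneg _) h1 2
    rw [div_pow] at h3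
    have : 0 ≤ 50176 * X ^ 2 / lam ^ 4 + 1176000 * (p.γξ * D) / lam ^ 3 := by positivity
    norm_num at h3
    linarith
  | succ n ih =>
    have hb := (hR.bddOn_criticErr (n + 1) x).norm_sq
    rw [batchesLaw_succ_last] at hb ⊢
    rw [ev_bind hb]
    have h1 : ∀ l ∈ (batchesLaw M.toCMDP (M.policy θ) p.Tmax n x).support,
        ev ((batchLaw M.toCMDP (M.policy θ) p.Tmax (endStateB x l)).map fun b => l ++ [b])
          (fun l => ‖criticErr M p g θ (M.criticOut p g l)‖ ^ 2)
        ≤ (1 - p.γξ * lam / 2) * ‖criticErr M p g θ (M.criticOut p g l)‖ ^ 2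
        + p.γξ * (25088 * X ^ 2 / lam ^ 3 + 588000 * (p.γξ * D) / lam ^ 2) := by
      intro l hl
      rw [ev_map (hb.of_bind hl)]
      simp only [criticOut_append]
      exact hR.ev_criticErr_step_sq_le _ (recurrent_of_mem_batchesLaw _ _ hx hl)
    have hb' := (hR.bddOn_criticErr n x).norm_sq
    refine (ev_mono hb.ev_bind ((hb'.const_mul _).add (BddOn.const _ _)) h1).trans ?_
    rw [ev_add (hb'.const_mul _) (BddOn.const _ _), ev_mul, ev_const, pow_succ']
    have hρ : 0 ≤ 1 - p.γξ * lam / 2 := by nlinarith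
    have h2 := mul_le_mul_of_nonneg_left ih hρ
    refine (add_le_add_left h2 _).trans (le_of_eq ?_)
    field_simp
    ring

/-- A uniform bound on the mean error norm along the recursion. -/
lemma ev_norm_criticErr_le (n : ℕ) {x : S} (hx : x ∈ M.recurrentStates (M.policy θ)) :
    ev (batchesLaw M.toCMDP (M.policy θ) p.Tmax n x)
      (fun l => ‖criticErr M p g θ (M.criticOut p g l)‖) ≤ 6 / lam := by
  have hγ := hR.step_nonneg
  have hlam := hR.lam_pos
  have hγ1 := hR.step_le_lam
  have hlam1 := hR.lam_le_one
  have hsq := hR.ev_criticErr_sq_le n hx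
  have hX0 : 0 ≤ p.cγ * C / p.Tmax :=
    div_nonneg (mul_nonneg (by linarith [hR.one_le_cγ]) (by linarith [hR.half_le])) (by positivity)
  set X := p.cγ * C / p.Tmax
  set D := p.cγ ^ 2 * C ^ 2 * Real.log p.Tmax with hD
  have hX : X ≤ lam / 1000 := hR.ratio_le
  have hD : 3000000 * (p.γξ * D) ≤ lam := hR.step_le
  have hb := hR.bddOn_criticErr n x
  have h1 : ev (batchesLaw M.toCMDP (M.policy θ) p.Tmax n x)
      (fun l => ‖criticErr M p g θ (M.criticOut p g l)‖) ≤
      ev (batchesLaw M.toCMDP (M.policy θ) p.Tmax n x)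
      (fun l => 1 / (2 * lam) + lam / 2 * ‖criticErr M p g θ (M.criticOut p g l)‖ ^ 2) := by
    refine ev_mono hb.norm ((BddOn.const _ _).add (hb.norm_sq.const_mul _)) fun l _ => ?_
    set y := ‖criticErr M p g θ (M.criticOut p g l)‖
    have e1 : 1 / (2 * lam) + lam / 2 * y ^ 2 - y = lam / 2 * (y - 1 / lam) ^ 2 := by
      field_simp
      ring
    have e2 : 0 ≤ lam / 2 * (y - 1 / lam) ^ 2 := by positivity
    linarith
  rw [ev_add (BddOn.const _ _) (hb.norm_sq.const_mul _), ev_const, ev_mul] at h1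
  have h2 : (1 - p.γξ * lam / 2) ^ n ≤ 1 :=
    pow_le_one₀ (by nlinarith) (by nlinarith)
  have h3 : (1 - p.γξ * lam / 2) ^ n * (9 / lam ^ 2) ≤ 9 / lam ^ 2 :=
    mul_le_of_le_one_left (by positivity) h2
  have h4 : 50176 * X ^ 2 / lam ^ 4 ≤ 1 / lam ^ 2 := by
    rw [div_le_div_iff₀ (by positivity) (by positivity)]
    have : X ^ 2 ≤ (lam / 1000) ^ 2 := pow_le_pow_left₀ hX0 hX 2
    have : 0 ≤ lam ^ 2 := by positivity
    nlinarith
  have h5 : 1176000 * (p.γξ * D) / lam ^ 3 ≤ 1 / lam ^ 2 := by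
    rw [div_le_div_iff₀ (by positivity) (by positivity)]
    have : 0 ≤ lam ^ 2 := by positivity
    nlinarith
  have h6 : 9 / lam ^ 2 = 9 * (1 / lam ^ 2) := by ring
  have h7 := hsq.trans (b := _) (c := 11 * (1 / lam ^ 2)) (by linarith)
  have h8 := mul_le_mul_of_nonneg_left h7 (by positivity : 0 ≤ lam / 2)
  refine h1.trans ((add_le_add_right h8 _).trans (le_of_eq ?_))
  field_simp
  norm_num

/-- The mean update is a contraction on the range of `Π`. -/
lemma norm_sub_smul_meanA_le {e : CriticVec (EuclideanSpace ℝ (Fin (m g)))}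
    (he : projL M g θ e = e) :
    ‖e - p.γξ • projL M g θ (M.meanA p.cγ g θ e)‖ ≤ (1 - p.γξ * lam / 4) * ‖e‖ := by
  have hγ := hR.step_nonneg
  have hlam := hR.lam_pos
  have hγ1 := hR.step_le_lam
  have hlam1 := hR.lam_le_one
  have hc := hR.one_le_cγ
  have hγc := hR.step_cγ_le
  have hρ : 0 ≤ 1 - p.γξ * lam / 4 := by nlinarith
  rw [← sq_le_sq₀ (norm_nonneg _) (by positivity), norm_sub_sq_real, inner_smul_right,
    inner_projL M g θ he, norm_smul, mul_pow, Real.norm_of_nonneg hγ]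
  have h1 := inner_meanA_ge M g θ p.cγ hR.feature_le hlam hR.lower hR.cγ_ge he
  have h2 : ‖projL M g θ (M.meanA p.cγ g θ e)‖ ≤ 4 * p.cγ * ‖e‖ := by
    refine (norm_projL_le M g θ _).trans ?_
    rw [meanA_apply]
    exact norm_statMean_le _ _ fun z => norm_criticA_le M g p.cγ hR.feature_le hc _ _ _
  have h3 := pow_le_pow_left₀ (norm_nonneg _) h2 2
  have h4 := mul_le_mul_of_nonneg_left h3 (sq_nonneg p.γξ)
  have h5 := mul_le_mul_of_nonneg_left h1 hγ
  have h6 : p.γξ * (16 * (p.γξ * p.cγ ^ 2)) * ‖e‖ ^ 2 ≤ p.γξ * (lam / 2) * ‖e‖ ^ 2 :=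
    mul_le_mul_of_nonneg_right (mul_le_mul_of_nonneg_left (by linarith) hγ) (sq_nonneg _)
  have h7 : 0 ≤ (p.γξ * lam / 4) ^ 2 * ‖e‖ ^ 2 := by positivity
  nlinarith

/-- Mean error after `n` critic steps: only the bias of the batches accumulates. -/
lemma norm_ev_criticErr_le (n : ℕ) {x : S} (hx : x ∈ M.recurrentStates (M.policy θ)) :
    ‖ev (batchesLaw M.toCMDP (M.policy θ) p.Tmax n x)
      (fun l => criticErr M p g θ (M.criticOut p g l))‖
      ≤ (1 - p.γξ * lam / 4) ^ n * (3 / lam) + 1568 * (p.cγ * C / p.Tmax) / lam ^ 2 := by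
  have hγ := hR.step_nonneg
  have hlam := hR.lam_pos
  have hγ1 := hR.step_le_lam
  have hlam1 := hR.lam_le_one
  have hX0 : 0 ≤ p.cγ * C / p.Tmax :=
    div_nonneg (mul_nonneg (by linarith [hR.one_le_cγ]) (by linarith [hR.half_le])) (by positivity)
  set X := p.cγ * C / p.Tmax with hX
  induction n with
  | zero =>
    rw [batchesLaw, ev_pure, pow_zero, one_mul]
    have h2 : criticErr M p g θ (M.criticOut p g []) = - M.criticTarget p.cγ g θ := by
      unfold criticErr
      rw [criticOut_eq, List.foldl_nil, zero_sub, map_neg, projL_criticTarget]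
    rw [h2, norm_neg]
    have h3 := norm_criticTarget_le M g θ p.cγ hR.feature_le hR.one_le_cγ hlam hlam1 hR.lower
        hR.unichain
    have : 0 ≤ 1568 * X / lam ^ 2 := by positivity
    linarith
  | succ n ih =>
    set P := batchesLaw M.toCMDP (M.policy θ) p.Tmax n x with hP
    set err := fun l => criticErr M p g θ (M.criticOut p g l) with herr
    set B := ContinuousLinearMap.id ℝ _ - p.γξ • (projL M g θ ∘L meanAL M p g θ) with hB
    have hb := hR.bddOn_criticErr (n + 1) x
    have hb' : BddOn P err := hR.bddOn_criticErr n x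
    rw [batchesLaw_succ_last] at hb ⊢
    rw [ev_bind hb]
    have h1 : ∀ l ∈ P.support,
        ‖ev ((batchLaw M.toCMDP (M.policy θ) p.Tmax (endStateB x l)).map fun b => l ++ [b]) err
          - B (err l)‖ ≤ p.γξ * (56 * X * (‖err l‖ + 1 / lam)) := by
      intro l hl
      have hxl := recurrent_of_mem_batchesLaw _ _ hx hl
      rw [ev_map (hb.of_bind hl)]
      simp only [herr, criticOut_append]
      set e := criticErr M p g θ (M.criticOut p g l) with he
      have hwb := hR.bddOn_mlmc e (batchLaw M.toCMDP (M.policy θ) p.Tmax (endStateB x l))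
      have h2 : ev (batchLaw M.toCMDP (M.policy θ) p.Tmax (endStateB x l))
          (fun b => criticErr M p g θ (criticStep M p g (M.criticOut p g l) b))
          = e + (-p.γξ) • projL M g θ (ev (batchLaw M.toCMDP (M.policy θ) p.Tmax (endStateB x l))
            (mlmc p.Tmax (errIncrement M p g θ e))) := by
        rw [ev_congr fun b hb => hR.criticErr_step (M.criticOut p g l) hxl hb,
          ev_add (BddOn.const _ _) ((hwb.clm _).const_smul _), ev_const, ev_smul, ev_clm hwb]
      rw [h2]
      have h3 : e + (-p.γξ) • projL M g θ (ev (batchLaw M.toCMDP (M.policy θ) p.Tmax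
            (endStateB x l)) (mlmc p.Tmax (errIncrement M p g θ e))) - B e
          = (-p.γξ) • projL M g θ (ev (batchLaw M.toCMDP (M.policy θ) p.Tmax
            (endStateB x l)) (mlmc p.Tmax (errIncrement M p g θ e)) - M.meanA p.cγ g θ e) := by
        have : B e = e - p.γξ • projL M g θ (M.meanA p.cγ g θ e) := rfl
        rw [this, map_sub, smul_sub, neg_smul, neg_smul]
        abel
      rw [h3, norm_smul, norm_neg, Real.norm_of_nonneg hγ]
      exact mul_le_mul_of_nonneg_left ((norm_projL_le M g θ _).trans
        (hR.norm_ev_mlmc_err_le e hxl)) hγ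
    have h4 : BddOn P fun l => B (err l) := hb'.clm B
    have h5 : ‖ev P (fun l => ev ((batchLaw M.toCMDP (M.policy θ) p.Tmax (endStateB x l)).map
        fun b => l ++ [b]) err) - ev P (fun l => B (err l))‖
        ≤ p.γξ * (56 * X * (7 / lam)) := by
      rw [← ev_sub hb.ev_bind h4]
      refine (norm_ev_le (hb.ev_bind.sub h4)).trans ?_
      refine (ev_mono (hb.ev_bind.sub h4).norm
        (((hb'.norm.add (BddOn.const _ _)).const_mul _).const_mul _) h1).trans ?_
      rw [ev_mul, ev_mul, ev_add hb'.norm (BddOn.const _ _), ev_const]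
      have h6 := hR.ev_norm_criticErr_le n hx
      refine mul_le_mul_of_nonneg_left (mul_le_mul_of_nonneg_left ?_ (by positivity)) hγ
      refine (add_le_add_left h6 _).trans (le_of_eq ?_)
      ring
    have h7 : ‖ev P (fun l => B (err l))‖ ≤ (1 - p.γξ * lam / 4) * ‖ev P err‖ := by
      rw [ev_clm hb']
      refine hR.norm_sub_smul_meanA_le (e := ev P err) ?_
      rw [← ev_clm hb']
      exact ev_congr fun l _ => projL_criticErr M p g θ _
    have hρ : 0 ≤ 1 - p.γξ * lam / 4 := by nlinarith
    have h8 := mul_le_mul_of_nonneg_left ih hρ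
    refine (norm_le_norm_sub_add _ (ev P fun l => B (err l))).trans ?_
    refine (add_le_add h5 (h7.trans h8)).trans (le_of_eq ?_)
    rw [pow_succ']
    field_simp
    ring

end CriticRegime

end Recursion

/-! ### Runs of the algorithm and the conditional law of an epoch -/

section Epochs

variable {S A : Type*} (M : CMDP S A) (π : S → PMF A)

/-- Policies of full support generate chains with the same recurrent states. -/
lemma recurrentStates_eq {π π' : S → PMF A} (h : ∀ s a, π s a ≠ 0) (h' : ∀ s a, π' s a ≠ 0) :
    M.recurrentStates π = M.recurrentStates π' := by
  have key : ∀ {ρ : S → PMF A}, (∀ s a, ρ s a ≠ 0) → ∀ x y,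
      M.chain ρ x y ≠ 0 ↔ ∃ a, M.trans x a y ≠ 0 := by
    intro ρ hρ x y
    unfold CMDP.chain
    rw [← PMF.mem_support_iff, PMF.mem_support_bind_iff]
    exact ⟨fun ⟨a, _, h2⟩ => ⟨a, h2⟩, fun ⟨a, h2⟩ => ⟨a, hρ x a, h2⟩⟩
  have hreach : M.Reaches π = M.Reaches π' := by
    unfold CMDP.Reaches
    congr 1
    funext x y
    exact propext ((key h x y).trans (key h' x y).symm)
  unfold CMDP.recurrentStates
  rw [hreach]

/-- A trajectory that visits the recurrent class ends there. -/
lemma recurrent_endState_of_hit {n : ℕ} {s : S} {τ : List (Transition S A)}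
    (h : τ ∈ (pathLaw M π n s).support)
    (hit : ∃ x ∈ s :: τ.map (fun z => z.2.2), x ∈ M.recurrentStates π) :
    endState s τ ∈ M.recurrentStates π := by
  induction n generalizing s τ with
  | zero =>
    obtain rfl : τ = [] := by simpa [pathLaw] using h
    simpa [endState] using hit
  | succ n ih =>
    have h' := h
    rw [pathLaw_succ] at h
    simp only [PMF.mem_support_bind_iff, PMF.mem_support_map_iff] at h
    obtain ⟨z, hz, τ', hτ', rfl⟩ := h
    obtain ⟨x, hx, hxR⟩ := hit
    rcases List.mem_cons.1 hx with rfl | hx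
    · exact (recurrent_of_mem_pathLaw M π hxR h').1
    · exact ih (s := z.2.2) hτ' ⟨x, by simpa using hx, hxR⟩

lemma mem_epochLaw {B H Tmax : ℕ} {s : S} {e : EpochSample S A}
    (h : e ∈ (epochLaw M π B H Tmax s).support) :
    e.burn ∈ (pathLaw M π B s).support ∧
      e.critic ∈ (batchesLaw M π Tmax H (endState s e.burn)).support ∧
      e.npg ∈ (batchesLaw M π Tmax H (endStateB (endState s e.burn) e.critic)).support := by
  unfold epochLaw at h
  simp only [PMF.mem_support_bind_iff, PMF.mem_support_map_iff] at h
  obtain ⟨τ, hτ, l, hl, l', hl', rfl⟩ := h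
  exact ⟨hτ, hl, hl'⟩

/-- The expectation over an epoch of a function of the burn-in and the critic batches. -/
lemma ev_epochLaw {E : Type*} [NormedAddCommGroup E] [NormedSpace ℝ E] [CompleteSpace E]
    {B H Tmax : ℕ} {s : S} {F : List (Transition S A) → List (Batch S A) → E} {C : ℝ}
    (hF : ∀ τ l, l.length = H → ‖F τ l‖ ≤ C) :
    ev (epochLaw M π B H Tmax s) (fun e => F e.burn e.critic)
      = ev (pathLaw M π B s) fun τ => ev (batchesLaw M π Tmax H (endState s τ)) (F τ) := by
  have hb : BddOn (epochLaw M π B H Tmax s) fun e => F e.burn e.critic :=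
    ⟨C, fun e he => hF _ _ (length_of_mem_batchesLaw M π (mem_epochLaw M π he).2.1)⟩
  unfold epochLaw at hb ⊢
  rw [ev_bind hb]
  refine ev_congr fun τ hτ => ?_
  rw [ev_bind (hb.of_bind hτ)]
  refine ev_congr fun l hl => ?_
  rw [ev_map ((hb.of_bind hτ).of_bind hl)]
  exact ev_const _ (F τ l)

end Epochs

section Runs

variable {S A : Type*} {d : ℕ} {m : Signal → ℕ} (M : Model S A d m) (p : Params d)

lemma bind_congr_support {α β : Type*} {q : PMF α} {f g : α → PMF β}
    (h : ∀ a ∈ q.support, f a = g a) : q.bind f = q.bind g := by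
  ext b
  rw [PMF.bind_apply, PMF.bind_apply]
  refine tsum_congr fun a => ?_
  by_cases ha : a ∈ q.support
  · rw [h a ha]
  · rw [(q.apply_eq_zero_iff a).2 ha, zero_mul, zero_mul]

lemma length_of_mem_runLaw {k : ℕ} {ω : Run S A} (h : ω ∈ (M.runLaw p k).support) :
    ω.epochs.length = k := by
  induction k generalizing ω with
  | zero =>
    rw [Model.runLaw, PMF.mem_support_map_iff] at h
    obtain ⟨s, -, rfl⟩ := h
    rfl
  | succ k ih =>
    rw [Model.runLaw] at h
    simp only [PMF.mem_support_bind_iff, PMF.mem_support_map_iff] at h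
    obtain ⟨ω', hω', e, -, rfl⟩ := h
    simp [ih hω']

lemma history_of_length_le {k : ℕ} {ω : Run S A} (h : ω.epochs.length ≤ k) :
    ω.history k = ω := by
  unfold Run.history
  rw [List.take_of_length_le h]

lemma history_append {k : ℕ} {ω : Run S A} (h : k ≤ ω.epochs.length) (e : EpochSample S A) :
    Run.history k ⟨ω.start, ω.epochs ++ [e]⟩ = ω.history k := by
  unfold Run.history
  rw [List.take_append_of_le_length h]

lemma epoch_append (ω : Run S A) (e : EpochSample S A) :
    Run.epoch ω.epochs.length ⟨ω.start, ω.epochs ++ [e]⟩ = e := by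
  simp [Run.epoch]

lemma history_history {j k : ℕ} (h : j ≤ k) (ω : Run S A) :
    (ω.history k).history j = ω.history j := by
  unfold Run.history
  rw [List.take_take, min_eq_left h]

lemma epoch_history {j k : ℕ} (h : j < k) (ω : Run S A) :
    (ω.history k).epoch j = ω.epoch j := by
  simp [Run.epoch, Run.history, List.getD_eq_getElem?_getD, h]

/-- The first `k` epochs of a longer run have the law of a run of `k` epochs. -/
lemma runLaw_map_history {k n : ℕ} (h : k ≤ n) :
    (M.runLaw p n).map (Run.history k) = M.runLaw p k := by
  induction n, h using Nat.le_induction with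
  | base =>
    rw [← PMF.bind_pure_comp]
    conv_rhs => rw [← PMF.bind_pure (M.runLaw p k)]
    refine bind_congr_support fun ω hω => ?_
    simp only [Function.comp]
    rw [history_of_length_le (length_of_mem_runLaw M p hω).le]
  | succ n hn ih =>
    rw [← ih, Model.runLaw, PMF.map_bind, ← PMF.bind_pure_comp (Run.history k)]
    refine bind_congr_support fun ω hω => ?_
    rw [PMF.map_comp]
    have hlen := length_of_mem_runLaw M p hω
    have : (Run.history k ∘ fun e => (⟨ω.start, ω.epochs ++ [e]⟩ : Run S A))
        = Function.const _ (ω.history k) := by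
      funext e
      exact history_append (hlen ▸ hn) e
    rw [this, PMF.map_const]
    rfl

lemma mem_runLaw_succ {k : ℕ} {ω : Run S A} (h : ω ∈ (M.runLaw p (k + 1)).support) :
    ω.history k ∈ (M.runLaw p k).support ∧
    ω.epoch k ∈ (epochLaw M.toCMDP (M.policy (M.stateAfter p (ω.history k)).θ) p.B p.H p.Tmax
        (M.stateAfter p (ω.history k)).pos).support := by
  rw [Model.runLaw] at h
  simp only [PMF.mem_support_bind_iff, PMF.mem_support_map_iff] at h
  obtain ⟨ω', hω', e, he, rfl⟩ := h
  have hlen := length_of_mem_runLaw M p hω'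
  have h1 : Run.history k ⟨ω'.start, ω'.epochs ++ [e]⟩ = ω' := by
    rw [history_append hlen.ge, history_of_length_le hlen.le]
  have h2 : Run.epoch k ⟨ω'.start, ω'.epochs ++ [e]⟩ = e := by
    rw [← hlen]; exact epoch_append ω' e
  rw [h1, h2]
  exact ⟨hω', he⟩

lemma history_mem_runLaw {k n : ℕ} (h : k ≤ n) {ω : Run S A}
    (hω : ω ∈ (M.runLaw p n).support) : ω.history k ∈ (M.runLaw p k).support := by
  rw [← runLaw_map_history M p h, PMF.mem_support_map_iff]
  exact ⟨ω, hω, rfl⟩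

lemma epoch_mem_epochLaw {k n : ℕ} (h : k < n) {ω : Run S A}
    (hω : ω ∈ (M.runLaw p n).support) :
    ω.epoch k ∈ (epochLaw M.toCMDP (M.policy (M.stateAfter p (ω.history k)).θ) p.B p.H p.Tmax
        (M.stateAfter p (ω.history k)).pos).support := by
  have h1 := (mem_runLaw_succ M p (history_mem_runLaw M p (Nat.succ_le_of_lt h) hω)).2
  rwa [history_history (Nat.le_succ k), epoch_history (Nat.lt_succ_self k)] at h1

lemma length_critic {k n : ℕ} (h : k < n) {ω : Run S A} (hω : ω ∈ (M.runLaw p n).support) :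
    (ω.epoch k).critic.length = p.H :=
  length_of_mem_batchesLaw _ _ (mem_epochLaw _ _ (epoch_mem_epochLaw M p h hω)).2.1

/-- The joint law of the history before epoch `k` and the samples of epoch `k`. -/
lemma ev_runLaw {E : Type*} [NormedAddCommGroup E] [NormedSpace ℝ E] [CompleteSpace E]
    {k n : ℕ} (h : k < n) {Φ : Run S A → EpochSample S A → E} {C : ℝ}
    (hΦ : ∀ ω e, e.critic.length = p.H → ‖Φ ω e‖ ≤ C) :
    ev (M.runLaw p n) (fun ω => Φ (ω.history k) (ω.epoch k))
      = ev (M.runLaw p k) fun ω => ev (epochLaw M.toCMDP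
          (M.policy (M.stateAfter p ω).θ) p.B p.H p.Tmax (M.stateAfter p ω).pos) (Φ ω) := by
  set f : Run S A → E := fun ω => Φ (ω.history k) (ω.epoch k) with hf
  have hb : BddOn (M.runLaw p (k + 1)) f :=
    ⟨C, fun ω hω => hΦ _ _ (length_critic M p (Nat.lt_succ_self k) hω)⟩
  have h1 : ev (M.runLaw p n) f = ev (M.runLaw p (k + 1)) f := by
    have hb' := hb
    rw [← runLaw_map_history M p (Nat.succ_le_of_lt h)] at hb' ⊢
    rw [ev_map hb']
    refine ev_congr fun ω _ => ?_
    simp only [hf]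
    rw [history_history (Nat.le_succ k), epoch_history (Nat.lt_succ_self k)]
  rw [h1]
  rw [Model.runLaw] at hb ⊢
  rw [ev_bind hb]
  refine ev_congr fun ω hω => ?_
  rw [ev_map (hb.of_bind hω)]
  have hlen := length_of_mem_runLaw M p hω
  refine ev_congr fun e _ => ?_
  have h2 : Run.history k ⟨ω.start, ω.epochs ++ [e]⟩ = ω := by
    rw [history_append hlen.ge, history_of_length_le hlen.le]
  have h3 : Run.epoch k ⟨ω.start, ω.epochs ++ [e]⟩ = e := by
    rw [← hlen]; exact epoch_append ω e
  simp only [hf, h2, h3]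

lemma stateAfter_history_succ {k : ℕ} {ω : Run S A} (h : k < ω.epochs.length) :
    M.stateAfter p (ω.history (k + 1))
      = M.update p (M.stateAfter p (ω.history k)) (ω.epoch k) := by
  unfold Model.stateAfter Run.history Run.epoch
  simp only
  rw [List.take_succ_eq_append_getElem h, List.foldl_append, List.getD_eq_getElem _ _ h]
  rfl

lemma mem_hitEvent_history {j k : ℕ} (h : j < k) (ω : Run S A) :
    ω.history k ∈ M.hitEvent p j ↔ ω ∈ M.hitEvent p j := by
  unfold Model.hitEvent
  simp only [Set.mem_ofPred_eq]
  rw [history_history h.le, epoch_history h]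

variable {Θ : Set (EuclideanSpace ℝ (Fin d))}
  (hpos : ∀ θ ∈ Θ, ∀ s a, M.policy θ s a ≠ 0)
include hpos

/-- Once the recurrent class is reached, it is never left: all policies share it. Hence hitting
it in epoch `k` implies hitting it in all later epochs. -/
lemma hitEvent_mono {K : ℕ} {ω : Run S A} (hω : ω ∈ (M.runLaw p K).support)
    (hΘ : ∀ k < K, (M.stateAfter p (ω.history k)).θ ∈ Θ) {k : ℕ} (hk : ω ∈ M.hitEvent p k)
    {j : ℕ} (hkj : k ≤ j) (hj : j < K) : ω ∈ M.hitEvent p j := by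
  induction j, hkj using Nat.le_induction with
  | base => exact hk
  | succ j hkj ih =>
    have hjK : j < K := by omega
    have hhit := ih hjK
    obtain ⟨h1, h2, h3⟩ := mem_epochLaw _ _ (epoch_mem_epochLaw M p hjK hω)
    have e1 := recurrent_endState_of_hit _ _ h1 hhit
    have e2 := recurrent_of_mem_batchesLaw _ _ e1 h2
    have e3 := recurrent_of_mem_batchesLaw _ _ e2 h3
    have hlen := length_of_mem_runLaw M p hω
    refine ⟨(M.stateAfter p (ω.history (j + 1))).pos, List.mem_cons_self, ?_⟩
    rw [recurrentStates_eq M.toCMDP (hpos _ (hΘ _ hj)) (hpos _ (hΘ _ hjK)),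
      stateAfter_history_succ M p (by omega)]
    exact e3

/-- Given the history, the burn-in event reduces to a condition on the burn-in of epoch `k`. -/
lemma mem_burnInEvent_iff {K : ℕ} {ω : Run S A} (hω : ω ∈ (M.runLaw p K).support)
    (hΘ : ∀ k < K, (M.stateAfter p (ω.history k)).θ ∈ Θ) {k : ℕ} (hk : k < K) :
    ω ∈ M.burnInEvent p K ↔
      (∀ j < k, ω.history k ∈ M.hitEvent p j) ∧ ω ∈ M.hitEvent p k := by
  unfold Model.burnInEvent
  simp only [Set.mem_iInter, Finset.mem_range]
  constructor
  · intro h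
    exact ⟨fun j hj => (mem_hitEvent_history M p hj ω).2 (h j (hj.trans hk)), h k hk⟩
  · rintro ⟨h1, h2⟩ j hj
    rcases lt_or_ge j k with hjk | hjk
    · exact (mem_hitEvent_history M p hjk ω).1 (h1 j hjk)
    · exact hitEvent_mono M p hpos hω hΘ h2 hjk hj

end Runs

section ConditionalLaw

variable {S A : Type*} [Fintype S] [Fintype A]

instance : DiscreteMeasurableSpace (Run S A) := ⟨fun _ => trivial⟩

instance : Countable (Batch S A) :=
  Function.Injective.countable (f := fun b : Batch S A => (b.level, b.path)) fun a b h => by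
    cases a; cases b; simp_all

instance : Countable (EpochSample S A) :=
  Function.Injective.countable (f := fun e : EpochSample S A => (e.burn, e.critic, e.npg))
    fun a b h => by cases a; cases b; simp_all

instance : Countable (Run S A) :=
  Function.Injective.countable (f := fun ω : Run S A => (ω.start, ω.epochs)) fun a b h => by
    cases a; cases b; simp_all

lemma integrable_of_bddOn {E : Type*} [NormedAddCommGroup E] [NormedSpace ℝ E]
    {q : PMF (Run S A)} {f : Run S A → E} (h : BddOn q f) : Integrable f q.toMeasure := by
  obtain ⟨C, hC⟩ := h
  refine Integrable.of_bound (StronglyMeasurable.of_discrete).aestronglyMeasurable C ?_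
  rw [ae_iff, PMF.toMeasure_apply_eq_zero_iff _ (MeasurableSet.of_discrete)]
  exact Set.disjoint_left.2 fun ω hω hn => hn (hC ω hω)

lemma integral_toMeasure {E : Type*} [NormedAddCommGroup E] [NormedSpace ℝ E] [CompleteSpace E]
    {q : PMF (Run S A)} {f : Run S A → E} (h : BddOn q f) : ∫ ω, f ω ∂q.toMeasure = ev q f :=
  PMF.integral_eq_tsum q f (integrable_of_bddOn h)

lemma ev_sum {α ι E : Type*} [NormedAddCommGroup E] [NormedSpace ℝ E] [CompleteSpace E]
    {q : PMF α} (s : Finset ι) {f : ι → α → E} (h : ∀ i, BddOn q (f i)) :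
    ev q (fun x => ∑ i ∈ s, f i x) = ∑ i ∈ s, ev q (f i) := by
  unfold ev
  rw [← Summable.tsum_finsetSum fun i _ => (h i).summable]
  simp only [Finset.smul_sum]

lemma ev_smul_const {α E : Type*} [NormedAddCommGroup E] [NormedSpace ℝ E] [CompleteSpace E]
    {q : PMF α} {f : α → ℝ} (h : BddOn q f) (v : E) : ev q (fun x => f x • v) = ev q f • v :=
  ev_clm h ((ContinuousLinearMap.id ℝ ℝ).smulRight v)

variable {d : ℕ} {m : Signal → ℕ} (M : Model S A d m) (p : Params d)
  {Θ : Set (EuclideanSpace ℝ (Fin d))}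
  (hpos : ∀ θ ∈ Θ, ∀ s a, M.policy θ s a ≠ 0) {K : ℕ}
  (hΘ : ∀ ω ∈ (M.runLaw p K).support, ∀ k < K, (M.stateAfter p (ω.history k)).θ ∈ Θ)
  {k : ℕ} (hk : k < K) {h : Run S A}
  (hE : (M.runLaw p K).toMeasure ({ω | ω.history k = h} ∩ M.burnInEvent p K) ≠ 0)
include hpos hΘ hk hE

open Classical in
/-- Under the conditional law, the critic batches of epoch `k` are generated from a random
starting state in the recurrent class. -/
lemma exists_condLaw_weights :
    ∃ w : S → ℝ, (∀ x, 0 ≤ w x) ∧ ∑ x, w x = 1 ∧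
      (∀ x, w x ≠ 0 → x ∈ M.recurrentStates (M.policy (M.stateAfter p h).θ)) ∧
      ∀ (V : Type) [NormedAddCommGroup V] [NormedSpace ℝ V] [CompleteSpace V]
        (F : List (Batch S A) → V), (∃ C, ∀ l, l.length = p.H → ‖F l‖ ≤ C) →
        ∫ ω, F (ω.epoch k).critic ∂(M.condLaw p K k h) = ∑ x, w x • ev (batchesLaw M.toCMDP
          (M.policy (M.stateAfter p h).θ) p.Tmax p.H x) F := by
  set θ := (M.stateAfter p h).θ with hθ
  set s₀ := (M.stateAfter p h).pos with hs₀
  set E := {ω : Run S A | ω.history k = h} ∩ M.burnInEvent p K with hEdef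
  -- `c τ` says that the burn-in trajectory `τ` is compatible with the burn-in event; `u x` is the
  -- probability that this happens and that the burn-in ends in `x`.
  set c : List (Transition S A) → Prop := fun τ => (∀ j < k, h ∈ M.hitEvent p j) ∧
    ∃ s ∈ s₀ :: τ.map (fun z => z.2.2), s ∈ M.recurrentStates (M.policy θ) with hc
  have hEc : ∀ ω ∈ (M.runLaw p K).support,
      (ω ∈ E ↔ ω.history k = h ∧ c (ω.epoch k).burn) := by
    intro ω hω
    rw [hEdef, Set.mem_inter_iff, Set.mem_ofPred_eq, mem_burnInEvent_iff M p hpos hω (hΘ ω hω) hk]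
    refine and_congr_right fun hh => ?_
    unfold Model.hitEvent
    simp only [Set.mem_ofPred_eq, hh, hc]
    rfl
  set u : S → ℝ := fun x => ev (pathLaw M.toCMDP (M.policy θ) p.B s₀)
    fun τ => if c τ ∧ endState s₀ τ = x then 1 else 0 with hu
  set c₀ : ℝ := ((M.runLaw p K).toMeasure E)⁻¹.toReal * (M.runLaw p k h).toReal with hc₀
  have hu0 : ∀ x, 0 ≤ u x := fun x => ev_nonneg fun τ => by split_ifs <;> norm_num
  have hF : ∀ (V : Type) [NormedAddCommGroup V] [NormedSpace ℝ V] [CompleteSpace V]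
        (F : List (Batch S A) → V), (∃ C, ∀ l, l.length = p.H → ‖F l‖ ≤ C) →
        ∫ ω, F (ω.epoch k).critic ∂(M.condLaw p K k h) = ∑ x, (c₀ * u x) • ev (batchesLaw M.toCMDP
          (M.policy (M.stateAfter p h).θ) p.Tmax p.H x) F := by
    intro V _ _ _ F hFb
    obtain ⟨C, hC⟩ := hFb
    set Φ : Run S A → EpochSample S A → V := fun ω e =>
      if ω = h ∧ c e.burn then F e.critic else 0 with hΦ
    have hΦb : ∀ ω e, e.critic.length = p.H → ‖Φ ω e‖ ≤ max C 0 := by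
      intro ω e he
      simp only [hΦ]
      split_ifs
      · exact le_max_of_le_left (hC _ he)
      · simp
    have hind : ∀ ω ∈ (M.runLaw p K).support,
        E.indicator (fun ω => F (ω.epoch k).critic) ω = Φ (ω.history k) (ω.epoch k) := by
      intro ω hω
      simp only [Set.indicator, hΦ, hEc ω hω]
    have hbind : BddOn (M.runLaw p K) (E.indicator fun ω => F (ω.epoch k).critic) := by
      refine ⟨max C 0, fun ω hω => ?_⟩
      rw [hind ω hω]
      exact hΦb _ _ (length_critic M p hk hω)
    unfold Model.condLaw ProbabilityTheory.cond
    rw [integral_smul_measure, ← integral_indicator MeasurableSet.of_discrete,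
      integral_toMeasure hbind, ev_congr hind, ev_runLaw M p hk hΦb]
    have h1 : ev (M.runLaw p k) (fun ω => ev (epochLaw M.toCMDP
          (M.policy (M.stateAfter p ω).θ) p.B p.H p.Tmax (M.stateAfter p ω).pos) (Φ ω))
        = (M.runLaw p k h).toReal • ev (epochLaw M.toCMDP (M.policy θ) p.B p.H p.Tmax s₀)
          (Φ h) := by
      rw [ev, tsum_eq_single h]
      intro ω hω
      have : Φ ω = fun _ => 0 := by
        funext e
        simp [hΦ, hω]
      rw [this, ev_const, smul_zero]
    have h2 : ev (epochLaw M.toCMDP (M.policy θ) p.B p.H p.Tmax s₀) (Φ h)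
        = ev (pathLaw M.toCMDP (M.policy θ) p.B s₀) fun τ => ∑ x,
          (if c τ ∧ endState s₀ τ = x then (1 : ℝ) else 0) •
            ev (batchesLaw M.toCMDP (M.policy θ) p.Tmax p.H x) F := by
      have e1 := ev_epochLaw M.toCMDP (M.policy θ) (B := p.B) (H := p.H) (Tmax := p.Tmax)
        (s := s₀) (F := fun τ l => if c τ then F l else 0) (C := max C 0) (by
          intro τ l hl
          split_ifs
          · exact le_max_of_le_left (hC _ hl)
          · simp)
      have e2 : Φ h = fun e => if c e.burn then F e.critic else 0 := by
        funext e
        simp [hΦ]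
      rw [e2, e1]
      refine ev_congr fun τ _ => ?_
      by_cases hcτ : c τ
      · simp [hcτ]
      · simp [hcτ, ev_const]
    rw [h1, h2, ev_sum _ fun x => BddOn.of_pathLaw _ _ _ _ _]
    simp only [ev_smul_const (BddOn.of_pathLaw _ _ _ _ _)]
    rw [Finset.smul_sum, Finset.smul_sum]
    refine Finset.sum_congr rfl fun x _ => ?_
    rw [smul_smul, smul_smul]
  have hprob : IsProbabilityMeasure (M.condLaw p K k h) := cond_isProbabilityMeasure hE
  refine ⟨fun x => c₀ * u x, fun x => mul_nonneg (by positivity) (hu0 x), ?_, ?_, hF⟩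
  -- The weights sum to one because the conditional law is a probability measure.
  · have h1 := hF ℝ (fun _ => 1) ⟨1, by simp⟩
    simpa [ev_const] using h1.symm
  · intro x hx
    by_contra hxR
    refine hx ?_
    have : u x = ev (pathLaw M.toCMDP (M.policy θ) p.B s₀) fun _ => (0 : ℝ) := by
      refine ev_congr fun τ hτ => if_neg ?_
      rintro ⟨hcτ, rfl⟩
      exact hxR (recurrent_endState_of_hit _ _ hτ hcτ.2)
    change c₀ * u x = 0
    rw [this, ev_const, mul_zero]

omit hpos hΘ in
lemma memLp_criticIterate (g : Signal)
    (hb : ∃ C, ∀ l : List (Batch S A), l.length = p.H → ‖M.criticOut p g l‖ ≤ C) :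
    MemLp (M.criticIterate p g k) 2 (M.condLaw p K k h) := by
  obtain ⟨C, hC⟩ := hb
  have hprob : IsProbabilityMeasure (M.condLaw p K k h) := cond_isProbabilityMeasure hE
  refine MemLp.of_bound (StronglyMeasurable.of_discrete).aestronglyMeasurable C ?_
  have hac : M.condLaw p K k h ≪ (M.runLaw p K).toMeasure := cond_absolutelyContinuous
  have hae : ∀ᵐ ω ∂(M.runLaw p K).toMeasure, ‖M.criticIterate p g k ω‖ ≤ C := by
    rw [ae_iff, PMF.toMeasure_apply_eq_zero_iff _ MeasurableSet.of_discrete]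
    exact Set.disjoint_left.2 fun ω hω hn => hn (hC _ (length_critic M p hk hω))
  exact hac.ae_le hae

end ConditionalLaw

/-! ### From the recursion to the stated rates -/

section Rates

/-- Contraction over `n` steps whose rates add up to `r log t`. -/
lemma one_sub_pow_le_inv {x t : ℝ} {n r : ℕ} (hx : x ≤ 1) (ht : 0 < t)
    (h : x * n = r * Real.log t) : (1 - x) ^ n ≤ (t ^ r)⁻¹ := by
  calc (1 - x) ^ n ≤ Real.exp (-x) ^ n :=
        pow_le_pow_left₀ (by linarith) (Real.one_sub_le_exp_neg x) n
    _ = (t ^ r)⁻¹ := by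
        rw [← Real.exp_nat_mul, mul_neg, mul_comm, h, ← Real.log_pow, Real.exp_neg,
          Real.exp_log (by positivity)]

variable {lm c C γ t Tm : ℝ} {H : ℕ} (hlm : 0 < lm) (hlm1 : lm ≤ 1) (hc : 1 ≤ c) (hC : 0 ≤ C)
  (ht : 2 ≤ t) (hTm : 2 ≤ Tm) (hH : 1 ≤ H) (hγ : γ = 8 * Real.log t / (lm * H))
  (hγ1 : γ ≤ lm / 500000)

include ht hTm in
lemma log_mul_log_ge : 0.47 ≤ Real.log t * Real.log Tm := by
  have h2 := Real.log_two_gt_d9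
  have h3 : 0.69 ≤ Real.log t := by
    have : Real.log 2 ≤ Real.log t := Real.log_le_log (by norm_num) ht
    norm_num at h2 ⊢
    linarith
  have h4 : 0.69 ≤ Real.log Tm := by
    have : Real.log 2 ≤ Real.log Tm := Real.log_le_log (by norm_num) hTm
    norm_num at h2 ⊢
    linarith
  norm_num at h3 h4 ⊢
  nlinarith

include hlm hc ht in
lemma initial_term_le : (t ^ 4)⁻¹ * (9 / lm ^ 2) ≤ 9 * (c ^ 2 / (lm ^ 2 * t ^ 2)) := by
  have h1 : (t ^ 4)⁻¹ * (9 / lm ^ 2) = 9 * (1 / (lm ^ 2 * t ^ 4)) := by field_simp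
  rw [h1]
  refine mul_le_mul_of_nonneg_left ?_ (by norm_num)
  have h2 : 1 ≤ c ^ 2 := one_le_pow₀ hc
  have h3 : t ^ 2 ≤ t ^ 4 := pow_le_pow_right₀ (by linarith) (by norm_num)
  gcongr

include hlm hc hTm in
lemma bias_term_le : (c * C / Tm) ^ 2 / lm ^ 4 ≤ c ^ 4 * C ^ 2 / (lm ^ 4 * Tm) := by
  have h1 : (c * C / Tm) ^ 2 / lm ^ 4 = c ^ 2 * C ^ 2 / (lm ^ 4 * Tm ^ 2) := by field_simp
  rw [h1]
  have h2 : c ^ 2 ≤ c ^ 4 := pow_le_pow_right₀ hc (by norm_num)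
  have h3 : Tm ≤ Tm ^ 2 := by nlinarith
  gcongr

include hlm hc hH hγ ht hTm in
lemma variance_term_le : γ * (c ^ 2 * C ^ 2 * Real.log Tm) / lm ^ 3
    ≤ 8 * (Real.log t * Real.log Tm) * (c ^ 4 * C ^ 2 / (lm ^ 4 * H)) := by
  have hH0 : (0 : ℝ) < H := by exact_mod_cast hH
  have h0 := log_mul_log_ge ht hTm
  have h1 : γ * (c ^ 2 * C ^ 2 * Real.log Tm) / lm ^ 3
      = 8 * (Real.log t * Real.log Tm) * (c ^ 2 * C ^ 2 / (lm ^ 4 * H)) := by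
    rw [hγ]
    field_simp
  rw [h1]
  have h2 : c ^ 2 ≤ c ^ 4 := pow_le_pow_right₀ hc (by norm_num)
  refine mul_le_mul_of_nonneg_left ?_ (by linarith)
  gcongr

include hlm hH hγ in
/-- The step size is chosen so that the total contraction exponent is `8 log t`. -/
lemma rate_exponent : γ * lm * H = 8 * Real.log t := by
  have hH0 : (0 : ℝ) < H := by exact_mod_cast hH
  rw [hγ]
  field_simp

include hlm hlm1 hc ht hTm hH hγ hγ1 in
lemma meanSquare_rate_le :
    (1 - γ * lm / 2) ^ H * (9 / lm ^ 2)
        + (50176 * (c * C / Tm) ^ 2 / lm ^ 4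
          + 1176000 * (γ * (c ^ 2 * C ^ 2 * Real.log Tm)) / lm ^ 3)
      ≤ 20000000 * (Real.log t * Real.log Tm) * (c ^ 2 / (lm ^ 2 * t ^ 2)
        + (c ^ 4 * C ^ 2 / (lm ^ 4 * H) + c ^ 4 * C ^ 2 / (lm ^ 4 * Tm))) := by
  have hH0 : (0 : ℝ) < H := by exact_mod_cast hH
  have h0 := log_mul_log_ge ht hTm
  have h1 : (1 - γ * lm / 2) ^ H ≤ (t ^ 4)⁻¹ := by
    refine one_sub_pow_le_inv (by nlinarith) (by linarith) ?_
    have := rate_exponent hlm hH hγ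
    push_cast
    linarith
  have h2 := mul_le_mul_of_nonneg_right h1 (by positivity : 0 ≤ 9 / lm ^ 2)
  have h3 := initial_term_le hlm hc ht
  have h4 := bias_term_le (C := C) hlm hc hTm
  have h5 := variance_term_le (C := C) hlm hc ht hTm hH hγ
  have e1 : 50176 * (c * C / Tm) ^ 2 / lm ^ 4 = 50176 * ((c * C / Tm) ^ 2 / lm ^ 4) := by ring
  have e2 : 1176000 * (γ * (c ^ 2 * C ^ 2 * Real.log Tm)) / lm ^ 3
      = 1176000 * (γ * (c ^ 2 * C ^ 2 * Real.log Tm) / lm ^ 3) := by ring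
  rw [e1, e2]
  have hP1 : 0 ≤ c ^ 2 / (lm ^ 2 * t ^ 2) := by positivity
  have hP2 : 0 ≤ c ^ 4 * C ^ 2 / (lm ^ 4 * H) := by positivity
  have hP3 : 0 ≤ c ^ 4 * C ^ 2 / (lm ^ 4 * Tm) := by positivity
  generalize c ^ 2 / (lm ^ 2 * t ^ 2) = P1 at *
  generalize c ^ 4 * C ^ 2 / (lm ^ 4 * H) = P2 at *
  generalize c ^ 4 * C ^ 2 / (lm ^ 4 * Tm) = P3 at *
  generalize Real.log t * Real.log Tm = ll at *
  norm_num at h0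
  nlinarith [mul_nonneg (sub_nonneg.2 h0) hP1, mul_nonneg (sub_nonneg.2 h0) hP2,
    mul_nonneg (sub_nonneg.2 h0) hP3]

include hlm hlm1 hc hC ht hTm hH hγ hγ1 in
lemma mean_rate_le {y : ℝ} (hy0 : 0 ≤ y)
    (hy : y ≤ (1 - γ * lm / 4) ^ H * (3 / lm) + 1568 * (c * C / Tm) / lm ^ 2) :
    y ^ 2 ≤ 20000000 * (Real.log t * Real.log Tm) * (c ^ 2 / (lm ^ 2 * t ^ 2)
      + c ^ 4 * C ^ 2 / (lm ^ 4 * Tm)) := by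
  have hH0 : (0 : ℝ) < H := by exact_mod_cast hH
  have h0 := log_mul_log_ge ht hTm
  have h1 : (1 - γ * lm / 4) ^ H ≤ (t ^ 2)⁻¹ := by
    refine one_sub_pow_le_inv (by nlinarith) (by linarith) ?_
    have := rate_exponent hlm hH hγ
    push_cast
    linarith
  have h2 := mul_le_mul_of_nonneg_right h1 (by positivity : 0 ≤ 3 / lm)
  have h3 := initial_term_le hlm hc ht
  have h4 := bias_term_le (C := C) hlm hc hTm
  set u := (t ^ 2)⁻¹ * (3 / lm) with hu
  set v := 1568 * (c * C / Tm) / lm ^ 2 with hv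
  have h5 : y ^ 2 ≤ 2 * u ^ 2 + 2 * v ^ 2 := by
    have : y ^ 2 ≤ (u + v) ^ 2 := pow_le_pow_left₀ hy0 (by linarith) 2
    nlinarith [sq_nonneg (u - v)]
  have e1 : u ^ 2 = (t ^ 4)⁻¹ * (9 / lm ^ 2) := by
    rw [hu]
    field_simp
    norm_num
  have e2 : v ^ 2 = 2458624 * ((c * C / Tm) ^ 2 / lm ^ 4) := by
    rw [hv]
    field_simp
    ring
  rw [e1, e2] at h5
  have hP1 : 0 ≤ c ^ 2 / (lm ^ 2 * t ^ 2) := by positivity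
  have hP3 : 0 ≤ c ^ 4 * C ^ 2 / (lm ^ 4 * Tm) := by positivity
  generalize c ^ 2 / (lm ^ 2 * t ^ 2) = P1 at *
  generalize c ^ 4 * C ^ 2 / (lm ^ 4 * Tm) = P3 at *
  generalize Real.log t * Real.log Tm = ll at *
  norm_num at h0
  nlinarith [mul_nonneg (sub_nonneg.2 h0) hP1, mul_nonneg (sub_nonneg.2 h0) hP3]

end Rates

section Assembly

variable {S A : Type*} [Fintype S] [Fintype A] {d : ℕ} {m : Signal → ℕ} {M : Model S A d m}

lemma half_le_Ctar {Θ : Set (EuclideanSpace ℝ (Fin d))} (h0 : 0 < M.Ctar Θ)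
    (htop : M.Ctar Θ ≠ ⊤) : 1 / 2 ≤ (M.Ctar Θ).toReal := by
  obtain ⟨θ, hθ, hne⟩ : ∃ θ ∈ Θ, M.targetTime (M.policy θ) ≠ 0 := by
    by_contra hcon
    push Not at hcon
    refine h0.ne' ?_
    unfold Model.Ctar
    simp only [ENNReal.iSup_eq_zero]
    exact hcon
  have h1 : (2⁻¹ : ℝ≥0∞) ≤ M.Ctar Θ :=
    (half_le_targetTime M.toCMDP (M.policy θ) hne).trans
      (le_iSup₂_of_le (f := fun θ (_ : θ ∈ Θ) => M.targetTime (M.policy θ)) θ hθ le_rfl)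
  have h2 := ENNReal.toReal_mono htop h1
  simpa using h2

variable {p : Params d} {g : Signal} {θ : EuclideanSpace ℝ (Fin d)} {lm C : ℝ}

/-- Averages of the error bounds over a random starting state in the recurrent class. -/
lemma CriticRegime.bounds_of_weights (hR : CriticRegime M p g θ lm C) {w : S → ℝ}
    (hw0 : ∀ x, 0 ≤ w x) (hw1 : ∑ x, w x = 1)
    (hwR : ∀ x, w x ≠ 0 → x ∈ M.recurrentStates (M.policy θ)) (n : ℕ) :
    ∑ x, w x • ev (batchesLaw M.toCMDP (M.policy θ) p.Tmax n x)
        (fun l => ‖criticErr M p g θ (M.criticOut p g l)‖ ^ 2)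
      ≤ (1 - p.γξ * lm / 2) ^ n * (9 / lm ^ 2)
        + (50176 * (p.cγ * C / p.Tmax) ^ 2 / lm ^ 4
          + 1176000 * (p.γξ * (p.cγ ^ 2 * C ^ 2 * Real.log p.Tmax)) / lm ^ 3) ∧
    ‖projL M g θ ((∑ x, w x • ev (batchesLaw M.toCMDP (M.policy θ) p.Tmax n x)
        (M.criticOut p g)) - M.criticTarget p.cγ g θ)‖
      ≤ (1 - p.γξ * lm / 4) ^ n * (3 / lm) + 1568 * (p.cγ * C / p.Tmax) / lm ^ 2 := by
  have avg : ∀ (f : S → ℝ) (B : ℝ), (∀ x ∈ M.recurrentStates (M.policy θ), f x ≤ B) →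
      ∑ x, w x * f x ≤ B := by
    intro f B hf
    calc ∑ x, w x * f x ≤ ∑ x, w x * B := by
          refine Finset.sum_le_sum fun x _ => ?_
          by_cases hx : w x = 0
          · simp [hx]
          · exact mul_le_mul_of_nonneg_left (hf x (hwR x hx)) (hw0 x)
      _ = B := by rw [← Finset.sum_mul, hw1, one_mul]
  refine ⟨avg _ _ fun x hx => hR.ev_criticErr_sq_le n hx, ?_⟩
  have h1 : projL M g θ ((∑ x, w x • ev (batchesLaw M.toCMDP (M.policy θ) p.Tmax n x)
        (M.criticOut p g)) - M.criticTarget p.cγ g θ)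
      = ∑ x, w x • ev (batchesLaw M.toCMDP (M.policy θ) p.Tmax n x)
        (fun l => criticErr M p g θ (M.criticOut p g l)) := by
    have h2 : M.criticTarget p.cγ g θ = ∑ x, w x • M.criticTarget p.cγ g θ := by
      rw [← Finset.sum_smul, hw1, one_smul]
    conv_lhs => rw [h2, ← Finset.sum_sub_distrib, map_sum]
    refine Finset.sum_congr rfl fun x _ => ?_
    rw [← smul_sub, map_smul]
    congr 1
    have hb := hR.bddOn_criticOut n x
    unfold criticErr
    rw [ev_clm (hb.sub (BddOn.const _ _)), ev_sub hb (BddOn.const _ _), ev_const]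
  rw [h1]
  refine (norm_sum_le _ _).trans ?_
  simp only [norm_smul, Real.norm_of_nonneg (hw0 _)]
  exact avg _ _ fun x hx => hR.norm_ev_criticErr_le n hx

end Assembly

end UnichainCMDP

open UnichainCMDP in
theorem mainTheorem2 :
    ∃ (a b L : ℝ) (q : ℕ), 0 < a ∧ 0 < b ∧ 0 < L ∧
      ∀ (S A : Type*) [Fintype S] [Fintype A] (d : ℕ) (m : Signal → ℕ) (M : Model S A d m)
        (Θ : Set (EuclideanSpace ℝ (Fin d))) (lam : Signal → ℝ) (G₁ G₂ μ : ℝ)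
        (p : Params d) (K T : ℕ),
        M.Assumptions Θ p.δ lam G₁ G₂ μ →
        0 < M.Ctar Θ → M.Ctar Θ ≠ ⊤ →
        min (lam .r) (lam .c) ≤ 1 →
        (∀ ω ∈ (M.runLaw p K).support, ∀ k < K, (M.stateAfter p (ω.history k)).θ ∈ Θ) →
        2 ≤ T → 2 ≤ p.Tmax → 1 ≤ p.H →
        ∀ lm C : ℝ, lm = min (lam .r) (lam .c) → C = (M.Ctar Θ).toReal →
        lm + √(1 / lm ^ 2 - 1) ≤ p.cγ →
        p.γξ = 8 * Real.log T / (lm * p.H) →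
        p.γξ ≤ lm / (a * p.cγ ^ 2 * C ^ 2 * Real.log p.Tmax) →
        b * p.cγ ^ 2 * C ^ 2 / lm ≤ p.Tmax →
        ∀ (g : Signal), ∀ k < K, ∀ h : Run S A,
          (M.runLaw p K).toMeasure ({ω | ω.history k = h} ∩ M.burnInEvent p K) ≠ 0 →
          ∀ (θ : EuclideanSpace ℝ (Fin d)), θ = (M.stateAfter p h).θ →
          MeasureTheory.MemLp (M.criticIterate p g k) 2 (M.condLaw p K k h) ∧
          (∫ ω, ‖M.proj g θ (M.criticIterate p g k ω - M.criticTarget p.cγ g θ)‖ ^ 2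
              ∂(M.condLaw p K k h)
            ≤ L * (Real.log T * Real.log p.Tmax) ^ q *
              (p.cγ ^ 2 / (lm ^ 2 * T ^ 2)
                + p.cγ ^ 4 * C ^ 2 / lm ^ 4 * (1 / p.H + 1 / p.Tmax))) ∧
          (p.Tmax ≤ p.H →
            ∫ ω, ‖M.proj g θ (M.criticIterate p g k ω - M.criticTarget p.cγ g θ)‖ ^ 2
              ∂(M.condLaw p K k h)
            ≤ L * (Real.log T * Real.log p.Tmax) ^ q *
              (p.cγ ^ 2 / (lm ^ 2 * T ^ 2) + p.cγ ^ 4 * C ^ 2 / (lm ^ 4 * p.Tmax))) ∧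
          ‖M.proj g θ ((∫ ω, M.criticIterate p g k ω ∂(M.condLaw p K k h))
              - M.criticTarget p.cγ g θ)‖ ^ 2
            ≤ L * (Real.log T * Real.log p.Tmax) ^ q *
              (p.cγ ^ 2 / (lm ^ 2 * T ^ 2) + p.cγ ^ 4 * C ^ 2 / (lm ^ 4 * p.Tmax)) := by
  refine ⟨3000000, 2000, 40000000, 1, by norm_num, by norm_num, by norm_num, ?_⟩
  intro S A _ _ d m M Θ lam G₁ G₂ μ p K T hM hC0 hCtop hlm1 hΘ hT hTmax hH lm C hlm hCeq hcγ hγ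
    hγle hTge g k hk h hE θ hθ
  have hlm0 : 0 < lm := hlm ▸ lt_min (hM.lam_pos .r) (hM.lam_pos .c)
  have hlm1' : lm ≤ 1 := hlm ▸ hlm1
  have hlmg : lm ≤ lam g := by
    rw [hlm]
    cases g
    · exact min_le_left _ _
    · exact min_le_right _ _
  have hpos : ∀ θ ∈ Θ, ∀ s a, M.policy θ s a ≠ 0 := fun θ hθ s a h0 => by
    have := hM.policy_pos θ hθ s a
    rw [h0] at this
    exact lt_irrefl _ this
  -- The conditioning event contains a run of positive probability, so `θ` is one of the `θ_k`
  have hθΘ : θ ∈ Θ := by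
    rw [Ne, PMF.toMeasure_apply_eq_zero_iff _ MeasurableSet.of_discrete,
      Set.not_disjoint_iff] at hE
    obtain ⟨ω, hω, hωh, -⟩ := hE
    have hωh' : ω.history k = h := hωh
    rw [hθ, ← hωh']
    exact hΘ ω hω k hk
  have hChalf : 1 / 2 ≤ C := hCeq ▸ half_le_Ctar hC0 hCtop
  have hcoer := half_add_le_of_sqrt_le p.cγ hlm0 hlm1' hcγ
  have hc1 : 1 ≤ p.cγ := one_le_of_half_add_le p.cγ hlm0 hcoer
  have hTr : (2 : ℝ) ≤ T := by exact_mod_cast hT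
  have hTmr : (2 : ℝ) ≤ p.Tmax := by exact_mod_cast hTmax
  have hH0 : (0 : ℝ) < p.H := by exact_mod_cast hH
  have hlogT : 0 < Real.log T := Real.log_pos (by linarith)
  have hlogTm : 0 < Real.log p.Tmax := Real.log_pos (by linarith)
  have hR : CriticRegime M p g θ lm C :=
    { unichain := hM.unichain θ hθΘ
      feature_le := hM.feature_le g
      lam_pos := hlm0
      lam_le_one := hlm1'
      lower := fun x hx => (mul_le_mul_of_nonneg_right hlmg (sq_nonneg _)).trans
        (hM.critic_lower g θ hθΘ x hx)
      half_le := hChalf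
      target_le := by
        rw [hCeq, ENNReal.ofReal_toReal hCtop]
        exact le_iSup₂_of_le (f := fun θ (_ : θ ∈ Θ) => M.targetTime (M.policy θ)) θ hθΘ le_rfl
      cγ_ge := hcoer
      two_le := hTmax
      step_nonneg := by rw [hγ]; positivity
      step_le := by
        rw [le_div_iff₀ (by positivity)] at hγle
        linarith
      Tmax_ge := by
        rw [div_le_iff₀ hlm0] at hTge
        linarith }
  obtain ⟨w, hw0, hw1, hwR, hwF⟩ := exists_condLaw_weights M p hpos hΘ hk hE
  rw [← hθ] at hwR hwF
  obtain ⟨B, hB⟩ := hR.exists_norm_criticOut_le p.H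
  obtain ⟨hsq, hmean⟩ := hR.bounds_of_weights hw0 hw1 hwR p.H
  have hint : ∫ ω, ‖M.proj g θ (M.criticIterate p g k ω - M.criticTarget p.cγ g θ)‖ ^ 2
      ∂(M.condLaw p K k h) = ∑ x, w x • ev (batchesLaw M.toCMDP (M.policy θ) p.Tmax p.H x)
        (fun l => ‖criticErr M p g θ (M.criticOut p g l)‖ ^ 2) := by
    refine hwF ℝ (fun l => ‖criticErr M p g θ (M.criticOut p g l)‖ ^ 2)
      ⟨(B + ‖M.criticTarget p.cγ g θ‖) ^ 2, fun l hl => ?_⟩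
    rw [norm_pow, norm_norm]
    refine pow_le_pow_left₀ (norm_nonneg _) ?_ 2
    exact (norm_projL_le M g θ _).trans ((norm_sub_le _ _).trans (by linarith [hB l hl]))
  have hint2 : ∫ ω, M.criticIterate p g k ω ∂(M.condLaw p K k h)
      = ∑ x, w x • ev (batchesLaw M.toCMDP (M.policy θ) p.Tmax p.H x) (M.criticOut p g) :=
    hwF _ (M.criticOut p g) ⟨B, hB⟩
  have hrate := hsq.trans (meanSquare_rate_le (C := C) hlm0 hlm1' hc1 hTr hTmr hH hγ
    hR.step_le_lam)
  have hmrate := mean_rate_le (C := C) hlm0 hlm1' hc1 (by linarith) hTr hTmr hH hγ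
    hR.step_le_lam (norm_nonneg _) hmean
  rw [← hint] at hrate
  rw [← hint2] at hmrate
  have hll := log_mul_log_ge hTr hTmr
  have hP1 : 0 ≤ p.cγ ^ 2 / (lm ^ 2 * (T : ℝ) ^ 2) := by positivity
  have hP2 : 0 ≤ p.cγ ^ 4 * C ^ 2 / (lm ^ 4 * p.H) := by positivity
  have hP3 : 0 ≤ p.cγ ^ 4 * C ^ 2 / (lm ^ 4 * p.Tmax) := by positivity
  have hll0 : 0 ≤ Real.log T * Real.log p.Tmax := by positivity
  rw [pow_one]
  refine ⟨memLp_criticIterate M p hk hE g ⟨B, hB⟩, hrate.trans ?_, fun hTH => hrate.trans ?_,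
    hmrate.trans ?_⟩
  · have e1 : p.cγ ^ 4 * C ^ 2 / lm ^ 4 * (1 / p.H + 1 / p.Tmax)
        = p.cγ ^ 4 * C ^ 2 / (lm ^ 4 * p.H) + p.cγ ^ 4 * C ^ 2 / (lm ^ 4 * p.Tmax) := by
      field_simp
    rw [e1]
    gcongr
    norm_num
  · have hTHr : (p.Tmax : ℝ) ≤ p.H := by exact_mod_cast hTH
    have e1 : p.cγ ^ 4 * C ^ 2 / (lm ^ 4 * p.H) ≤ p.cγ ^ 4 * C ^ 2 / (lm ^ 4 * p.Tmax) := by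
      gcongr
    nlinarith [mul_nonneg hll0 hP1, mul_nonneg hll0 (sub_nonneg.2 e1)]
  · gcongr
    norm_num
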